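/- Let $z$ be a random vector in $\mathbb{R}^d$ and $s$ a random variable with values in a standard Borel space $S$. Write $p(z,s)$ for their joint law, with marginals $p(z)$, $p(s)$ and conditional law $p(s\mid z)$. Let $q(\cdot\mid z)$ be a Markov kernel from $\mathbb{R}^d$ to $S$, and let $\tilde s$ be drawn from $q(\cdot\mid z)$. Let $\varepsilon\sim\mathcal N(0,I_d)$ be independent of $(z,s)$ and of $(z,\tilde s)$. For $\gamma\in\mathbb{R}$ put $z_\gamma=\sqrt{\sigma(\gamma)}\,z+\sqrt{\sigma(-\gamma)}\,\varepsilon$, where $\sigma(x)=1/(1+e^{-x})$. Let $\hat\varepsilon(y,\gamma,t)=\mathbb{E}[\varepsilon\mid z_\gamma=y,\,s=t]$ be the minimum mean square error (MMSE) estimator of $\varepsilon$ given $(z_\gamma,s)$; the same function $\hat\varepsilon$ is also evaluated at $\tilde s$. Assume that the mutual information $I(z;s)=D_{\mathrm{KL}}(p(z,s)\,\|\,p(z)\otimes p(s))$ and the quantities $\mathbb{E}_z[D_{\mathrm{KL}}(q(\cdot\mid z)\,\|\,p(s\mid z))]$ and $\mathbb{E}_z[D_{\mathrm{KL}}(q(\cdot\mid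 z)\,\|\,p(s))]$ are finite. Then $$-I(z;s)=\frac12\int_{-\infty}^{\infty}\Big(\mathbb{E}\big[\|\varepsilon-\hat\varepsilon(z_\gamma,\gamma,s)\|^2\big]-\mathbb{E}\big[\|\varepsilon-\hat\varepsilon(z_\gamma,\gamma,\tilde s)\|^2\big]\Big)\,d\gamma+\mathbb{E}_z\Big[D_{\mathrm{KL}}\big(q(\cdot\mid z)\,\|\,p(s\mid z)\big)-D_{\mathrm{KL}}\big(q(\cdot\mid z)\,\|\,p(s)\big)\Big],$$ where both error expectations are finite for every $\gamma$, and the integrand in $\gamma$ and the integrand of the expectation over $z$ are absolutely integrable. -/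

import Mathlib

open MeasureTheory ProbabilityTheory InformationTheory
open scoped ENNReal

noncomputable section

/-- The variance-preserving Gaussian channel `√σ(γ) z + √σ(-γ) ε` at log signal-to-noise
ratio `γ`, where `σ` is the sigmoid function. -/
def vpNoise {d : ℕ} (γ : ℝ) (z ε : EuclideanSpace ℝ (Fin d)) : EuclideanSpace ℝ (Fin d) :=
  √(Real.sigmoid γ) • z + √(Real.sigmoid (-γ)) • ε

variable {Ω : Type*} [MeasurableSpace Ω] {S : Type*} [MeasurableSpace S] {d : ℕ}

/-- The mutual information of `X` and `Y`: the Kullback-Leibler divergence of their joint law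
from the product of their laws. -/
def mutualInformation {A B : Type*} [MeasurableSpace A] [MeasurableSpace B]
    (μ : Measure Ω) (X : Ω → A) (Y : Ω → B) : ℝ≥0∞ :=
  klDiv (μ.map fun ω => (X ω, Y ω)) ((μ.map X).prod (μ.map Y))

/-- The minimum mean square error estimator of the noise `ε` given the noisy observation of `z`
at level `γ` and given `s`, as a function of the observed values `(y, t)`: the mean of the
conditional law of `ε` given that the noisy observation is `y` and that `s` is `t`. -/
def mmseDenoiser (μ : Measure Ω) [IsFiniteMeasure μ] (z ε : Ω → EuclideanSpace ℝ (Fin d))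
    (s : Ω → S) (γ : ℝ) (y : EuclideanSpace ℝ (Fin d)) (t : S) : EuclideanSpace ℝ (Fin d) :=
  ∫ e, e ∂(condDistrib ε (fun ω => (vpNoise γ (z ω) (ε ω), s ω)) μ (y, t))

/-- The squared error `‖ε - ε̂(z_γ, γ, s')‖²` of the estimator that was built from the joint law of
`(z, s, ε)`, when it is given the conditioning variable `s'` in the place of `s`. -/
def denoisingSqError (μ : Measure Ω) [IsFiniteMeasure μ] (z ε : Ω → EuclideanSpace ℝ (Fin d))
    (s s' : Ω → S) (γ : ℝ) (ω : Ω) : ℝ :=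
  ‖ε ω - mmseDenoiser μ z ε s γ (vpNoise γ (z ω) (ε ω)) (s' ω)‖ ^ 2

/-- The gap between the mean square denoising error with the true conditioning variable `s` and
the one with the negative conditioning variable `s'`, for the same estimator. -/
def denoisingGap (μ : Measure Ω) [IsFiniteMeasure μ] (z ε : Ω → EuclideanSpace ℝ (Fin d))
    (s s' : Ω → S) (γ : ℝ) : ℝ :=
  (∫ ω, denoisingSqError μ z ε s s γ ω ∂μ) - ∫ ω, denoisingSqError μ z ε s s' γ ω ∂μ

end

open Filter Topology
open scoped NNReal

/-! ### Smoothing a measure by the Gaussian channel -/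

/-! Dividing `z_γ` by `√σ(γ)` gives the additive channel `y = x + exp (-γ/2) e`. For a prior `P` let
`n_P(y)` be the posterior mean of `e`. Everything rests on one identity for probability measures
with finite `KL(Q‖P)`: it equals `½ ∫ E_Q ‖n_Q(y) - n_P(y)‖² dγ` (`klDiv_eq_lintegral_dissipation`).

To prove it, let `H(γ)` be the relative entropy of the smoothed measures. Smoothed densities solve a
heat equation, and `n_P` is a multiple of the score (`noiseEst_apply`). Hence the entropy density
has `γ`-derivative half the dissipation minus a multiple of its own Laplacian
(`hasDerivAt_klDensity`). Cutoffs remove the Laplacian, so `H` grows exactly by the dissipation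
(`lintegral_klDensity_add_dissipation`). As `γ → -∞` the observation carries no information and `H →
0` (`tendsto_lintegral_klDensity_atBot`); as `γ → ∞` the posterior concentrates at the signal and `H
→ KL(Q‖P)` (`lintegral_klFun_le_iSup`).

Averaged over a condition, the chain rule turns this into `KL(p(s,z) ‖ ν ⊗ κ) = KL(p(s) ‖ ν) + ½ ∫ E
‖n_{p(z|s)} - n_κ‖² dγ` (`klDiv_map_eq_add_lintegral_sq_noiseEst_sub`). It is used three times with
`ν = p(s)`: for `s̃` with `κ = p(z|s)`, for `s̃` with `κ = p(z)`, and for `s` with `κ = p(z)`.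
Disintegrating the same pair laws over `z` instead, the left sides are `E KL(q‖p(s|z))`, `E
KL(q‖p(s))` and `I(z;s)`. The term `KL(p(s̃)‖p(s))` cancels between the first two and is zero in the
third. By orthogonality (`integral_sq_norm_sub_noiseEst`) each squared distance is a difference of
mean square errors; in the combination the errors of the `p(z|s̃)` and `p(z)` estimators cancel and
the denoising gap remains.

No moment of `z` is assumed. Smoothing needs only boundedness of quadratic weights times a Gaussian,
and square integrability of a mismatched estimate comes from finite relative entropy and a Gaussian
exponential moment (`lintegral_smoothDensity_mul_sq_noiseEst_le`). -/

/-- The density at `v` of the Gaussian law on `ℝᵈ` with covariance `exp (-γ) • 1`. -/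
noncomputable def heatKernel {d : ℕ} (γ : ℝ) (v : EuclideanSpace ℝ (Fin d)) : ℝ :=
  (2 * Real.pi) ^ (-(d / 2 : ℝ)) * Real.exp (γ * d / 2 - Real.exp γ * ‖v‖ ^ 2 / 2)

/-- The integral `∫ k (y - x) g (y - x) ρ(dx)`, where `g` is the Gaussian density at level `γ`. -/
noncomputable def gaussMoment {d : ℕ} (ρ : Measure (EuclideanSpace ℝ (Fin d)))
    (k : EuclideanSpace ℝ (Fin d) → ℝ) (γ : ℝ) (y : EuclideanSpace ℝ (Fin d)) : ℝ :=
  ∫ x, k (y - x) * heatKernel γ (y - x) ∂ρ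

section Smoothing

variable {d : ℕ}

lemma heatKernel_pos (γ : ℝ) (v : EuclideanSpace ℝ (Fin d)) : 0 < heatKernel γ v := by
  unfold heatKernel; positivity

lemma continuous_heatKernel : Continuous fun p : ℝ × (EuclideanSpace ℝ (Fin d)) => heatKernel p.1 p.2 := by
  unfold heatKernel; fun_prop

lemma continuous_heatKernel_right (γ : ℝ) : Continuous fun v : EuclideanSpace ℝ (Fin d) => heatKernel γ v := by
  unfold heatKernel; fun_prop

/-- A bound of `(1 + ‖v‖²) * heatKernel γ v` that is uniform in `v`. -/
noncomputable def heatBound (d : ℕ) (γ : ℝ) : ℝ :=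
  (2 * Real.pi) ^ (-(d / 2 : ℝ)) * Real.exp (γ * d / 2) * (1 + 2 * Real.exp (-γ))

lemma continuous_heatBound : Continuous (heatBound d) := by
  unfold heatBound; fun_prop

lemma one_add_sq_mul_heatKernel_le (γ : ℝ) (v : EuclideanSpace ℝ (Fin d)) :
    (1 + ‖v‖ ^ 2) * heatKernel γ v ≤ heatBound d γ := by
  unfold heatKernel heatBound
  rw [sub_eq_add_neg, Real.exp_add]
  have key : (1 + ‖v‖ ^ 2) * Real.exp (-(Real.exp γ * ‖v‖ ^ 2 / 2)) ≤ 1 + 2 * Real.exp (-γ) := by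
    set t := Real.exp γ * ‖v‖ ^ 2 / 2 with ht
    have ht0 : 0 ≤ t := by positivity
    have h1 : Real.exp (-t) ≤ 1 := Real.exp_le_one_iff.2 (by linarith)
    have h2 : t * Real.exp (-t) ≤ 1 := by
      rw [Real.exp_neg, ← div_eq_mul_inv, div_le_one (Real.exp_pos t)]
      linarith [Real.add_one_le_exp t]
    have h3 : ‖v‖ ^ 2 = 2 * Real.exp (-γ) * t := by
      rw [ht, Real.exp_neg]; field_simp
    rw [h3, add_mul, one_mul, mul_assoc]
    have : 2 * Real.exp (-γ) * (t * Real.exp (-t)) ≤ 2 * Real.exp (-γ) * 1 := by gcongr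
    linarith
  calc _ = ((2 * Real.pi) ^ (-(d / 2 : ℝ)) * Real.exp (γ * d / 2)) *
      ((1 + ‖v‖ ^ 2) * Real.exp (-(Real.exp γ * ‖v‖ ^ 2 / 2))) := by ring
    _ ≤ _ := by gcongr

/-- The domination behind every differentiation under the integral below. It is uniform in `v`,
hence integrable for every finite `ρ`, whatever its moments. -/
lemma abs_mul_heatKernel_le {k : EuclideanSpace ℝ (Fin d) → ℝ} {C : ℝ} (hk : ∀ v, |k v| ≤ C * (1 + ‖v‖ ^ 2))
    (γ : ℝ) (v : EuclideanSpace ℝ (Fin d)) : ‖k v * heatKernel γ v‖ ≤ C * heatBound d γ := by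
  have hC : 0 ≤ C := by
    by_contra! h
    have h1 := (abs_nonneg _).trans (hk 0)
    simp at h1
    linarith
  rw [norm_mul, Real.norm_eq_abs, Real.norm_eq_abs, abs_of_pos (heatKernel_pos γ v)]
  calc _ ≤ C * (1 + ‖v‖ ^ 2) * heatKernel γ v :=
        mul_le_mul_of_nonneg_right (hk v) (heatKernel_pos γ v).le
    _ = C * ((1 + ‖v‖ ^ 2) * heatKernel γ v) := by ring
    _ ≤ _ := mul_le_mul_of_nonneg_left (one_add_sq_mul_heatKernel_le γ v) hC

variable {ρ : Measure (EuclideanSpace ℝ (Fin d))} {k : EuclideanSpace ℝ (Fin d) → ℝ} {C : ℝ}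

lemma aestronglyMeasurable_mul_heatKernel (hc : Continuous k) (γ : ℝ) (y : EuclideanSpace ℝ (Fin d)) :
    AEStronglyMeasurable (fun x => k (y - x) * heatKernel γ (y - x)) ρ := by
  have := continuous_heatKernel_right (d := d) γ
  exact Continuous.aestronglyMeasurable (by fun_prop)

lemma integrable_mul_heatKernel [IsFiniteMeasure ρ] (hc : Continuous k) (hk : ∀ v, |k v| ≤ C * (1 + ‖v‖ ^ 2))
    (γ : ℝ) (y : EuclideanSpace ℝ (Fin d)) : Integrable (fun x => k (y - x) * heatKernel γ (y - x)) ρ :=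
  Integrable.of_bound (aestronglyMeasurable_mul_heatKernel hc γ y) (C * heatBound d γ)
    (ae_of_all _ fun x => abs_mul_heatKernel_le hk γ (y - x))

lemma eventually_heatBound_le (γ : ℝ) : ∀ᶠ t in 𝓝 γ, heatBound d t ≤ heatBound d γ + 1 :=
  (continuous_heatBound.tendsto γ).eventually_le_const (by linarith)

lemma continuous_gaussMoment [IsFiniteMeasure ρ] (hc : Continuous k) (hC : 0 ≤ C)
    (hk : ∀ v, |k v| ≤ C * (1 + ‖v‖ ^ 2)) :
    Continuous fun p : ℝ × (EuclideanSpace ℝ (Fin d)) => gaussMoment ρ k p.1 p.2 := by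
  refine continuous_iff_continuousAt.2 fun p => ?_
  refine continuousAt_of_dominated (bound := fun _ => C * (heatBound d p.1 + 1)) ?_ ?_
    (integrable_const _) ?_
  · exact .of_forall fun q => aestronglyMeasurable_mul_heatKernel hc _ _
  · filter_upwards [continuousAt_fst.eventually (eventually_heatBound_le (d := d) p.1)] with q hq
    exact ae_of_all _ fun x => (abs_mul_heatKernel_le hk q.1 (q.2 - x)).trans (by gcongr)
  · refine ae_of_all _ fun x => ?_
    have := continuous_heatKernel (d := d)
    have h2 : Continuous fun q : ℝ × (EuclideanSpace ℝ (Fin d)) => heatKernel q.1 (q.2 - x) :=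
      this.comp (f := fun q : ℝ × (EuclideanSpace ℝ (Fin d)) => (q.1, q.2 - x)) (by fun_prop)
    exact Continuous.continuousAt (by fun_prop)

lemma hasLineDerivAt_heatKernel (γ : ℝ) (v : EuclideanSpace ℝ (Fin d)) (i : Fin d) :
    HasLineDerivAt ℝ (heatKernel γ) (-(Real.exp γ * v i) * heatKernel γ v) v
      (EuclideanSpace.single i 1) := by
  unfold HasLineDerivAt
  have h1 : HasDerivAt (fun t : ℝ => ‖v + t • EuclideanSpace.single i (1 : ℝ)‖ ^ 2) (2 * v i) 0 := by
    have h : ∀ t : ℝ, ‖v + t • EuclideanSpace.single i (1 : ℝ)‖ ^ 2 =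
        ‖v‖ ^ 2 + 2 * (t * v i) + t ^ 2 := by
      intro t
      rw [norm_add_sq_real, inner_smul_right, norm_smul, EuclideanSpace.inner_single_right]
      simp
    simp_rw [h]
    have := (((hasDerivAt_id (0 : ℝ)).mul_const (v i)).const_mul 2).const_add (‖v‖ ^ 2) |>.add
      ((hasDerivAt_id (0 : ℝ)).pow 2)
    convert! this using 1
    simp
  have h2 := (((h1.const_mul (Real.exp γ)).div_const 2).const_sub (γ * d / 2)).exp.const_mul
    ((2 * Real.pi) ^ (-(d / 2 : ℝ)))
  unfold heatKernel
  convert! h2 using 1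
  simp only [zero_smul, add_zero]
  ring

lemma hasDerivAt_heatKernel (γ : ℝ) (v : EuclideanSpace ℝ (Fin d)) :
    HasDerivAt (fun t => heatKernel t v)
      ((d / 2 - Real.exp γ / 2 * ‖v‖ ^ 2) * heatKernel γ v) γ := by
  unfold heatKernel
  have h2 := ((((hasDerivAt_id γ).mul_const (d : ℝ)).div_const 2).sub
    (((Real.hasDerivAt_exp γ).mul_const (‖v‖ ^ 2)).div_const 2)).exp.const_mul
    ((2 * Real.pi) ^ (-(d / 2 : ℝ)))
  convert! h2 using 1
  simp only [id, Pi.sub_apply]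
  ring

/-- Differentiating an integral along a line requires the derivative of the integrand at every
parameter, not only at zero; a translation of the base point supplies it. -/
lemma HasLineDerivAt.hasDerivAt_line {E : Type*} [NormedAddCommGroup E] [NormedSpace ℝ E]
    {f : E → ℝ} {f' : ℝ} {y e : E} {t : ℝ} (h : HasLineDerivAt ℝ f f' (y + t • e) e) :
    HasDerivAt (fun u : ℝ => f (y + u • e)) f' t := by
  unfold HasLineDerivAt at h
  have h0 : HasDerivAt (fun u : ℝ => f (y + t • e + u • e)) f' (t - t) := by rwa [sub_self]
  have h3 := h0.comp_sub_const t t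
  refine h3.congr_of_eventuallyEq (.of_forall fun u => ?_)
  simp only [add_assoc, ← add_smul, add_sub_cancel]

lemma HasLineDerivAt.mul_real {E : Type*} [NormedAddCommGroup E] [NormedSpace ℝ E]
    {f g : E → ℝ} {f' g' : ℝ} {y e : E} (hf : HasLineDerivAt ℝ f f' y e)
    (hg : HasLineDerivAt ℝ g g' y e) :
    HasLineDerivAt ℝ (fun v => f v * g v) (f' * g y + f y * g') y e := by
  unfold HasLineDerivAt at *
  have := hf.mul hg
  simp only [zero_smul, add_zero] at this
  exact this

/-- The product rule replaces the weight `k` by `k' - exp γ * v i * k`. The new weight must again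
grow at most quadratically; this covers `k = 1` and `k = v i`, which is all that two spatial
derivatives require. -/
lemma hasLineDerivAt_gaussMoment [IsFiniteMeasure ρ] {k' : EuclideanSpace ℝ (Fin d) → ℝ} {γ : ℝ} {C' : ℝ} (i : Fin d)
    (hc : Continuous k) (hk : ∀ v, |k v| ≤ C * (1 + ‖v‖ ^ 2))
    (hd : ∀ v, HasLineDerivAt ℝ k (k' v) v (EuclideanSpace.single i 1))
    (hc' : Continuous k')
    (hk' : ∀ v, |k' v - Real.exp γ * v i * k v| ≤ C' * (1 + ‖v‖ ^ 2))
    (y : EuclideanSpace ℝ (Fin d)) :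
    HasLineDerivAt ℝ (gaussMoment ρ k γ)
      (gaussMoment ρ (fun v => k' v - Real.exp γ * v i * k v) γ y) y
      (EuclideanSpace.single i 1) := by
  set e : EuclideanSpace ℝ (Fin d) := EuclideanSpace.single i 1 with he
  clear_value e
  have hprod : ∀ v : EuclideanSpace ℝ (Fin d), HasLineDerivAt ℝ (fun v => k v * heatKernel γ v)
      ((k' v - Real.exp γ * v i * k v) * heatKernel γ v) v e := by
    intro v
    have := (hd v).mul_real (he ▸ hasLineDerivAt_heatKernel γ v i)
    convert! this using 1
    ring
  have key := hasDerivAt_integral_of_dominated_loc_of_deriv_le (μ := ρ) (𝕜 := ℝ)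
    (F := fun t x => k (y - x + t • e) * heatKernel γ (y - x + t • e))
    (F' := fun t x => (k' (y - x + t • e) - Real.exp γ * (y - x + t • e) i * k (y - x + t • e))
      * heatKernel γ (y - x + t • e)) (x₀ := 0) (s := Set.univ)
    (bound := fun _ => C' * heatBound d γ)
    Filter.univ_mem (.of_forall fun t => ?_) ?_ ?_
    (ae_of_all _ fun x t _ => abs_mul_heatKernel_le hk' γ _)
    (integrable_const _) (ae_of_all _ fun x t _ => (hprod _).hasDerivAt_line)
  · have h2 := key.2
    simp only [zero_smul, add_zero] at h2
    unfold HasLineDerivAt gaussMoment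
    simpa only [add_sub_right_comm] using h2
  · simpa only [add_sub_right_comm] using
      aestronglyMeasurable_mul_heatKernel (ρ := ρ) hc γ (y + t • e)
  · simpa using integrable_mul_heatKernel (ρ := ρ) hc hk γ y
  · simpa using aestronglyMeasurable_mul_heatKernel (ρ := ρ)
      (k := fun v => k' v - Real.exp γ * v i * k v) (by fun_prop) γ y

lemma hasDerivAt_gaussMoment [IsFiniteMeasure ρ] (hc : Continuous k)
    (hk : ∀ v, |k v| ≤ C * (1 + ‖v‖ ^ 2)) {γ₀ C' : ℝ} (hC' : 0 ≤ C')
    (hk' : ∀ γ ∈ Metric.ball γ₀ 1, ∀ v : EuclideanSpace ℝ (Fin d),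
      |(d / 2 - Real.exp γ / 2 * ‖v‖ ^ 2) * k v| ≤ C' * (1 + ‖v‖ ^ 2))
    (y : EuclideanSpace ℝ (Fin d)) :
    HasDerivAt (fun γ => gaussMoment ρ k γ y)
      (gaussMoment ρ (fun v => (d / 2 - Real.exp γ₀ / 2 * ‖v‖ ^ 2) * k v) γ₀ y) γ₀ := by
  -- On this neighbourhood both the kernel bound and the growth constant `C'` of the differentiated
  -- weight are uniform in the level.
  have hs : {t | heatBound d t ≤ heatBound d γ₀ + 1} ∩ Metric.ball γ₀ 1 ∈ 𝓝 γ₀ :=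
    Filter.inter_mem (eventually_heatBound_le γ₀) (Metric.ball_mem_nhds _ one_pos)
  refine (hasDerivAt_integral_of_dominated_loc_of_deriv_le (μ := ρ) (𝕜 := ℝ)
    (F := fun γ x => k (y - x) * heatKernel γ (y - x))
    (F' := fun γ x => ((d / 2 - Real.exp γ / 2 * ‖y - x‖ ^ 2) * k (y - x)) * heatKernel γ (y - x))
    (bound := fun _ => C' * (heatBound d γ₀ + 1)) hs
    (.of_forall fun t => aestronglyMeasurable_mul_heatKernel hc t y)
    (integrable_mul_heatKernel hc hk _ _) ?_ ?_ (integrable_const _) ?_).2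
  · exact aestronglyMeasurable_mul_heatKernel
      (k := fun v => (d / 2 - Real.exp γ₀ / 2 * ‖v‖ ^ 2) * k v) (by fun_prop) _ _
  · refine ae_of_all _ fun x t ht => ?_
    refine (abs_mul_heatKernel_le (hk' t ht.2) t (y - x)).trans ?_
    have : heatBound d t ≤ heatBound d γ₀ + 1 := ht.1
    gcongr
  · refine ae_of_all _ fun x t ht => ?_
    have := (hasDerivAt_heatKernel t (y - x)).const_mul (k (y - x))
    convert! this using 1
    ring

lemma gaussMoment_const_mul (c : ℝ) (γ : ℝ) (y : EuclideanSpace ℝ (Fin d)) :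
    gaussMoment ρ (fun v => c * k v) γ y = c * gaussMoment ρ k γ y := by
  unfold gaussMoment
  simp_rw [mul_assoc]
  exact integral_const_mul _ _

lemma gaussMoment_add [IsFiniteMeasure ρ] {k₂ : EuclideanSpace ℝ (Fin d) → ℝ} {C₂ : ℝ} (hc : Continuous k)
    (hk : ∀ v, |k v| ≤ C * (1 + ‖v‖ ^ 2)) (hc₂ : Continuous k₂)
    (hk₂ : ∀ v, |k₂ v| ≤ C₂ * (1 + ‖v‖ ^ 2)) (γ : ℝ) (y : EuclideanSpace ℝ (Fin d)) :
    gaussMoment ρ (fun v => k v + k₂ v) γ y = gaussMoment ρ k γ y + gaussMoment ρ k₂ γ y := by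
  unfold gaussMoment
  simp_rw [add_mul]
  exact integral_add (integrable_mul_heatKernel hc hk γ y) (integrable_mul_heatKernel hc₂ hk₂ γ y)

/-- The density at `y` of the law `ρ` smoothed by the Gaussian channel at level `γ`. -/
noncomputable def smoothDensity (ρ : Measure (EuclideanSpace ℝ (Fin d))) (γ : ℝ)
    (y : EuclideanSpace ℝ (Fin d)) : ℝ :=
  gaussMoment ρ (fun _ => 1) γ y

/-- The `i`-th partial derivative of `smoothDensity`. -/
noncomputable def smoothGrad (ρ : Measure (EuclideanSpace ℝ (Fin d))) (i : Fin d) (γ : ℝ)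
    (y : EuclideanSpace ℝ (Fin d)) : ℝ :=
  -(Real.exp γ * gaussMoment ρ (fun v => v i) γ y)

/-- The second partial derivative of `smoothDensity` in the `i`-th direction. -/
noncomputable def smoothHess (ρ : Measure (EuclideanSpace ℝ (Fin d))) (i : Fin d) (γ : ℝ)
    (y : EuclideanSpace ℝ (Fin d)) : ℝ :=
  Real.exp γ * (Real.exp γ * gaussMoment ρ (fun v => v i ^ 2) γ y - smoothDensity ρ γ y)

lemma abs_apply_le (v : EuclideanSpace ℝ (Fin d)) (i : Fin d) : |v i| ≤ ‖v‖ := by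
  simpa using PiLp.norm_apply_le v i

lemma abs_one_le (v : EuclideanSpace ℝ (Fin d)) : |(1 : ℝ)| ≤ 1 * (1 + ‖v‖ ^ 2) := by
  simp

lemma abs_apply_le_one_add_sq (i : Fin d) (v : EuclideanSpace ℝ (Fin d)) :
    |v i| ≤ 1 * (1 + ‖v‖ ^ 2) := by
  nlinarith [abs_apply_le v i, sq_nonneg (‖v‖ - 1)]

lemma abs_apply_sq_le_one_add_sq (i : Fin d) (v : EuclideanSpace ℝ (Fin d)) :
    |v i ^ 2| ≤ 1 * (1 + ‖v‖ ^ 2) := by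
  rw [abs_pow]
  nlinarith [abs_apply_le v i, abs_nonneg (v i), norm_nonneg v]

lemma integrable_heatKernel [IsFiniteMeasure ρ] (γ : ℝ) (y : EuclideanSpace ℝ (Fin d)) :
    Integrable (fun x => heatKernel γ (y - x)) ρ := by
  simpa using integrable_mul_heatKernel (ρ := ρ) continuous_const abs_one_le γ y

lemma smoothDensity_eq (γ : ℝ) (y : EuclideanSpace ℝ (Fin d)) :
    smoothDensity ρ γ y = ∫ x, heatKernel γ (y - x) ∂ρ := by
  simp [smoothDensity, gaussMoment]

lemma smoothDensity_nonneg (γ : ℝ) (y : EuclideanSpace ℝ (Fin d)) : 0 ≤ smoothDensity ρ γ y := by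
  rw [smoothDensity_eq]
  exact integral_nonneg fun x => (heatKernel_pos _ _).le

lemma smoothDensity_pos [IsFiniteMeasure ρ] [NeZero ρ] (γ : ℝ) (y : EuclideanSpace ℝ (Fin d)) :
    0 < smoothDensity ρ γ y := by
  rw [smoothDensity_eq]
  refine (integral_pos_iff_support_of_nonneg (fun x => (heatKernel_pos _ _).le)
    (integrable_heatKernel γ y)).2 ?_
  have : Function.support (fun x => heatKernel γ (y - x)) = Set.univ := by
    ext x; simp [(heatKernel_pos γ (y - x)).ne']
  rw [this]
  exact Measure.measure_univ_pos.2 (NeZero.ne ρ)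

lemma continuous_smoothDensity [IsFiniteMeasure ρ] :
    Continuous fun p : ℝ × EuclideanSpace ℝ (Fin d) => smoothDensity ρ p.1 p.2 :=
  continuous_gaussMoment continuous_const zero_le_one abs_one_le

lemma continuous_smoothGrad [IsFiniteMeasure ρ] (i : Fin d) :
    Continuous fun p : ℝ × EuclideanSpace ℝ (Fin d) => smoothGrad ρ i p.1 p.2 := by
  have := continuous_gaussMoment (ρ := ρ) (k := fun v : EuclideanSpace ℝ (Fin d) => v i)
    (by fun_prop) zero_le_one (abs_apply_le_one_add_sq i)
  unfold smoothGrad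
  fun_prop

lemma continuous_smoothHess [IsFiniteMeasure ρ] (i : Fin d) :
    Continuous fun p : ℝ × EuclideanSpace ℝ (Fin d) => smoothHess ρ i p.1 p.2 := by
  have := continuous_gaussMoment (ρ := ρ) (k := fun v : EuclideanSpace ℝ (Fin d) => v i ^ 2)
    (by fun_prop) zero_le_one (abs_apply_sq_le_one_add_sq i)
  have := continuous_smoothDensity (ρ := ρ)
  unfold smoothHess
  fun_prop

lemma hasLineDerivAt_smoothDensity [IsFiniteMeasure ρ] (i : Fin d) (γ : ℝ)
    (y : EuclideanSpace ℝ (Fin d)) :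
    HasLineDerivAt ℝ (smoothDensity ρ γ) (smoothGrad ρ i γ y) y (EuclideanSpace.single i 1) := by
  have := hasLineDerivAt_gaussMoment (ρ := ρ) (k := fun _ => 1) (k' := fun _ => 0) (γ := γ)
    (C := 1) (C' := Real.exp γ) i (by fun_prop) abs_one_le
    (fun v => hasDerivAt_const _ _) (by fun_prop) (fun v => ?_) y
  · convert! this using 1
    unfold smoothGrad
    rw [← neg_mul, ← gaussMoment_const_mul]
    congr 1
    ext v; ring
  · have := abs_apply_le_one_add_sq i v
    rw [zero_sub, abs_neg, mul_one, abs_mul, abs_of_pos (Real.exp_pos γ)]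
    nlinarith [Real.exp_pos γ]

lemma hasLineDerivAt_apply (i : Fin d) (v : EuclideanSpace ℝ (Fin d)) :
    HasLineDerivAt ℝ (fun v : EuclideanSpace ℝ (Fin d) => v i) 1 v
      (EuclideanSpace.single i 1) := by
  unfold HasLineDerivAt
  have := (hasDerivAt_id (0 : ℝ)).const_add (v i)
  simpa using this

lemma hasLineDerivAt_smoothGrad [IsFiniteMeasure ρ] (i : Fin d) (γ : ℝ)
    (y : EuclideanSpace ℝ (Fin d)) :
    HasLineDerivAt ℝ (smoothGrad ρ i γ) (smoothHess ρ i γ y) y (EuclideanSpace.single i 1) := by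
  have := hasLineDerivAt_gaussMoment (ρ := ρ) (k := fun v : EuclideanSpace ℝ (Fin d) => v i)
    (k' := fun _ => 1) (γ := γ) (C := 1) (C' := 1 + Real.exp γ) i (by fun_prop)
    (abs_apply_le_one_add_sq i) (fun v => hasLineDerivAt_apply i v) (by fun_prop) (fun v => ?_) y
  · have h2 := HasDerivAt.const_mul (-Real.exp γ) this
    unfold HasLineDerivAt
    convert! h2 using 1
    · ext t; simp [smoothGrad]
    · have h3 := gaussMoment_add (ρ := ρ) (k := fun _ => 1)
        (k₂ := fun v : EuclideanSpace ℝ (Fin d) => -Real.exp γ * v i ^ 2) (C₂ := Real.exp γ)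
        continuous_const abs_one_le (by fun_prop) (fun v => ?_) γ y
      · rw [gaussMoment_const_mul] at h3
        have h4 : (fun v : EuclideanSpace ℝ (Fin d) => 1 - Real.exp γ * v i * v i) =
          fun v => 1 + -Real.exp γ * v i ^ 2 := by ext v; ring
        rw [h4, h3, smoothHess, smoothDensity]
        ring
      · have := abs_apply_sq_le_one_add_sq i v
        rw [abs_mul, abs_neg, abs_of_pos (Real.exp_pos γ)]
        nlinarith [Real.exp_pos γ]
  · have := abs_apply_sq_le_one_add_sq i v
    have h5 := abs_one_le v
    rw [mul_assoc, ← sq]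
    refine (abs_sub _ _).trans ?_
    rw [abs_mul, abs_of_pos (Real.exp_pos γ)]
    nlinarith [Real.exp_pos γ]

/-- The smoothed densities solve the heat equation. -/
lemma hasDerivAt_smoothDensity [IsFiniteMeasure ρ] (γ : ℝ) (y : EuclideanSpace ℝ (Fin d)) :
    HasDerivAt (fun t => smoothDensity ρ t y)
      (-(Real.exp (-γ) / 2) * ∑ i, smoothHess ρ i γ y) γ := by
  -- In `C'`, `exp (γ + 1)` bounds `exp t` on the unit ball around `γ`.
  have := hasDerivAt_gaussMoment (ρ := ρ) (k := fun _ => 1) (C := 1) (γ₀ := γ)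
    (C' := d / 2 + Real.exp (γ + 1) / 2) continuous_const abs_one_le (by positivity) ?_ y
  · convert! this using 1
    -- Writing `‖v‖²` as a sum of squares matches the weight of the `γ`-derivative with the sum of
    -- the weights `exp γ * (exp γ * v i ^ 2 - 1)` of the second derivatives, up to the factor `-exp
    -- (-γ) / 2`.
    have h1 : gaussMoment ρ (fun v => (d / 2 - Real.exp γ / 2 * ‖v‖ ^ 2) * 1) γ y =
        d / 2 * smoothDensity ρ γ y - Real.exp γ / 2 * ∑ i, gaussMoment ρ (fun v => v i ^ 2) γ y := by
      rw [smoothDensity]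
      unfold gaussMoment
      rw [← integral_const_mul, ← integral_finsetSum, ← integral_const_mul, ← integral_sub]
      · congr 1
        ext x
        beta_reduce
        rw [EuclideanSpace.real_norm_sq_eq, ← Finset.sum_mul]
        ring
      · exact (integrable_mul_heatKernel continuous_const abs_one_le γ y).const_mul _
      · exact (integrable_finsetSum _ fun i _ => integrable_mul_heatKernel (by fun_prop)
          (abs_apply_sq_le_one_add_sq i) γ y).const_mul _
      · exact fun i _ => integrable_mul_heatKernel (by fun_prop)
          (abs_apply_sq_le_one_add_sq i) γ y
    rw [h1]
    simp only [smoothHess, mul_sub, Finset.sum_sub_distrib, ← Finset.mul_sum, Finset.sum_const,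
      Finset.card_univ, Fintype.card_fin, nsmul_eq_mul]
    rw [Real.exp_neg]
    field_simp
    ring
  · intro t ht v
    rw [mul_one]
    have ht' : Real.exp t ≤ Real.exp (γ + 1) := by
      rw [Metric.mem_ball, Real.dist_eq, abs_lt] at ht
      exact Real.exp_le_exp.2 (by linarith)
    refine (abs_sub _ _).trans ?_
    rw [abs_of_nonneg (by positivity), abs_of_nonneg (by positivity)]
    have h0 : (0 : ℝ) ≤ d := by positivity
    nlinarith [sq_nonneg ‖v‖, mul_le_mul_of_nonneg_right ht' (sq_nonneg ‖v‖),
      mul_nonneg h0 (sq_nonneg ‖v‖), Real.exp_pos (γ + 1)]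

/-- The posterior mean of the standardized noise at the observation `y`, when the prior is
proportional to `ρ`. -/
noncomputable def noiseEst (ρ : Measure (EuclideanSpace ℝ (Fin d))) (γ : ℝ)
    (y : EuclideanSpace ℝ (Fin d)) : EuclideanSpace ℝ (Fin d) :=
  (smoothDensity ρ γ y)⁻¹ • ∫ x, heatKernel γ (y - x) • Real.exp (γ / 2) • (y - x) ∂ρ

lemma integrable_heatKernel_smul [IsFiniteMeasure ρ] (γ : ℝ) (y : EuclideanSpace ℝ (Fin d)) :
    Integrable (fun x => heatKernel γ (y - x) • Real.exp (γ / 2) • (y - x)) ρ := by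
  have h : Integrable (fun x => heatKernel γ (y - x) • (y - x)) ρ := by
    have hc := continuous_heatKernel_right (d := d) γ
    refine Integrable.of_bound (Continuous.aestronglyMeasurable (by fun_prop))
      (1 * heatBound d γ) (ae_of_all _ fun x => ?_)
    have := abs_mul_heatKernel_le (k := fun v : EuclideanSpace ℝ (Fin d) => ‖v‖) (C := 1)
      (fun v => by
        rw [abs_norm]; nlinarith [sq_nonneg (‖v‖ - 1)]) γ (y - x)
    rw [norm_smul, mul_comm]
    simpa using this
  refine (h.smul (Real.exp (γ / 2))).congr (ae_of_all _ fun x => ?_)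
  simp only [Pi.smul_apply]
  exact smul_comm _ _ _

/-- Tweedie's formula. The gradient of the Gaussian density is `-exp γ • v` times the density, so
averaging the noise `exp (γ / 2) • (y - x)` over the posterior gives a multiple of the score. -/
lemma noiseEst_apply [IsFiniteMeasure ρ] (γ : ℝ) (y : EuclideanSpace ℝ (Fin d)) (i : Fin d) :
    noiseEst ρ γ y i = -(Real.exp (-(γ / 2)) * (smoothGrad ρ i γ y / smoothDensity ρ γ y)) := by
  have h1 : (∫ x, heatKernel γ (y - x) • Real.exp (γ / 2) • (y - x) ∂ρ) i =
      Real.exp (γ / 2) * gaussMoment ρ (fun v => v i) γ y := by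
    have := (EuclideanSpace.proj (𝕜 := ℝ) i).integral_comp_comm
      (integrable_heatKernel_smul (ρ := ρ) γ y)
    refine this.symm.trans ?_
    rw [gaussMoment, ← integral_const_mul]
    congr 1
    ext x
    simp only [PiLp.proj_apply, PiLp.smul_apply, smul_eq_mul]
    ring
  unfold noiseEst
  rw [PiLp.smul_apply, h1, smoothGrad, smul_eq_mul]
  have h2 : Real.exp γ = Real.exp (γ / 2) * Real.exp (γ / 2) := by
    rw [← Real.exp_add]; ring_nf
  rw [h2, Real.exp_neg]
  field_simp

end Smoothing

/-! ### The entropy density of two smoothed measures and its evolution equation -/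

section Dissipation

variable {d : ℕ}

/-- Two integrations by parts. The compact supports of `χ` and its derivatives make all products
integrable, so `f` needs no decay. -/
lemma integral_mul_secondLineDeriv {f g h χ χ₁ χ₂ : EuclideanSpace ℝ (Fin d) → ℝ}
    {e : EuclideanSpace ℝ (Fin d)}
    (hf : Continuous f) (hg : Continuous g) (hh : Continuous h)
    (hfg : ∀ y, HasLineDerivAt ℝ f (g y) y e) (hgh : ∀ y, HasLineDerivAt ℝ g (h y) y e)
    (hχ : Continuous χ) (hχ₁ : Continuous χ₁) (hχ₂ : Continuous χ₂)
    (sχ : HasCompactSupport χ) (sχ₁ : HasCompactSupport χ₁) (sχ₂ : HasCompactSupport χ₂)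
    (dχ : ∀ y, HasLineDerivAt ℝ χ (χ₁ y) y e) (dχ₁ : ∀ y, HasLineDerivAt ℝ χ₁ (χ₂ y) y e) :
    ∫ y, χ y * h y = ∫ y, χ₂ y * f y := by
  have int {a b : EuclideanSpace ℝ (Fin d) → ℝ} (ha : Continuous a) (sa : HasCompactSupport a)
      (hb : Continuous b) : Integrable fun y => a y * b y :=
    (ha.mul hb).integrable_of_hasCompactSupport (sa.mul_right)
  have h1 := integral_bilinear_hasLineDerivAt_right_eq_neg_left_of_integrable (μ := volume)
    (f := χ) (f' := χ₁) (g := g) (g' := h) (v := e) (B := ContinuousLinearMap.mul ℝ ℝ)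
    (int hχ₁ sχ₁ hg) (int hχ sχ hh) (int hχ sχ hg) (fun x _ => dχ x) (fun x _ => hgh x)
  have h2 := integral_bilinear_hasLineDerivAt_right_eq_neg_left_of_integrable (μ := volume)
    (f := χ₁) (f' := χ₂) (g := f) (g' := g) (v := e) (B := ContinuousLinearMap.mul ℝ ℝ)
    (int hχ₂ sχ₂ hf) (int hχ₁ sχ₁ hg) (int hχ₁ sχ₁ hf) (fun x _ => dχ₁ x) (fun x _ => hfg x)
  simp only [ContinuousLinearMap.mul_apply'] at h1 h2
  rw [h1, h2, neg_neg]

/-- A sequence of smooth cutoff functions that increases to `1`, with second derivatives that tend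
to zero uniformly. -/
lemma exists_cutoff (d : ℕ) : ∃ (χ : ℕ → EuclideanSpace ℝ (Fin d) → ℝ)
    (χ₁ χ₂ : ℕ → Fin d → EuclideanSpace ℝ (Fin d) → ℝ) (c : ℕ → ℝ),
    (∀ n, Continuous (χ n) ∧ HasCompactSupport (χ n)) ∧
    (∀ n i, Continuous (χ₁ n i) ∧ HasCompactSupport (χ₁ n i)) ∧
    (∀ n i, Continuous (χ₂ n i) ∧ HasCompactSupport (χ₂ n i)) ∧
    (∀ n i y, HasLineDerivAt ℝ (χ n) (χ₁ n i y) y (EuclideanSpace.single i 1)) ∧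
    (∀ n i y, HasLineDerivAt ℝ (χ₁ n i) (χ₂ n i y) y (EuclideanSpace.single i 1)) ∧
    (∀ n y, 0 ≤ χ n y ∧ χ n y ≤ 1) ∧ (∀ y, Tendsto (fun n => χ n y) atTop (𝓝 1)) ∧
    (∀ n i y, |χ₂ n i y| ≤ c n) ∧ Tendsto c atTop (𝓝 0) := by
  let b : ContDiffBump (0 : EuclideanSpace ℝ (Fin d)) := ⟨1, 2, one_pos, one_lt_two⟩
  let e : Fin d → EuclideanSpace ℝ (Fin d) := fun i => EuclideanSpace.single i 1
  let b₁ : Fin d → EuclideanSpace ℝ (Fin d) → ℝ := fun i y => fderiv ℝ b y (e i)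
  let b₂ : Fin d → EuclideanSpace ℝ (Fin d) → ℝ := fun i y => fderiv ℝ (b₁ i) y (e i)
  have hb : ContDiff ℝ 2 b := b.contDiff
  have hb₁ : ∀ i, ContDiff ℝ 1 (b₁ i) := fun i =>
    (hb.fderiv_right (m := 1) (by norm_num)).clm_apply contDiff_const
  have hb₂ : ∀ i, ContDiff ℝ 0 (b₂ i) := fun i =>
    ((hb₁ i).fderiv_right (m := 0) (by norm_num)).clm_apply contDiff_const
  have sb : HasCompactSupport b := b.hasCompactSupport
  have sb₁ : ∀ i, HasCompactSupport (b₁ i) := fun i => sb.fderiv_apply ℝ (e i)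
  have sb₂ : ∀ i, HasCompactSupport (b₂ i) := fun i => (sb₁ i).fderiv_apply ℝ (e i)
  have bound : ∀ i, ∃ C, ∀ y, |b₂ i y| ≤ C := fun i =>
    (sb₂ i).exists_bound_of_continuous (hb₂ i).continuous
  choose C hC using bound
  -- Composing one bump function with the dilation by `r n` multiplies its second derivatives by `r
  -- n ^ 2`. This is the source of the decay of `c n`; the sum over `i` there makes the constant
  -- independent of the direction.
  let r : ℕ → ℝ := fun n => ((n : ℝ) + 1)⁻¹
  have hr : ∀ n, 0 < r n := fun n => by positivity
  have hr0 : Tendsto r atTop (𝓝 0) := by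
    simpa [r, one_div] using tendsto_one_div_add_atTop_nhds_zero_nat (𝕜 := ℝ)
  have scale {a a' : EuclideanSpace ℝ (Fin d) → ℝ} {v : EuclideanSpace ℝ (Fin d)}
      (ha : ∀ y, HasLineDerivAt ℝ a (a' y) y v) (n : ℕ) (y : EuclideanSpace ℝ (Fin d)) :
      HasLineDerivAt ℝ (fun y => a (r n • y)) (r n * a' (r n • y)) y v := by
    have h0 : HasDerivAt (fun u : ℝ => a (r n • y + u • v)) (a' (r n • y)) (r n * 0) := by
      rw [mul_zero]; exact ha _
    have := h0.comp 0 ((hasDerivAt_id (0 : ℝ)).const_mul (r n))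
    unfold HasLineDerivAt
    convert! this using 1
    · ext t; simp [smul_add, mul_smul]
    · ring
  have hd {a : EuclideanSpace ℝ (Fin d) → ℝ} (ha : ContDiff ℝ 1 a) (v y : EuclideanSpace ℝ (Fin d)) :
      HasLineDerivAt ℝ a (fderiv ℝ a y v) y v :=
    ((ha.differentiable (by norm_num)) y).hasFDerivAt.hasLineDerivAt v
  have supp {a : EuclideanSpace ℝ (Fin d) → ℝ} (ha : HasCompactSupport a) (n : ℕ) :
      HasCompactSupport fun y => a (r n • y) := ha.comp_smul (hr n).ne'
  refine ⟨fun n y => b (r n • y), fun n i y => r n * b₁ i (r n • y),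
    fun n i y => r n * (r n * b₂ i (r n • y)), fun n => r n * (r n * ∑ i, |C i|), ?_, ?_, ?_, ?_, ?_,
    ?_, ?_, ?_, ?_⟩
  · exact fun n => ⟨hb.continuous.comp (continuous_const_smul _), supp sb n⟩
  · exact fun n i => ⟨continuous_const.mul ((hb₁ i).continuous.comp (continuous_const_smul _)),
      (supp (sb₁ i) n).mul_left⟩
  · exact fun n i => ⟨continuous_const.mul (continuous_const.mul
      ((hb₂ i).continuous.comp (continuous_const_smul _))), ((supp (sb₂ i) n).mul_left).mul_left⟩
  · exact fun n i y => scale (fun y => hd (hb.of_le (by norm_num)) (e i) y) n y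
  · exact fun n i y => HasDerivAt.const_mul (r n) (scale (fun y => hd (hb₁ i) (e i) y) n y)
  · exact fun n y => ⟨b.nonneg, b.le_one⟩
  · intro y
    have h1 : Tendsto (fun n => r n • y) atTop (𝓝 0) := by simpa using hr0.smul_const y
    refine tendsto_const_nhds.congr' ?_
    filter_upwards [h1.eventually (Metric.ball_mem_nhds 0 one_pos)] with n hn
    exact (b.one_of_mem_closedBall (Metric.ball_subset_closedBall hn)).symm
  · intro n i y
    rw [abs_mul, abs_mul, abs_of_pos (hr n)]
    have : |b₂ i (r n • y)| ≤ ∑ i, |C i| := (hC i _).trans <| (le_abs_self _).trans <|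
      Finset.single_le_sum (f := fun i => |C i|) (fun _ _ => abs_nonneg _) (Finset.mem_univ i)
    exact mul_le_mul_of_nonneg_left (mul_le_mul_of_nonneg_left this (hr n).le) (hr n).le
  · simpa using hr0.mul (hr0.mul_const (∑ i, |C i|))

/-- The integrand of the Kullback-Leibler divergence between two smoothed measures. -/
noncomputable def klDensity (ρ η : Measure (EuclideanSpace ℝ (Fin d))) (γ : ℝ)
    (y : EuclideanSpace ℝ (Fin d)) : ℝ :=
  smoothDensity ρ γ y * (Real.log (smoothDensity ρ γ y) - Real.log (smoothDensity η γ y))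
    + smoothDensity η γ y - smoothDensity ρ γ y

/-- The `i`-th partial derivative of `klDensity`. -/
noncomputable def klDensityGrad (ρ η : Measure (EuclideanSpace ℝ (Fin d))) (i : Fin d) (γ : ℝ)
    (y : EuclideanSpace ℝ (Fin d)) : ℝ :=
  smoothGrad ρ i γ y * (Real.log (smoothDensity ρ γ y) - Real.log (smoothDensity η γ y))
    + smoothGrad η i γ y * (1 - smoothDensity ρ γ y / smoothDensity η γ y)

/-- The second partial derivative of `klDensity` in the `i`-th direction. -/
noncomputable def klDensityHess (ρ η : Measure (EuclideanSpace ℝ (Fin d))) (i : Fin d) (γ : ℝ)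
    (y : EuclideanSpace ℝ (Fin d)) : ℝ :=
  smoothHess ρ i γ y * (Real.log (smoothDensity ρ γ y) - Real.log (smoothDensity η γ y))
    + smoothHess η i γ y * (1 - smoothDensity ρ γ y / smoothDensity η γ y)
    + smoothDensity ρ γ y * (smoothGrad ρ i γ y / smoothDensity ρ γ y
      - smoothGrad η i γ y / smoothDensity η γ y) ^ 2

/-- The dissipation rate of `klDensity`: the squared distance between the two noise estimates,
weighted by the first smoothed density. -/
noncomputable def dissipation (ρ η : Measure (EuclideanSpace ℝ (Fin d))) (γ : ℝ)
    (y : EuclideanSpace ℝ (Fin d)) : ℝ :=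
  smoothDensity ρ γ y * ‖noiseEst ρ γ y - noiseEst η γ y‖ ^ 2

variable {ρ η : Measure (EuclideanSpace ℝ (Fin d))}

/-- By Tweedie's formula the squared distance of the noise estimates is `exp (-γ)` times that of the
scores, so the dissipation is the density of a relative Fisher information. -/
lemma dissipation_eq [IsFiniteMeasure ρ] [IsFiniteMeasure η] (γ : ℝ) (y : EuclideanSpace ℝ (Fin d)) :
    dissipation ρ η γ y = Real.exp (-γ) * ∑ i, smoothDensity ρ γ y *
      (smoothGrad ρ i γ y / smoothDensity ρ γ y - smoothGrad η i γ y / smoothDensity η γ y) ^ 2 := by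
  rw [dissipation, EuclideanSpace.real_norm_sq_eq, Finset.mul_sum, Finset.mul_sum]
  refine Finset.sum_congr rfl fun i _ => ?_
  have h : Real.exp (-γ) = Real.exp (-(γ / 2)) ^ 2 := by rw [sq, ← Real.exp_add]; ring_nf
  rw [PiLp.sub_apply, noiseEst_apply, noiseEst_apply, h]
  ring

lemma dissipation_nonneg (γ : ℝ) (y : EuclideanSpace ℝ (Fin d)) : 0 ≤ dissipation ρ η γ y :=
  mul_nonneg (smoothDensity_nonneg _ _) (sq_nonneg _)

variable [IsFiniteMeasure ρ] [IsFiniteMeasure η] [NeZero ρ] [NeZero η]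

lemma continuous_dissipation :
    Continuous fun p : ℝ × EuclideanSpace ℝ (Fin d) => dissipation ρ η p.1 p.2 := by
  simp_rw [dissipation_eq]
  have h1 := continuous_smoothDensity (ρ := ρ)
  have h2 := continuous_smoothDensity (ρ := η)
  have h3 := continuous_smoothGrad (ρ := ρ)
  have h4 := continuous_smoothGrad (ρ := η)
  have p1 (p : ℝ × EuclideanSpace ℝ (Fin d)) := (smoothDensity_pos (ρ := ρ) p.1 p.2).ne'
  have p2 (p : ℝ × EuclideanSpace ℝ (Fin d)) := (smoothDensity_pos (ρ := η) p.1 p.2).ne'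
  fun_prop (disch := assumption)

lemma continuous_klDensity :
    Continuous fun p : ℝ × EuclideanSpace ℝ (Fin d) => klDensity ρ η p.1 p.2 := by
  have h1 := continuous_smoothDensity (ρ := ρ)
  have h2 := continuous_smoothDensity (ρ := η)
  have p1 (p : ℝ × EuclideanSpace ℝ (Fin d)) := (smoothDensity_pos (ρ := ρ) p.1 p.2).ne'
  have p2 (p : ℝ × EuclideanSpace ℝ (Fin d)) := (smoothDensity_pos (ρ := η) p.1 p.2).ne'
  unfold klDensity
  fun_prop (disch := assumption)

lemma continuous_klDensityGrad (i : Fin d) :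
    Continuous fun p : ℝ × EuclideanSpace ℝ (Fin d) => klDensityGrad ρ η i p.1 p.2 := by
  have h1 := continuous_smoothDensity (ρ := ρ)
  have h2 := continuous_smoothDensity (ρ := η)
  have h3 := continuous_smoothGrad (ρ := ρ)
  have h4 := continuous_smoothGrad (ρ := η)
  have p1 (p : ℝ × EuclideanSpace ℝ (Fin d)) := (smoothDensity_pos (ρ := ρ) p.1 p.2).ne'
  have p2 (p : ℝ × EuclideanSpace ℝ (Fin d)) := (smoothDensity_pos (ρ := η) p.1 p.2).ne'
  unfold klDensityGrad
  fun_prop (disch := assumption)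

lemma continuous_klDensityHess (i : Fin d) :
    Continuous fun p : ℝ × EuclideanSpace ℝ (Fin d) => klDensityHess ρ η i p.1 p.2 := by
  have h1 := continuous_smoothDensity (ρ := ρ)
  have h2 := continuous_smoothDensity (ρ := η)
  have h3 := continuous_smoothGrad (ρ := ρ)
  have h4 := continuous_smoothGrad (ρ := η)
  have h5 := continuous_smoothHess (ρ := ρ)
  have h6 := continuous_smoothHess (ρ := η)
  have p1 (p : ℝ × EuclideanSpace ℝ (Fin d)) := (smoothDensity_pos (ρ := ρ) p.1 p.2).ne'
  have p2 (p : ℝ × EuclideanSpace ℝ (Fin d)) := (smoothDensity_pos (ρ := η) p.1 p.2).ne'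
  unfold klDensityHess
  fun_prop (disch := assumption)

/-- The same computation serves for the derivatives of `klDensity` in space and in `γ`. -/
lemma hasDerivAt_relEntropy {a b : ℝ → ℝ} {a' b' t : ℝ} (ha : HasDerivAt a a' t)
    (hb : HasDerivAt b b' t) (ha0 : 0 < a t) (hb0 : 0 < b t) :
    HasDerivAt (fun u => a u * (Real.log (a u) - Real.log (b u)) + b u - a u)
      (a' * (Real.log (a t) - Real.log (b t)) + b' * (1 - a t / b t)) t := by
  have := ((ha.mul ((ha.log ha0.ne').sub (hb.log hb0.ne'))).add hb).sub ha
  convert! this using 1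
  simp only [Pi.sub_apply]
  field_simp
  ring

lemma hasLineDerivAt_klDensity (i : Fin d) (γ : ℝ) (y : EuclideanSpace ℝ (Fin d)) :
    HasLineDerivAt ℝ (klDensity ρ η γ) (klDensityGrad ρ η i γ y) y
      (EuclideanSpace.single i 1) := by
  have := hasDerivAt_relEntropy (hasLineDerivAt_smoothDensity (ρ := ρ) i γ y)
    (hasLineDerivAt_smoothDensity (ρ := η) i γ y) (smoothDensity_pos _ _) (smoothDensity_pos _ _)
  simp only [zero_smul, add_zero] at this
  exact this

lemma hasLineDerivAt_klDensityGrad (i : Fin d) (γ : ℝ) (y : EuclideanSpace ℝ (Fin d)) :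
    HasLineDerivAt ℝ (klDensityGrad ρ η i γ) (klDensityHess ρ η i γ y) y
      (EuclideanSpace.single i 1) := by
  have p1 := smoothDensity_pos (ρ := ρ) γ y
  have p2 := smoothDensity_pos (ρ := η) γ y
  have p1' : smoothDensity ρ γ (y + (0 : ℝ) • EuclideanSpace.single i 1) ≠ 0 :=
    (smoothDensity_pos _ _).ne'
  have p2' : smoothDensity η γ (y + (0 : ℝ) • EuclideanSpace.single i 1) ≠ 0 :=
    (smoothDensity_pos _ _).ne'
  have ha := hasLineDerivAt_smoothDensity (ρ := ρ) i γ y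
  have hb := hasLineDerivAt_smoothDensity (ρ := η) i γ y
  have ha1 := hasLineDerivAt_smoothGrad (ρ := ρ) i γ y
  have hb1 := hasLineDerivAt_smoothGrad (ρ := η) i γ y
  unfold HasLineDerivAt at *
  have := (ha1.mul ((ha.log p1').sub (hb.log p2'))).add (hb1.mul ((ha.div hb p2').const_sub 1))
  convert! this using 1
  simp only [zero_smul, add_zero, Pi.sub_apply, Pi.div_apply, klDensityHess]
  field_simp
  ring

/-- Both densities solve the same heat equation. The terms of `klDensityHess` that are linear in the
second derivatives therefore reproduce the `γ`-derivative, and the surplus square in the Laplacian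
is the dissipation. -/
lemma hasDerivAt_klDensity (γ : ℝ) (y : EuclideanSpace ℝ (Fin d)) :
    HasDerivAt (fun t => klDensity ρ η t y)
      (dissipation ρ η γ y / 2 - Real.exp (-γ) / 2 * ∑ i, klDensityHess ρ η i γ y) γ := by
  have := hasDerivAt_relEntropy (hasDerivAt_smoothDensity (ρ := ρ) γ y)
    (hasDerivAt_smoothDensity (ρ := η) γ y) (smoothDensity_pos _ _) (smoothDensity_pos _ _)
  convert! this using 1
  simp only [klDensityHess, Finset.sum_add_distrib, ← Finset.sum_mul, dissipation_eq]
  ring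

/-- The correction by the difference of the densities turns the entropy integrand into `klFun` of
the ratio, which is nonnegative pointwise. The cutoff estimates depend on that sign. -/
lemma klDensity_eq (γ : ℝ) (y : EuclideanSpace ℝ (Fin d)) :
    klDensity ρ η γ y =
      smoothDensity η γ y * klFun (smoothDensity ρ γ y / smoothDensity η γ y) := by
  have p1 := smoothDensity_pos (ρ := ρ) γ y
  have p2 := smoothDensity_pos (ρ := η) γ y
  rw [klDensity, klFun_apply, Real.log_div p1.ne' p2.ne']
  field_simp

lemma klDensity_nonneg (γ : ℝ) (y : EuclideanSpace ℝ (Fin d)) : 0 ≤ klDensity ρ η γ y := by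
  rw [klDensity_eq]
  exact mul_nonneg (smoothDensity_nonneg _ _)
    (klFun_nonneg (div_nonneg (smoothDensity_nonneg _ _) (smoothDensity_nonneg _ _)))

end Dissipation

/-! ### Auxiliary facts on cutoffs -/

lemma tendsto_lintegral_ofReal_mul_cutoff {α : Type*} [MeasurableSpace α] {μ : Measure α}
    {χ : ℕ → α → ℝ} {h : α → ℝ} (hχm : ∀ n, Measurable (χ n)) (hm : Measurable h)
    (hχ : ∀ n x, 0 ≤ χ n x ∧ χ n x ≤ 1) (hlim : ∀ x, Tendsto (fun n => χ n x) atTop (𝓝 1))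
    (h0 : ∀ x, 0 ≤ h x) :
    Tendsto (fun n => ∫⁻ x, ENNReal.ofReal (χ n x * h x) ∂μ) atTop
      (𝓝 (∫⁻ x, ENNReal.ofReal (h x) ∂μ)) := by
  -- Fatou gives the lower bound and `χ n ≤ 1` the upper one, so neither monotonicity of the cutoffs
  -- nor integrability of `h` is used.
  refine tendsto_of_le_liminf_of_limsup_le ?_ ?_
  · calc ∫⁻ x, ENNReal.ofReal (h x) ∂μ
        = ∫⁻ x, liminf (fun n => ENNReal.ofReal (χ n x * h x)) atTop ∂μ := by
          refine lintegral_congr fun x => ?_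
          have : Tendsto (fun n => ENNReal.ofReal (χ n x * h x)) atTop
              (𝓝 (ENNReal.ofReal (h x))) := by
            have := ENNReal.tendsto_ofReal ((hlim x).mul_const (h x))
            rwa [one_mul] at this
          exact this.liminf_eq.symm
      _ ≤ _ := lintegral_liminf_le fun n => by fun_prop
  · refine limsup_le_of_le (h := .of_forall fun n => lintegral_mono fun x => ?_)
    exact ENNReal.ofReal_le_ofReal (mul_le_of_le_one_left (h0 x) (hχ n x).2)

lemma integrable_prod_of_eq_zero_off_compact {X : Type*} [TopologicalSpace X] [MeasurableSpace X]
    [OpensMeasurableSpace X] [SecondCountableTopology X] [T2Space X]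
    {μ : Measure X} [SFinite μ]
    [IsFiniteMeasureOnCompacts μ] {F : ℝ × X → ℝ} (hF : Continuous F) {K : Set X}
    (hK : IsCompact K) (h0 : ∀ p, p.2 ∉ K → F p = 0) (a b : ℝ) :
    Integrable F ((volume.restrict (Set.Ioc a b)).prod μ) := by
  have h1 : IntegrableOn F (Set.Icc a b ×ˢ K) (volume.prod μ) := by
    have hc : IsCompact (Set.Icc a b ×ˢ K) := isCompact_Icc.prod hK
    refine IntegrableOn.of_bound ?_ hF.aestronglyMeasurable
      (hc.exists_bound_of_continuousOn hF.continuousOn).choose ?_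
    · rw [Measure.prod_prod]
      exact ENNReal.mul_lt_top isCompact_Icc.measure_lt_top hK.measure_lt_top
    · refine (ae_restrict_iff' (measurableSet_Icc.prod hK.measurableSet)).2 (ae_of_all _ ?_)
      exact (hc.exists_bound_of_continuousOn hF.continuousOn).choose_spec
  have h2 : IntegrableOn F (Set.Ioc a b ×ˢ Set.univ) (volume.prod μ) := by
    refine h1.of_forall_sdiff_eq_zero (measurableSet_Ioc.prod MeasurableSet.univ) ?_
    rintro ⟨t, y⟩ ⟨ht, hy⟩
    refine h0 _ fun hyK => hy ⟨Set.Ioc_subset_Icc_self ht.1, hyK⟩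
  rwa [IntegrableOn, ← Measure.prod_restrict, Measure.restrict_univ] at h2

/-! ### Growth of the relative entropy between two noise levels -/

section EnergyIdentity

variable {d : ℕ} {ρ η : Measure (EuclideanSpace ℝ (Fin d))} [IsFiniteMeasure ρ]
  [IsFiniteMeasure η] [NeZero ρ] [NeZero η]

/-- The evolution equation tested against `χ`: integrate it in `γ` at each `y`, exchange the
integrals, and move the Laplacian onto the cutoff. The last term is the error that a growing cutoff
must eliminate. -/
lemma integral_cutoff_klDensity_sub {χ : EuclideanSpace ℝ (Fin d) → ℝ}
    {χ₁ χ₂ : Fin d → EuclideanSpace ℝ (Fin d) → ℝ}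
    (hχ : Continuous χ ∧ HasCompactSupport χ)
    (hχ₁ : ∀ i, Continuous (χ₁ i) ∧ HasCompactSupport (χ₁ i))
    (hχ₂ : ∀ i, Continuous (χ₂ i) ∧ HasCompactSupport (χ₂ i))
    (dχ : ∀ i y, HasLineDerivAt ℝ χ (χ₁ i y) y (EuclideanSpace.single i 1))
    (dχ₁ : ∀ i y, HasLineDerivAt ℝ (χ₁ i) (χ₂ i y) y (EuclideanSpace.single i 1))
    {a b : ℝ} (hab : a ≤ b) :
    ∫ y, χ y * (klDensity ρ η b y - klDensity ρ η a y) =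
      (∫ p, χ p.2 * (dissipation ρ η p.1 p.2 / 2) ∂(volume.restrict (Set.Ioc a b)).prod volume) -
      ∫ γ in Set.Ioc a b, Real.exp (-γ) / 2 * ∑ i, ∫ y, χ₂ i y * klDensity ρ η γ y := by
  have cD := continuous_dissipation (ρ := ρ) (η := η)
  have cH := continuous_klDensityHess (ρ := ρ) (η := η)
  have cK := continuous_klDensity (ρ := ρ) (η := η)
  have cG := continuous_klDensityGrad (ρ := ρ) (η := η)
  have hχc := hχ.1
  have fix {F : ℝ × EuclideanSpace ℝ (Fin d) → ℝ} (hF : Continuous F) (γ : ℝ) :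
    Continuous fun y => F (γ, y) := by fun_prop
  set T : ℝ × EuclideanSpace ℝ (Fin d) → ℝ := fun p => dissipation ρ η p.1 p.2 / 2 -
    Real.exp (-p.1) / 2 * ∑ i, klDensityHess ρ η i p.1 p.2 with hT
  have cT : Continuous T := by fun_prop
  have hoff {F : ℝ × EuclideanSpace ℝ (Fin d) → ℝ} (hF : Continuous F) :
      Integrable (fun p : ℝ × EuclideanSpace ℝ (Fin d) => χ p.2 * F p)
        ((volume.restrict (Set.Ioc a b)).prod volume) := by
    refine integrable_prod_of_eq_zero_off_compact (by fun_prop) (K := tsupport χ) hχ.2 ?_ a b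
    intro p hp
    rw [image_eq_zero_of_notMem_tsupport hp, zero_mul]
  have ftc (y : EuclideanSpace ℝ (Fin d)) :
      klDensity ρ η b y - klDensity ρ η a y = ∫ γ in Set.Ioc a b, T (γ, y) := by
    rw [← intervalIntegral.integral_of_le hab]
    refine (intervalIntegral.integral_eq_sub_of_hasDerivAt
      (fun γ _ => hasDerivAt_klDensity γ y) ?_).symm
    exact Continuous.intervalIntegrable (u := fun γ => T (γ, y)) (by fun_prop) a b
  calc ∫ y, χ y * (klDensity ρ η b y - klDensity ρ η a y)
      = ∫ y, ∫ γ in Set.Ioc a b, χ y * T (γ, y) := by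
        congr 1; ext y; rw [ftc, integral_const_mul]
    _ = ∫ p, χ p.2 * T p ∂(volume.restrict (Set.Ioc a b)).prod volume :=
        (integral_prod_symm _ (hoff cT)).symm
    _ = (∫ p, χ p.2 * (dissipation ρ η p.1 p.2 / 2)
          ∂(volume.restrict (Set.Ioc a b)).prod volume) -
        ∫ p, χ p.2 * (Real.exp (-p.1) / 2 * ∑ i, klDensityHess ρ η i p.1 p.2)
          ∂(volume.restrict (Set.Ioc a b)).prod volume := by
        rw [← integral_sub (hoff (F := fun p => dissipation ρ η p.1 p.2 / 2) (by fun_prop))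
          (hoff (F := fun p => Real.exp (-p.1) / 2 * ∑ i, klDensityHess ρ η i p.1 p.2)
            (by fun_prop))]
        congr 1; ext p; rw [hT]; ring
    _ = _ := by
        congr 1
        rw [integral_prod _ (hoff (F := fun p => Real.exp (-p.1) / 2 *
          ∑ i, klDensityHess ρ η i p.1 p.2) (by fun_prop))]
        congr 1; ext γ
        simp_rw [mul_left_comm (χ _), integral_const_mul]
        congr 1
        simp_rw [Finset.mul_sum]
        rw [integral_finsetSum]
        · refine Finset.sum_congr rfl fun i _ => ?_
          exact integral_mul_secondLineDeriv (fix cK γ) (fix (cG i) γ) (fix (cH i) γ)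
            (hasLineDerivAt_klDensity i γ) (hasLineDerivAt_klDensityGrad i γ) hχ.1 (hχ₁ i).1
            (hχ₂ i).1 hχ.2 (hχ₁ i).2 (hχ₂ i).2 (dχ i) (dχ₁ i)
        · intro i _
          exact (hχ.1.mul (fix (cH i) γ)).integrable_of_hasCompactSupport hχ.2.mul_right

/-- Along the Gaussian channel the relative entropy between two smoothed measures increases at a
rate given by the squared distance between the noise estimates. -/
theorem lintegral_klDensity_add_dissipation {K : ℝ}
    (hint : ∀ γ, Integrable (klDensity ρ η γ)) (hK : ∀ γ, ∫ y, klDensity ρ η γ y ≤ K)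
    {a b : ℝ} (hab : a ≤ b) :
    (∫⁻ y, ENNReal.ofReal (klDensity ρ η a y)) +
      ∫⁻ γ in Set.Ioc a b, ∫⁻ y, ENNReal.ofReal (dissipation ρ η γ y / 2) =
    ∫⁻ y, ENNReal.ofReal (klDensity ρ η b y) := by
  obtain ⟨χ, χ₁, χ₂, c, hχ, hχ₁, hχ₂, dχ, dχ₁, h01, hlim, hc, hc0⟩ := exists_cutoff d
  have cD := continuous_dissipation (ρ := ρ) (η := η)
  set π := (volume.restrict (Set.Ioc a b)).prod (volume : Measure (EuclideanSpace ℝ (Fin d)))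
  have c0 (n : ℕ) (i : Fin d) : 0 ≤ c n := (abs_nonneg _).trans (hc n i 0)
  have hlimI (γ : ℝ) : Tendsto (fun n => ∫ y, χ n y * klDensity ρ η γ y) atTop
      (𝓝 (∫ y, klDensity ρ η γ y)) := by
    refine tendsto_integral_of_dominated_convergence (klDensity ρ η γ)
      (fun n => (hχ n).1.aestronglyMeasurable.mul (hint γ).1) (hint γ) (fun n => ae_of_all _ ?_)
      (ae_of_all _ ?_)
    · intro y
      rw [norm_mul, Real.norm_eq_abs, Real.norm_eq_abs, abs_of_nonneg (h01 n y).1,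
        abs_of_nonneg (klDensity_nonneg γ y)]
      exact mul_le_of_le_one_left (klDensity_nonneg γ y) (h01 n y).2
    · intro y
      simpa using (hlim y).mul_const (klDensity ρ η γ y)
  have hintχ (n : ℕ) (γ : ℝ) : Integrable fun y => χ n y * klDensity ρ η γ y := by
    refine (hint γ).mono ((hχ n).1.aestronglyMeasurable.mul (hint γ).1) (ae_of_all _ fun y => ?_)
    rw [norm_mul, Real.norm_eq_abs, abs_of_nonneg (h01 n y).1]
    exact mul_le_of_le_one_left (norm_nonneg _) (h01 n y).2
  -- The entropies are at most `K` uniformly in `γ`, so the error is of the order of `c n` times the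
  -- length of the interval.
  have herr : Tendsto (fun n => ∫ γ in Set.Ioc a b, Real.exp (-γ) / 2 *
      ∑ i, ∫ y, χ₂ n i y * klDensity ρ η γ y) atTop (𝓝 0) := by
    have hb (n : ℕ) : ‖∫ γ in Set.Ioc a b, Real.exp (-γ) / 2 *
        ∑ i, ∫ y, χ₂ n i y * klDensity ρ η γ y‖ ≤
        (Real.exp (-a) / 2 * ∑ _i : Fin d, c n * K) * volume.real (Set.Ioc a b) := by
      refine norm_setIntegral_le_of_norm_le_const measure_Ioc_lt_top fun γ hγ => ?_
      rw [norm_mul, Real.norm_eq_abs, abs_of_pos (by positivity)]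
      have h1 : Real.exp (-γ) ≤ Real.exp (-a) := Real.exp_le_exp.2 (by linarith [hγ.1])
      have h2 : ‖∑ i, ∫ y, χ₂ n i y * klDensity ρ η γ y‖ ≤ ∑ _i : Fin d, c n * K := by
        refine norm_sum_le_of_le _ fun i _ => ?_
        calc ‖∫ y, χ₂ n i y * klDensity ρ η γ y‖ ≤ ∫ y, c n * klDensity ρ η γ y := by
              refine norm_integral_le_of_norm_le ((hint γ).const_mul _) (ae_of_all _ fun y => ?_)
              rw [norm_mul, Real.norm_eq_abs, Real.norm_eq_abs,
                abs_of_nonneg (klDensity_nonneg γ y)]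
              exact mul_le_mul_of_nonneg_right (hc n i y) (klDensity_nonneg γ y)
          _ = c n * ∫ y, klDensity ρ η γ y := integral_const_mul _ _
          _ ≤ c n * K := mul_le_mul_of_nonneg_left (hK γ) (c0 n i)
      gcongr
    refine squeeze_zero_norm hb ?_
    have : Tendsto (fun n => (Real.exp (-a) / 2 * ∑ _i : Fin d, c n * K) *
        volume.real (Set.Ioc a b)) atTop
        (𝓝 ((Real.exp (-a) / 2 * ∑ _i : Fin d, 0 * K) * volume.real (Set.Ioc a b))) :=
      ((tendsto_finsetSum _ fun i _ => hc0.mul_const K).const_mul _).mul_const _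
    simpa using this
  have hJ : Tendsto (fun n => ∫ p, χ n p.2 * (dissipation ρ η p.1 p.2 / 2) ∂π) atTop
      (𝓝 ((∫ y, klDensity ρ η b y) - ∫ y, klDensity ρ η a y)) := by
    have h1 := ((hlimI b).sub (hlimI a)).add herr
    rw [add_zero] at h1
    refine h1.congr fun n => ?_
    have h2 := integral_cutoff_klDensity_sub (ρ := ρ) (η := η) (hχ n) (hχ₁ n) (hχ₂ n) (dχ n)
      (dχ₁ n) hab
    simp_rw [mul_sub] at h2
    rw [integral_sub (hintχ n b) (hintχ n a)] at h2
    rw [h2, sub_add_cancel]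
  have hD0 (p : ℝ × EuclideanSpace ℝ (Fin d)) : 0 ≤ dissipation ρ η p.1 p.2 / 2 :=
    div_nonneg (dissipation_nonneg _ _) zero_le_two
  have hJ0 (n : ℕ) : 0 ≤ ∫ p, χ n p.2 * (dissipation ρ η p.1 p.2 / 2) ∂π :=
    integral_nonneg fun p => mul_nonneg (h01 n p.2).1 (hD0 p)
  have hlint : Tendsto (fun n => ∫⁻ p, ENNReal.ofReal
      (χ n p.2 * (dissipation ρ η p.1 p.2 / 2)) ∂π) atTop
      (𝓝 (∫⁻ p, ENNReal.ofReal (dissipation ρ η p.1 p.2 / 2) ∂π)) :=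
    tendsto_lintegral_ofReal_mul_cutoff (χ := fun n p => χ n p.2)
      (fun n => (hχ n).1.measurable.comp (f := Prod.snd) measurable_snd)
      (h := fun p : ℝ × EuclideanSpace ℝ (Fin d) => dissipation ρ η p.1 p.2 / 2)
      (cD.measurable.div_const 2) (fun n p => h01 n p.2) (fun p => hlim p.2) hD0
  -- The truncated integrals of the dissipation converge both to its full `lintegral` and to the
  -- entropy difference. Finiteness of the dissipation is thus a conclusion.
  have heq : ∫⁻ p, ENNReal.ofReal (dissipation ρ η p.1 p.2 / 2) ∂π =
      ENNReal.ofReal ((∫ y, klDensity ρ η b y) - ∫ y, klDensity ρ η a y) := by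
    refine tendsto_nhds_unique hlint ((ENNReal.tendsto_ofReal hJ).congr fun n => ?_)
    refine ofReal_integral_eq_lintegral_ofReal ?_
      (ae_of_all _ fun p => mul_nonneg (h01 n p.2).1 (hD0 p))
    have hχc := (hχ n).1
    refine integrable_prod_of_eq_zero_off_compact (by fun_prop) (K := tsupport (χ n)) (hχ n).2 ?_ a b
    intro p hp
    rw [image_eq_zero_of_notMem_tsupport hp, zero_mul]
  have hprod : ∫⁻ γ in Set.Ioc a b, ∫⁻ y, ENNReal.ofReal (dissipation ρ η γ y / 2) =
      ∫⁻ p, ENNReal.ofReal (dissipation ρ η p.1 p.2 / 2) ∂π :=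
    (lintegral_prod (fun p : ℝ × EuclideanSpace ℝ (Fin d) =>
      ENNReal.ofReal (dissipation ρ η p.1 p.2 / 2)) (by fun_prop)).symm
  have hdiff := ge_of_tendsto' hJ hJ0
  have h0 (γ : ℝ) : 0 ≤ ∫ y, klDensity ρ η γ y := integral_nonneg fun y => klDensity_nonneg γ y
  have hof (γ : ℝ) : ∫⁻ y, ENNReal.ofReal (klDensity ρ η γ y) =
      ENNReal.ofReal (∫ y, klDensity ρ η γ y) :=
    (ofReal_integral_eq_lintegral_ofReal (hint γ) (ae_of_all _ fun y => klDensity_nonneg γ y)).symm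
  rw [hprod, heq, hof, hof, ← ENNReal.ofReal_add (h0 a) hdiff, add_sub_cancel]

end EnergyIdentity

/-! ### The Gaussian channel as a change of variables; convexity of `klFun` -/

section Channel

variable {d : ℕ}

lemma integrable_heatKernel_volume (γ : ℝ) :
    Integrable (heatKernel γ : EuclideanSpace ℝ (Fin d) → ℝ) := by
  have h := GaussianFourier.integrable_cexp_neg_mul_sq_norm_add
    (b := ((Real.exp γ / 2 : ℝ) : ℂ)) (by
      rw [Complex.ofReal_re]; positivity) 0 (0 : EuclideanSpace ℝ (Fin d))
  have h2 := (h.norm.const_mul ((2 * Real.pi) ^ (-(d / 2 : ℝ)) * Real.exp (γ * d / 2)))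
  refine h2.congr (ae_of_all _ fun v => ?_)
  have e1 : -((Real.exp γ / 2 : ℝ) : ℂ) * (‖v‖ : ℂ) ^ 2 + 0 * (inner ℝ 0 v : ℝ) =
      ((-(Real.exp γ * ‖v‖ ^ 2 / 2) : ℝ) : ℂ) := by push_cast; ring
  simp only [e1, Complex.norm_exp_ofReal, heatKernel]
  rw [sub_eq_add_neg, Real.exp_add]
  ring

/-- Two finite measures are compared through their characteristic functions, both equal to `exp
(-exp (-γ) ‖t‖² / 2)`. The computation also verifies the normalisation of `heatKernel`. -/
lemma map_smul_stdGaussian (γ : ℝ) :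
    (stdGaussian (EuclideanSpace ℝ (Fin d))).map (fun e => Real.exp (-(γ / 2)) • e) =
      volume.withDensity fun v => ENNReal.ofReal (heatKernel γ v) := by
  have hm : Measurable (heatKernel γ : EuclideanSpace ℝ (Fin d) → ℝ) :=
    (continuous_heatKernel_right γ).measurable
  have : IsFiniteMeasure (volume.withDensity
      fun v : EuclideanSpace ℝ (Fin d) => ENNReal.ofReal (heatKernel γ v)) :=
    isFiniteMeasure_withDensity_ofReal (integrable_heatKernel_volume γ).2
  have : IsFiniteMeasure ((stdGaussian (EuclideanSpace ℝ (Fin d))).map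
      (fun e => Real.exp (-(γ / 2)) • e)) := inferInstance
  refine Measure.ext_of_charFun (funext fun t => ?_)
  rw [charFun_map_smul, charFun_stdGaussian, charFun_apply,
    integral_withDensity_eq_integral_toReal_smul (by fun_prop) (by simp)]
  have hb : 0 < ((Real.exp γ / 2 : ℝ) : ℂ).re := by rw [Complex.ofReal_re]; positivity
  have key := GaussianFourier.integral_cexp_neg_mul_sq_norm_add hb Complex.I t
  have e1 : ∀ v : EuclideanSpace ℝ (Fin d),
      (ENNReal.ofReal (heatKernel γ v)).toReal • Complex.exp (inner ℝ v t * Complex.I) =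
      (((2 * Real.pi) ^ (-(d / 2 : ℝ)) * Real.exp (γ * d / 2) : ℝ) : ℂ) *
        Complex.exp (-((Real.exp γ / 2 : ℝ) : ℂ) * ‖v‖ ^ 2 + Complex.I * inner ℝ t v) := by
    intro v
    rw [ENNReal.toReal_ofReal (heatKernel_pos γ v).le, heatKernel, Complex.real_smul,
      sub_eq_add_neg, Real.exp_add, Complex.exp_add, real_inner_comm v t]
    push_cast
    ring_nf
  simp_rw [e1]
  rw [integral_const_mul, key]
  have e2 : ((Real.pi : ℂ) / ((Real.exp γ / 2 : ℝ) : ℂ)) ^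
      (Module.finrank ℝ (EuclideanSpace ℝ (Fin d)) / 2 : ℂ) =
      (((2 * Real.pi) ^ (d / 2 : ℝ) * Real.exp (-(γ * d / 2)) : ℝ) : ℂ) := by
    have : (Real.pi : ℂ) / ((Real.exp γ / 2 : ℝ) : ℂ) =
        ((2 * Real.pi * Real.exp (-γ) : ℝ) : ℂ) := by
      rw [Real.exp_neg]; push_cast; field_simp
    rw [this, finrank_euclideanSpace, Fintype.card_fin]
    have h3 : ((d : ℂ) / 2) = ((d / 2 : ℝ) : ℂ) := by push_cast; rfl
    rw [h3, ← Complex.ofReal_cpow (by positivity), Real.mul_rpow (by positivity) (by positivity),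
      ← Real.exp_mul]
    ring_nf
  rw [e2, ← mul_assoc, ← Complex.ofReal_mul]
  have e3 : (2 * Real.pi) ^ (-(d / 2 : ℝ)) * Real.exp (γ * d / 2) *
      ((2 * Real.pi) ^ (d / 2 : ℝ) * Real.exp (-(γ * d / 2))) = 1 := by
    rw [mul_mul_mul_comm, ← Real.rpow_add (by positivity), ← Real.exp_add]
    simp
  rw [e3, Complex.ofReal_one, one_mul]
  congr 1
  have h4 : Real.exp γ * Real.exp (-(γ / 2)) ^ 2 = 1 := by
    rw [sq, ← Real.exp_add, ← Real.exp_add]; ring_nf; simp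
  have h5 : (Real.exp γ : ℂ) * (Real.exp (-(γ / 2)) : ℂ) ^ 2 = 1 := by exact_mod_cast h4
  rw [norm_smul, Real.norm_eq_abs, abs_of_pos (Real.exp_pos _), Complex.I_sq]
  push_cast at h5 ⊢
  have h6 : Complex.exp γ ≠ 0 := Complex.exp_ne_zero _
  field_simp
  linear_combination -4 * (‖t‖ : ℂ) ^ 2 * h5

lemma lintegral_channel (γ : ℝ) (x : EuclideanSpace ℝ (Fin d))
    {F : EuclideanSpace ℝ (Fin d) → ℝ≥0∞} (hF : Measurable F) :
    ∫⁻ e, F (x + Real.exp (-(γ / 2)) • e) ∂stdGaussian (EuclideanSpace ℝ (Fin d)) =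
      ∫⁻ y, ENNReal.ofReal (heatKernel γ (y - x)) * F y := by
  have hm : Measurable (heatKernel γ : EuclideanSpace ℝ (Fin d) → ℝ) :=
    (continuous_heatKernel_right γ).measurable
  have h1 := lintegral_map (μ := stdGaussian (EuclideanSpace ℝ (Fin d)))
    (f := fun v => F (x + v)) (g := fun e => Real.exp (-(γ / 2)) • e) (by fun_prop) (by fun_prop)
  rw [← h1, map_smul_stdGaussian, lintegral_withDensity_eq_lintegral_mul _ (by fun_prop)
    (by fun_prop)]
  rw [← lintegral_sub_right_eq_self _ x]
  simp

/-- Change of variables from the signal and the noise to the signal and the observation. -/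
lemma lintegral_lintegral_channel (ρ : Measure (EuclideanSpace ℝ (Fin d))) [SFinite ρ] (γ : ℝ)
    {F : EuclideanSpace ℝ (Fin d) × EuclideanSpace ℝ (Fin d) → ℝ≥0∞} (hF : Measurable F) :
    ∫⁻ x, ∫⁻ e, F (x, x + Real.exp (-(γ / 2)) • e) ∂stdGaussian (EuclideanSpace ℝ (Fin d)) ∂ρ =
      ∫⁻ y, ∫⁻ x, ENNReal.ofReal (heatKernel γ (y - x)) * F (x, y) ∂ρ := by
  have hm : Measurable (heatKernel γ : EuclideanSpace ℝ (Fin d) → ℝ) :=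
    (continuous_heatKernel_right γ).measurable
  rw [lintegral_lintegral_swap (f := fun y x => ENNReal.ofReal (heatKernel γ (y - x)) * F (x, y))
    (by fun_prop)]
  exact lintegral_congr fun x => lintegral_channel γ x (F := fun y => F (x, y)) (by fun_prop)

lemma ofReal_smoothDensity {ρ : Measure (EuclideanSpace ℝ (Fin d))} [IsFiniteMeasure ρ] (γ : ℝ)
    (y : EuclideanSpace ℝ (Fin d)) :
    ENNReal.ofReal (smoothDensity ρ γ y) = ∫⁻ x, ENNReal.ofReal (heatKernel γ (y - x)) ∂ρ := by
  rw [smoothDensity_eq, ofReal_integral_eq_lintegral_ofReal (integrable_heatKernel γ y)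
    (ae_of_all _ fun x => (heatKernel_pos _ _).le)]

/-- The law of the observation has density `smoothDensity`. -/
lemma lintegral_observation (ρ : Measure (EuclideanSpace ℝ (Fin d))) [IsFiniteMeasure ρ] (γ : ℝ)
    {F : EuclideanSpace ℝ (Fin d) → ℝ≥0∞} (hF : Measurable F) :
    ∫⁻ x, ∫⁻ e, F (x + Real.exp (-(γ / 2)) • e) ∂stdGaussian (EuclideanSpace ℝ (Fin d)) ∂ρ =
      ∫⁻ y, ENNReal.ofReal (smoothDensity ρ γ y) * F y := by
  have hm : Measurable (heatKernel γ : EuclideanSpace ℝ (Fin d) → ℝ) :=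
    (continuous_heatKernel_right γ).measurable
  rw [lintegral_lintegral_channel ρ γ (F := fun p => F p.2) (by fun_prop)]
  refine lintegral_congr fun y => ?_
  rw [ofReal_smoothDensity]
  exact lintegral_mul_const (f := fun x => ENNReal.ofReal (heatKernel γ (y - x))) (F y)
    (by fun_prop)

/-- Fenchel-Young: `exp g - 1` is the convex conjugate of `klFun`. The choice `g = 1` gives
integrability of densities, `g = log u` the tangent line at `u`, and `g = ‖n_P‖² / 4` the second
moment of a mismatched estimate. -/
lemma young_klFun {x g : ℝ} (hx : 0 ≤ x) : x * g ≤ klFun x + (Real.exp g - 1) := by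
  rw [klFun_apply]
  rcases hx.eq_or_lt with rfl | hx
  · simp; positivity
  · have := Real.add_one_le_exp (g - Real.log x)
    rw [Real.exp_sub, Real.exp_log hx, le_div_iff₀ hx] at this
    linarith

lemma klFun_tangent_le {x u : ℝ} (hx : 0 ≤ x) (hu : 0 < u) :
    klFun u + Real.log u * (x - u) ≤ klFun x := by
  have := young_klFun (g := Real.log u) hx
  rw [Real.exp_log hu] at this
  rw [klFun_apply u]
  linarith

end Channel

/-- A dominated convergence theorem in which the dominating functions vary, with constant
integral. -/
lemma tendsto_lintegral_of_le_of_lintegral_eq {α : Type*} [MeasurableSpace α] {μ : Measure α}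
    {F G : ℕ → α → ℝ≥0∞} {F' G' : α → ℝ≥0∞} {C : ℝ≥0∞} (hF : ∀ n, Measurable (F n))
    (hG : ∀ n, Measurable (G n)) (hF' : Measurable F')
    (hle : ∀ n x, F n x ≤ G n x) (hFlim : ∀ x, Tendsto (fun n => F n x) atTop (𝓝 (F' x)))
    (hGlim : ∀ x, Tendsto (fun n => G n x) atTop (𝓝 (G' x))) (hG'top : ∀ x, G' x ≠ ∞)
    (hGC : ∀ n, ∫⁻ x, G n x ∂μ = C) (hG'C : ∫⁻ x, G' x ∂μ = C) (hC : C ≠ ∞) :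
    Tendsto (fun n => ∫⁻ x, F n x ∂μ) atTop (𝓝 (∫⁻ x, F' x ∂μ)) := by
  have hle' (x : α) : F' x ≤ G' x := le_of_tendsto_of_tendsto' (hFlim x) (hGlim x) (hle · x)
  have hFC (n : ℕ) : ∫⁻ x, F n x ∂μ ≤ C := (lintegral_mono (hle n)).trans (hGC n).le
  have hF'C : ∫⁻ x, F' x ∂μ ≤ C := (lintegral_mono hle').trans hG'C.le
  refine tendsto_of_le_liminf_of_limsup_le ?_ ?_
  · calc ∫⁻ x, F' x ∂μ = ∫⁻ x, liminf (fun n => F n x) atTop ∂μ :=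
          lintegral_congr fun x => (hFlim x).liminf_eq.symm
      _ ≤ _ := lintegral_liminf_le hF
  · have h1 (n : ℕ) : ∫⁻ x, F n x ∂μ = C - ∫⁻ x, (G n x - F n x) ∂μ := by
      rw [lintegral_sub (hF n) (ne_top_of_le_ne_top hC (hFC n)) (ae_of_all _ (hle n)), hGC,
        ENNReal.sub_sub_cancel hC (hFC n)]
    simp_rw [h1]
    rw [ENNReal.limsup_const_sub _ _ hC]
    have h2 : ∫⁻ x, (G' x - F' x) ∂μ ≤ liminf (fun n => ∫⁻ x, (G n x - F n x) ∂μ) atTop := by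
      calc ∫⁻ x, (G' x - F' x) ∂μ = ∫⁻ x, liminf (fun n => G n x - F n x) atTop ∂μ :=
            lintegral_congr fun x =>
              ((ENNReal.Tendsto.sub (hGlim x) (hFlim x) (.inl (hG'top x))).liminf_eq).symm
        _ ≤ _ := lintegral_liminf_le fun n => (hG n).sub (hF n)
    refine (tsub_le_tsub_left h2 C).trans ?_
    rw [lintegral_sub hF' (ne_top_of_le_ne_top hC hF'C) (ae_of_all _ hle'), hG'C,
      ENNReal.sub_sub_cancel hC hF'C]

/-! ### Bound on the smoothed entropy and its limit at vanishing signal-to-noise ratio -/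

section EntropyLimits

variable {d : ℕ}

lemma integrable_mul_heatKernel_of_integrable {P : Measure (EuclideanSpace ℝ (Fin d))}
    {h : EuclideanSpace ℝ (Fin d) → ℝ} (hh : Integrable h P) (γ : ℝ)
    (y : EuclideanSpace ℝ (Fin d)) : Integrable (fun x => h x * heatKernel γ (y - x)) P := by
  have hc := continuous_heatKernel_right (d := d) γ
  refine hh.mul_bdd (c := 1 * heatBound d γ)
    (Continuous.aestronglyMeasurable (by fun_prop)) (ae_of_all _ fun x => ?_)
  have := abs_mul_heatKernel_le (d := d) (k := fun _ => 1) abs_one_le γ (y - x)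
  simpa using this

lemma measurable_integral_mul_heatKernel {P : Measure (EuclideanSpace ℝ (Fin d))} [SFinite P]
    {h : EuclideanSpace ℝ (Fin d) → ℝ} (hh : Measurable h) (γ : ℝ) :
    Measurable fun y => ∫ x, h x * heatKernel γ (y - x) ∂P := by
  have hc := (continuous_heatKernel_right (d := d) γ).measurable
  have : Measurable fun p : EuclideanSpace ℝ (Fin d) × EuclideanSpace ℝ (Fin d) =>
    h p.2 * heatKernel γ (p.1 - p.2) := by fun_prop
  exact this.stronglyMeasurable.integral_prod_right'.measurable

/-- As the signal-to-noise ratio tends to zero, posterior means tend to the prior mean. -/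
lemma tendsto_posteriorMean_atBot {P : Measure (EuclideanSpace ℝ (Fin d))}
    [IsProbabilityMeasure P] {h : EuclideanSpace ℝ (Fin d) → ℝ} (hh : Integrable h P)
    (x e : EuclideanSpace ℝ (Fin d)) :
    Tendsto (fun γ : ℝ => (∫ x', h x' * heatKernel γ (x + Real.exp (-(γ / 2)) • e - x') ∂P) /
      smoothDensity P γ (x + Real.exp (-(γ / 2)) • e)) atBot (𝓝 (∫ x', h x' ∂P)) := by
  -- At the observation `x + exp (-(γ / 2)) • e` the kernel is `N γ * w γ x'`, and `N γ` cancels in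
  -- the quotient. The weights `w` are at most one and tend to `exp (-‖e‖² / 2)`, which does not
  -- depend on `x'`.
  set w : ℝ → EuclideanSpace ℝ (Fin d) → ℝ := fun γ x' =>
    Real.exp (-(‖Real.exp (γ / 2) • (x - x') + e‖ ^ 2 / 2)) with hw
  have wc (γ : ℝ) : Continuous (w γ) := by fun_prop
  set N : ℝ → ℝ := fun γ => (2 * Real.pi) ^ (-(d / 2 : ℝ)) * Real.exp (γ * d / 2) with hN
  have hN0 (γ : ℝ) : N γ ≠ 0 := by positivity
  have hG (γ : ℝ) (x' : EuclideanSpace ℝ (Fin d)) :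
      heatKernel γ (x + Real.exp (-(γ / 2)) • e - x') = N γ * w γ x' := by
    have h1 : x + Real.exp (-(γ / 2)) • e - x' =
        Real.exp (-(γ / 2)) • (Real.exp (γ / 2) • (x - x') + e) := by
      rw [smul_add, smul_smul, ← Real.exp_add, neg_add_cancel, Real.exp_zero, one_smul]
      abel
    rw [heatKernel, h1, norm_smul, Real.norm_eq_abs, abs_of_pos (Real.exp_pos _), sub_eq_add_neg,
      Real.exp_add, hN, hw, mul_assoc]
    congr 4
    have h2 : Real.exp γ * Real.exp (-(γ / 2)) ^ 2 = 1 := by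
      rw [sq, ← Real.exp_add, ← Real.exp_add]; ring_nf; simp
    rw [mul_pow, ← mul_assoc, h2, one_mul]
  have hlim {k : EuclideanSpace ℝ (Fin d) → ℝ} (hk : Integrable k P) :
      Tendsto (fun γ => ∫ x', k x' * w γ x' ∂P) atBot
        (𝓝 (∫ x', k x' * Real.exp (-(‖e‖ ^ 2 / 2)) ∂P)) := by
    refine tendsto_integral_filter_of_dominated_convergence (fun x' => ‖k x'‖)
      (.of_forall fun γ => hk.1.mul (wc γ).aestronglyMeasurable)
      (.of_forall fun γ => ae_of_all _ fun x' => ?_) hk.norm (ae_of_all _ fun x' => ?_)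
    · rw [norm_mul]
      refine mul_le_of_le_one_right (norm_nonneg _) ?_
      rw [Real.norm_eq_abs, abs_of_pos (Real.exp_pos _), Real.exp_le_one_iff]
      have : 0 ≤ ‖Real.exp (γ / 2) • (x - x') + e‖ ^ 2 / 2 := by positivity
      linarith
    · refine Tendsto.const_mul _ ?_
      have h0 : Tendsto (fun γ : ℝ => Real.exp (γ / 2)) atBot (𝓝 0) :=
        Real.tendsto_exp_atBot.comp (tendsto_id.atBot_div_const two_pos)
      have h1 : Tendsto (fun γ : ℝ => Real.exp (γ / 2) • (x - x') + e) atBot (𝓝 e) := by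
        simpa using (h0.smul_const (x - x')).add_const e
      exact (Real.continuous_exp.tendsto _).comp (((h1.norm.pow 2).div_const 2).neg)
  have h1 := (hlim hh).div (hlim (integrable_const (1 : ℝ))) (by
    rw [integral_mul_const]; simp [Real.exp_ne_zero])
  rw [integral_mul_const, integral_mul_const] at h1
  simp only [integral_const, probReal_univ, one_smul, one_mul] at h1
  rw [mul_div_cancel_right₀ _ (Real.exp_ne_zero _)] at h1
  refine h1.congr fun γ => ?_
  rw [smoothDensity_eq]
  simp_rw [hG, mul_left_comm (h _)]
  rw [integral_const_mul, integral_const_mul, mul_div_mul_left _ _ (hN0 γ)]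
  rfl

variable {P : Measure (EuclideanSpace ℝ (Fin d))}
  {f : EuclideanSpace ℝ (Fin d) → ℝ≥0}

lemma lintegral_ne_top_of_lintegral_klFun_ne_top {α : Type*} [MeasurableSpace α] {P : Measure α}
    [IsFiniteMeasure P] {f : α → ℝ≥0} (hf : Measurable f)
    (hK : ∫⁻ x, ENNReal.ofReal (klFun (f x)) ∂P ≠ ∞) : ∫⁻ x, f x ∂P ≠ ∞ := by
  have hm := measurable_klFun
  have h (x : α) : (f x : ℝ≥0∞) ≤
      ENNReal.ofReal (klFun (f x)) + ENNReal.ofReal (Real.exp 1 - 1) := by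
    rw [← ENNReal.ofReal_add (klFun_nonneg (f x).coe_nonneg) (by linarith [Real.add_one_le_exp 1])]
    rw [← ENNReal.ofReal_coe_nnreal]
    refine ENNReal.ofReal_le_ofReal ?_
    have := young_klFun (g := 1) (f x).coe_nonneg
    rwa [mul_one] at this
  refine ne_top_of_le_ne_top ?_ (lintegral_mono h)
  rw [lintegral_add_left (by fun_prop)]
  simp [hK]
  exact ENNReal.mul_ne_top ENNReal.ofReal_ne_top (measure_ne_top _ _)

lemma integrable_coe_of_lintegral_klFun_ne_top {α : Type*} [MeasurableSpace α] {P : Measure α}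
    [IsFiniteMeasure P] {f : α → ℝ≥0} (hf : Measurable f)
    (hK : ∫⁻ x, ENNReal.ofReal (klFun (f x)) ∂P ≠ ∞) : Integrable (fun x => (f x : ℝ)) P := by
  refine ⟨by fun_prop, ?_⟩
  have := lintegral_ne_top_of_lintegral_klFun_ne_top hf hK
  simpa [HasFiniteIntegral, lt_top_iff_ne_top] using this

lemma integrable_klFun_of_lintegral_ne_top {α : Type*} [MeasurableSpace α] {P : Measure α}
    {f : α → ℝ≥0} (hf : Measurable f)
    (hK : ∫⁻ x, ENNReal.ofReal (klFun (f x)) ∂P ≠ ∞) : Integrable (fun x => klFun (f x)) P := by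
  have hm := measurable_klFun
  refine ⟨by fun_prop, ?_⟩
  rw [hasFiniteIntegral_iff_ofReal (ae_of_all _ fun x => klFun_nonneg (f x).coe_nonneg)]
  exact lt_top_iff_ne_top.2 hK

lemma smoothDensity_withDensity (hf : Measurable f) (γ : ℝ) (y : EuclideanSpace ℝ (Fin d)) :
    smoothDensity (P.withDensity fun x => (f x : ℝ≥0∞)) γ y =
      ∫ x, f x * heatKernel γ (y - x) ∂P := by
  rw [smoothDensity_eq, integral_withDensity_eq_integral_smul hf]
  rfl

/-- Jensen's inequality for the posterior. The ratio `u` of the smoothed densities is the posterior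
mean of `f`, so integrating the tangent line of `klFun` at `u` against the kernel leaves only the
constant term. -/
lemma klFun_posteriorMean_mul_le [IsProbabilityMeasure P] (hf : Measurable f)
    (hK : ∫⁻ x, ENNReal.ofReal (klFun (f x)) ∂P ≠ ∞)
    [NeZero (P.withDensity fun x => (f x : ℝ≥0∞))]
    [IsFiniteMeasure (P.withDensity fun x => (f x : ℝ≥0∞))]
    (γ : ℝ) (y : EuclideanSpace ℝ (Fin d)) :
    klDensity (P.withDensity fun x => (f x : ℝ≥0∞)) P γ y ≤
      ∫ x, klFun (f x) * heatKernel γ (y - x) ∂P := by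
  set Q := P.withDensity fun x => (f x : ℝ≥0∞)
  have p1 := smoothDensity_pos (ρ := Q) γ y
  have p2 := smoothDensity_pos (ρ := P) γ y
  set u := smoothDensity Q γ y / smoothDensity P γ y with hu
  have hu0 : 0 < u := div_pos p1 p2
  have i1 := integrable_mul_heatKernel_of_integrable
    (integrable_coe_of_lintegral_klFun_ne_top hf hK) γ y
  have i2 := integrable_heatKernel (ρ := P) γ y
  rw [klDensity_eq]
  calc smoothDensity P γ y * klFun u
      = (klFun u - Real.log u * u) * smoothDensity P γ y + Real.log u * smoothDensity Q γ y := by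
        rw [hu]; field_simp; ring
    _ = ∫ x, ((klFun u - Real.log u * u) * heatKernel γ (y - x) +
          Real.log u * (f x * heatKernel γ (y - x))) ∂P := by
        rw [integral_add (i2.const_mul _) (i1.const_mul _), integral_const_mul,
          integral_const_mul, smoothDensity_withDensity hf, smoothDensity_eq]
    _ ≤ _ := by
        refine integral_mono ((i2.const_mul _).add (i1.const_mul _))
          (integrable_mul_heatKernel_of_integrable (integrable_klFun_of_lintegral_ne_top hf hK) γ y)
          fun x => ?_
        have := mul_le_mul_of_nonneg_right (klFun_tangent_le (f x).coe_nonneg hu0)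
          (heatKernel_pos γ (y - x)).le
        simp only
        linarith

/-- Averaging over the observation undoes conditioning on it, since the kernel has unit mass in `y`.
The Jensen bounds thus have an integral independent of `γ`. -/
lemma lintegral_integral_klFun_mul_heatKernel [IsProbabilityMeasure P] (hf : Measurable f)
    (hK : ∫⁻ x, ENNReal.ofReal (klFun (f x)) ∂P ≠ ∞) (γ : ℝ) :
    ∫⁻ y, ENNReal.ofReal (∫ x, klFun (f x) * heatKernel γ (y - x) ∂P) =
      ∫⁻ x, ENNReal.ofReal (klFun (f x)) ∂P := by
  have hm := measurable_klFun
  have := lintegral_lintegral_channel P γ (F := fun p => ENNReal.ofReal (klFun (f p.1)))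
    (by fun_prop)
  simp only [lintegral_const, measure_univ, mul_one] at this
  rw [this]
  refine lintegral_congr fun y => ?_
  rw [ofReal_integral_eq_lintegral_ofReal (integrable_mul_heatKernel_of_integrable
    (integrable_klFun_of_lintegral_ne_top hf hK) γ y)
    (ae_of_all _ fun x => mul_nonneg (klFun_nonneg (f x).coe_nonneg) (heatKernel_pos _ _).le)]
  refine lintegral_congr fun x => ?_
  rw [mul_comm, ENNReal.ofReal_mul (heatKernel_pos _ _).le]

lemma measurable_posteriorMean [IsFiniteMeasure P]
    [IsFiniteMeasure (P.withDensity fun x => (f x : ℝ≥0∞))] (γ : ℝ) : Measurable fun y =>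
    smoothDensity (P.withDensity fun x => (f x : ℝ≥0∞)) γ y / smoothDensity P γ y := by
  have h1 := continuous_smoothDensity (ρ := P.withDensity fun x => (f x : ℝ≥0∞))
  have h2 := continuous_smoothDensity (ρ := P)
  have h3 : Continuous fun y => smoothDensity (P.withDensity fun x => (f x : ℝ≥0∞)) γ y := by
    fun_prop
  have h4 : Continuous fun y => smoothDensity P γ y := by fun_prop
  exact h3.measurable.div h4.measurable

variable [IsProbabilityMeasure P] [NeZero (P.withDensity fun x => (f x : ℝ≥0∞))]
    [IsFiniteMeasure (P.withDensity fun x => (f x : ℝ≥0∞))]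

lemma lintegral_klDensity_le (hf : Measurable f)
    (hK : ∫⁻ x, ENNReal.ofReal (klFun (f x)) ∂P ≠ ∞) (γ : ℝ) :
    ∫⁻ y, ENNReal.ofReal (klDensity (P.withDensity fun x => (f x : ℝ≥0∞)) P γ y) ≤
      ∫⁻ x, ENNReal.ofReal (klFun (f x)) ∂P := by
  rw [← lintegral_integral_klFun_mul_heatKernel hf hK γ]
  exact lintegral_mono fun y => ENNReal.ofReal_le_ofReal (klFun_posteriorMean_mul_le hf hK γ y)

lemma integrable_klDensity (hf : Measurable f)
    (hK : ∫⁻ x, ENNReal.ofReal (klFun (f x)) ∂P ≠ ∞) (γ : ℝ) :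
    Integrable (klDensity (P.withDensity fun x => (f x : ℝ≥0∞)) P γ) := by
  have hc := continuous_klDensity (ρ := P.withDensity fun x => (f x : ℝ≥0∞)) (η := P)
  refine ⟨Continuous.aestronglyMeasurable (by fun_prop), ?_⟩
  rw [hasFiniteIntegral_iff_ofReal (ae_of_all _ fun x => klDensity_nonneg _ _)]
  exact (lintegral_klDensity_le hf hK γ).trans_lt (lt_top_iff_ne_top.2 hK)

/-- Written over the signal and the noise, the entropy lives on a probability space that does not
change with `γ`, so pointwise limits in `γ` make sense. -/
lemma lintegral_klDensity_eq (γ : ℝ) :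
    ∫⁻ y, ENNReal.ofReal (klDensity (P.withDensity fun x => (f x : ℝ≥0∞)) P γ y) =
      ∫⁻ x, ∫⁻ e, ENNReal.ofReal (klFun (smoothDensity (P.withDensity fun x => (f x : ℝ≥0∞)) γ
        (x + Real.exp (-(γ / 2)) • e) / smoothDensity P γ (x + Real.exp (-(γ / 2)) • e)))
        ∂stdGaussian (EuclideanSpace ℝ (Fin d)) ∂P := by
  have hm := measurable_klFun
  have hm2 := measurable_posteriorMean (P := P) (f := f) γ
  rw [lintegral_observation P γ (F := fun y => ENNReal.ofReal (klFun
    (smoothDensity (P.withDensity fun x => (f x : ℝ≥0∞)) γ y / smoothDensity P γ y)))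
    (by fun_prop)]
  refine lintegral_congr fun y => ?_
  rw [klDensity_eq, ENNReal.ofReal_mul (smoothDensity_nonneg _ _)]

/-- Posterior means of `f` and of `klFun ∘ f` tend to prior means. By Jensen the latter dominate
`klFun` of the former, with constant integral, which permits passing to the limit without a fixed
dominating function. -/
lemma tendsto_lintegral_klDensity_atBot (hf : Measurable f)
    (hK : ∫⁻ x, ENNReal.ofReal (klFun (f x)) ∂P ≠ ∞) :
    Tendsto (fun n : ℕ => ∫⁻ y, ENNReal.ofReal
      (klDensity (P.withDensity fun x => (f x : ℝ≥0∞)) P (-(n : ℝ)) y)) atTop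
      (𝓝 (ENNReal.ofReal (klFun (∫ x, f x ∂P)))) := by
  have hm := measurable_klFun
  have hm2 := measurable_posteriorMean (P := P) (f := f)
  have hm3 := measurable_integral_mul_heatKernel (P := P) (h := fun x => klFun (f x)) (by fun_prop)
  have hm4 (γ : ℝ) : Measurable fun y => smoothDensity P γ y := by
    have h2 := continuous_smoothDensity (ρ := P)
    exact Continuous.measurable (by fun_prop)
  have hn : Tendsto (fun n : ℕ => -(n : ℝ)) atTop atBot :=
    tendsto_neg_atTop_atBot.comp tendsto_natCast_atTop_atTop
  have i1 := integrable_coe_of_lintegral_klFun_ne_top hf hK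
  have i2 := integrable_klFun_of_lintegral_ne_top hf hK
  set Λ := P.prod (stdGaussian (EuclideanSpace ℝ (Fin d)))
  set Y : ℝ → EuclideanSpace ℝ (Fin d) × EuclideanSpace ℝ (Fin d) → EuclideanSpace ℝ (Fin d) :=
    fun γ p => p.1 + Real.exp (-(γ / 2)) • p.2 with hY
  have hYm (γ : ℝ) : Measurable (Y γ) := by fun_prop
  have hflim (p : EuclideanSpace ℝ (Fin d) × EuclideanSpace ℝ (Fin d)) :=
    (tendsto_posteriorMean_atBot i1 p.1 p.2).comp hn
  have hklim (p : EuclideanSpace ℝ (Fin d) × EuclideanSpace ℝ (Fin d)) :=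
    (tendsto_posteriorMean_atBot i2 p.1 p.2).comp hn
  have hFm (n : ℕ) : Measurable fun p => ENNReal.ofReal (klFun
      (smoothDensity (P.withDensity fun x => (f x : ℝ≥0∞))
      (-(n : ℝ)) (Y (-(n : ℝ)) p) / smoothDensity P (-(n : ℝ)) (Y (-(n : ℝ)) p))) :=
    ENNReal.measurable_ofReal.comp (hm.comp ((hm2 _).comp (hYm _)))
  have hGm (n : ℕ) : Measurable fun p => ENNReal.ofReal ((∫ x', klFun (f x') *
      heatKernel (-(n : ℝ)) (Y (-(n : ℝ)) p - x') ∂P) / smoothDensity P (-(n : ℝ))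
        (Y (-(n : ℝ)) p)) :=
    ENNReal.measurable_ofReal.comp (((hm3 _).comp (hYm _)).div ((hm4 _).comp (hYm _)))
  have key := tendsto_lintegral_of_le_of_lintegral_eq (μ := Λ)
    (F := fun n p => ENNReal.ofReal (klFun (smoothDensity (P.withDensity fun x => (f x : ℝ≥0∞))
      (-(n : ℝ)) (Y (-(n : ℝ)) p) / smoothDensity P (-(n : ℝ)) (Y (-(n : ℝ)) p))))
    (G := fun n p => ENNReal.ofReal ((∫ x', klFun (f x') *
      heatKernel (-(n : ℝ)) (Y (-(n : ℝ)) p - x') ∂P) / smoothDensity P (-(n : ℝ))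
        (Y (-(n : ℝ)) p)))
    (F' := fun _ => ENNReal.ofReal (klFun (∫ x, f x ∂P)))
    (G' := fun _ => ENNReal.ofReal (∫ x, klFun (f x) ∂P))
    (C := ∫⁻ x, ENNReal.ofReal (klFun (f x)) ∂P) ?_ ?_ ?_ ?_ ?_ ?_ ?_ ?_ ?_ hK
  · simp only [lintegral_const, measure_univ, mul_one] at key
    refine key.congr fun n => ?_
    rw [lintegral_klDensity_eq, lintegral_prod _ (hFm n).aemeasurable]
  · exact hFm
  · exact hGm
  · exact measurable_const
  · intro n p
    refine ENNReal.ofReal_le_ofReal ?_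
    rw [le_div_iff₀ (smoothDensity_pos _ _), mul_comm, ← klDensity_eq]
    exact klFun_posteriorMean_mul_le hf hK _ _
  · intro p
    refine ENNReal.tendsto_ofReal ((continuous_klFun.tendsto _).comp ?_)
    refine (hflim p).congr fun n => ?_
    rw [smoothDensity_withDensity hf]
    rfl
  · exact fun p => ENNReal.tendsto_ofReal (hklim p)
  · exact fun _ => ENNReal.ofReal_ne_top
  · intro n
    rw [← lintegral_integral_klFun_mul_heatKernel hf hK (-(n : ℝ)),
      lintegral_prod _ (hGm n).aemeasurable]
    rw [lintegral_observation P (-(n : ℝ)) (F := fun y => ENNReal.ofReal ((∫ x', klFun (f x') *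
      heatKernel (-(n : ℝ)) (y - x') ∂P) / smoothDensity P (-(n : ℝ)) y)) (by fun_prop)]
    refine lintegral_congr fun y => ?_
    rw [← ENNReal.ofReal_mul (smoothDensity_nonneg _ _),
      mul_div_cancel₀ _ (smoothDensity_pos _ _).ne']
  · rw [lintegral_const, measure_univ, mul_one, ofReal_integral_eq_lintegral_ofReal i2
      (ae_of_all _ fun x => klFun_nonneg (f x).coe_nonneg)]

end EntropyLimits

/-! ### The limit at infinite signal-to-noise ratio -/

section EntropyLimitAtTop

variable {d : ℕ} {P : Measure (EuclideanSpace ℝ (Fin d))} [IsProbabilityMeasure P]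
  {f : EuclideanSpace ℝ (Fin d) → ℝ≥0}

/-- Conditional expectation contracts `L¹`: since `g` is a function of the observation, `u - g` is
the posterior mean of `f - g`. -/
lemma lintegral_posteriorMean_sub_le (hf : Measurable f) (hfi : Integrable (fun x => (f x : ℝ)) P)
    (g : BoundedContinuousFunction (EuclideanSpace ℝ (Fin d)) ℝ) (γ : ℝ) :
    ∫⁻ y, ENNReal.ofReal (smoothDensity P γ y) *
      ‖smoothDensity (P.withDensity fun x => (f x : ℝ≥0∞)) γ y / smoothDensity P γ y - g y‖ₑ ≤
    ∫⁻ x, ∫⁻ e, ‖(f x : ℝ) - g (x + Real.exp (-(γ / 2)) • e)‖ₑ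
      ∂stdGaussian (EuclideanSpace ℝ (Fin d)) ∂P := by
  have hg := g.continuous.measurable
  rw [lintegral_lintegral_channel P γ (F := fun p => ‖(f p.1 : ℝ) - g p.2‖ₑ) (by fun_prop)]
  refine lintegral_mono fun y => ?_
  have p2 := smoothDensity_pos (ρ := P) γ y
  have i1 := integrable_mul_heatKernel_of_integrable hfi γ y
  have i2 := integrable_heatKernel (ρ := P) γ y
  have h1 : smoothDensity P γ y * (smoothDensity (P.withDensity fun x => (f x : ℝ≥0∞)) γ y /
      smoothDensity P γ y - g y) = ∫ x, heatKernel γ (y - x) * (f x - g y) ∂P := by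
    have : ∀ x, heatKernel γ (y - x) * (f x - g y) =
      f x * heatKernel γ (y - x) - heatKernel γ (y - x) * g y := fun x => by ring
    simp_rw [this]
    rw [integral_sub i1 (i2.mul_const _), integral_mul_const, ← smoothDensity_eq,
      ← smoothDensity_withDensity hf]
    field_simp
  calc ENNReal.ofReal (smoothDensity P γ y) *
      ‖smoothDensity (P.withDensity fun x => (f x : ℝ≥0∞)) γ y / smoothDensity P γ y - g y‖ₑ
      = ‖∫ x, heatKernel γ (y - x) * (f x - g y) ∂P‖ₑ := by
        rw [← h1, enorm_mul, Real.enorm_of_nonneg p2.le]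
    _ ≤ ∫⁻ x, ‖heatKernel γ (y - x) * (f x - g y)‖ₑ ∂P := enorm_integral_le_lintegral_enorm _
    _ = _ := lintegral_congr fun x => by
        rw [enorm_mul, Real.enorm_of_nonneg (heatKernel_pos _ _).le]

/-- For a bounded continuous `g` close to `f` in `L¹`, the value at the observation tends to the
value at the signal because the noise shrinks; the contraction carries this over to the posterior
mean of `f`. -/
lemma tendsto_lintegral_posteriorMean_sub
    [IsFiniteMeasure (P.withDensity fun x => (f x : ℝ≥0∞))] (hf : Measurable f)
    (hfi : Integrable (fun x => (f x : ℝ)) P) :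
    Tendsto (fun n : ℕ => ∫⁻ p : EuclideanSpace ℝ (Fin d) × EuclideanSpace ℝ (Fin d),
      ‖smoothDensity (P.withDensity fun x => (f x : ℝ≥0∞)) n
        (p.1 + Real.exp (-((n : ℝ) / 2)) • p.2) /
        smoothDensity P n (p.1 + Real.exp (-((n : ℝ) / 2)) • p.2) - f p.1‖ₑ
      ∂P.prod (stdGaussian (EuclideanSpace ℝ (Fin d)))) atTop (𝓝 0) := by
  set Λ := P.prod (stdGaussian (EuclideanSpace ℝ (Fin d))) with hΛ
  have hm2 := measurable_posteriorMean (P := P) (f := f)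
  set u : ℝ → EuclideanSpace ℝ (Fin d) → ℝ := fun γ y =>
    smoothDensity (P.withDensity fun x => (f x : ℝ≥0∞)) γ y / smoothDensity P γ y with hu
  set Y : ℕ → EuclideanSpace ℝ (Fin d) × EuclideanSpace ℝ (Fin d) → EuclideanSpace ℝ (Fin d) :=
    fun n p => p.1 + Real.exp (-((n : ℝ) / 2)) • p.2 with hY
  have hYm (n : ℕ) : Measurable (Y n) := by fun_prop
  have humY (n : ℕ) : Measurable fun p => u n (Y n p) := (hm2 n).comp (hYm n)
  rw [ENNReal.tendsto_atTop_zero]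
  intro δ hδ
  -- A quarter, because the distances of `u` and of `f` to `g (Y n p)` are each bounded by an
  -- approximation error plus a continuity error.
  have hδ4 : δ / 4 ≠ 0 := (ENNReal.div_pos hδ.ne' (by simp)).ne'
  obtain ⟨g, hg, -⟩ := hfi.exists_boundedContinuous_lintegral_sub_le hδ4
  have hgm := g.continuous.measurable
  have hlim : Tendsto (fun n => ∫⁻ p, ‖g p.1 - g (Y n p)‖ₑ ∂Λ) atTop (𝓝 0) := by
    have : Tendsto (fun n => ∫⁻ p, ‖g p.1 - g (Y n p)‖ₑ ∂Λ) atTop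
        (𝓝 (∫⁻ p, (0 : ℝ≥0∞) ∂Λ)) := by
      refine tendsto_lintegral_filter_of_dominated_convergence (fun _ => ‖2 * ‖g‖‖ₑ)
        (.of_forall fun n => by fun_prop) (.of_forall fun n => ae_of_all _ fun p => ?_) ?_
        (ae_of_all _ fun p => ?_)
      · rw [enorm_le_iff_norm_le, ← dist_eq_norm]
        exact (g.dist_le_two_norm _ _).trans (le_abs_self _)
      · rw [lintegral_const, measure_univ, mul_one]
        exact enorm_ne_top
      · have h0 : Tendsto (fun n : ℕ => Real.exp (-((n : ℝ) / 2))) atTop (𝓝 0) :=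
          Real.tendsto_exp_neg_atTop_nhds_zero.comp
            (tendsto_natCast_atTop_atTop.atTop_div_const two_pos)
        have h1 : Tendsto (fun n => Y n p) atTop (𝓝 p.1) := by
          simpa [hY] using (h0.smul_const p.2).const_add p.1
        have h2 := ((g.continuous.tendsto _).comp h1).const_sub (g p.1)
        have h3 := (continuous_enorm.tendsto _).comp h2
        rw [sub_self, enorm_zero] at h3
        exact h3
    simpa using this
  obtain ⟨N, hN⟩ := (ENNReal.tendsto_atTop_zero.1 hlim) (δ / 4) (pos_iff_ne_zero.2 hδ4)
  refine ⟨N, fun n hn => ?_⟩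
  have hA : ∫⁻ p, ‖(f p.1 : ℝ) - g (Y n p)‖ₑ ∂Λ ≤ δ / 4 + δ / 4 := by
    calc ∫⁻ p, ‖(f p.1 : ℝ) - g (Y n p)‖ₑ ∂Λ
        ≤ ∫⁻ p, (‖(f p.1 : ℝ) - g p.1‖ₑ + ‖g p.1 - g (Y n p)‖ₑ) ∂Λ := by
          refine lintegral_mono fun p => ?_
          have := enorm_add_le ((f p.1 : ℝ) - g p.1) (g p.1 - g (Y n p))
          rwa [sub_add_sub_cancel] at this
      _ = ∫⁻ p, ‖(f p.1 : ℝ) - g p.1‖ₑ ∂Λ + ∫⁻ p, ‖g p.1 - g (Y n p)‖ₑ ∂Λ :=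
          lintegral_add_left (by fun_prop) _
      _ ≤ _ := by
          refine add_le_add ?_ (hN n hn)
          rw [hΛ, lintegral_prod _ (Measurable.aemeasurable (by fun_prop))]
          simpa using hg
  have hB : ∫⁻ p, ‖u n (Y n p) - g (Y n p)‖ₑ ∂Λ ≤ ∫⁻ p, ‖(f p.1 : ℝ) - g (Y n p)‖ₑ ∂Λ := by
    have hum : Measurable (u n) := hm2 n
    have hdm : Measurable fun p => ‖u n (Y n p) - g (Y n p)‖ₑ :=
      ((humY n).sub (hgm.comp (hYm n))).enorm
    rw [hΛ, lintegral_prod _ hdm.aemeasurable,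
      lintegral_prod _ (Measurable.aemeasurable (by fun_prop)),
      lintegral_observation P n (F := fun y => ‖u n y - g y‖ₑ) (by fun_prop)]
    exact lintegral_posteriorMean_sub_le hf hfi g n
  calc ∫⁻ p, ‖u n (Y n p) - f p.1‖ₑ ∂Λ
      ≤ ∫⁻ p, (‖u n (Y n p) - g (Y n p)‖ₑ + ‖(f p.1 : ℝ) - g (Y n p)‖ₑ) ∂Λ := by
        refine lintegral_mono fun p => ?_
        have := enorm_sub_le (a := u n (Y n p) - g (Y n p)) (b := (f p.1 : ℝ) - g (Y n p))
        rwa [sub_sub_sub_cancel_right] at this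
    _ = ∫⁻ p, ‖u n (Y n p) - g (Y n p)‖ₑ ∂Λ + ∫⁻ p, ‖(f p.1 : ℝ) - g (Y n p)‖ₑ ∂Λ :=
        lintegral_add_right _ (by fun_prop)
    _ ≤ (δ / 4 + δ / 4) + (δ / 4 + δ / 4) := add_le_add (hB.trans hA) hA
    _ = δ := by
        have h2 : δ / 4 + δ / 4 = δ / 2 := by
          rw [← ENNReal.add_div, ← two_mul, ENNReal.div_eq_inv_mul, ENNReal.div_eq_inv_mul,
            ← mul_assoc]
          congr 1
          rw [show (4 : ℝ≥0∞) = 2 * 2 by norm_num, ENNReal.mul_inv (by simp) (by simp), mul_assoc,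
            ENNReal.inv_mul_cancel (by simp) (by simp), mul_one]
        rw [h2, ENNReal.add_halves]

/-- Lower semicontinuity of the entropy: `L¹` convergence gives almost sure convergence along a
subsequence, and Fatou applies. A supremum over the levels suffices because the entropy will be
monotone in `γ`. -/
lemma lintegral_klFun_le_iSup [NeZero (P.withDensity fun x => (f x : ℝ≥0∞))]
    [IsFiniteMeasure (P.withDensity fun x => (f x : ℝ≥0∞))] (hf : Measurable f)
    (hfi : Integrable (fun x => (f x : ℝ)) P) :
    ∫⁻ x, ENNReal.ofReal (klFun (f x)) ∂P ≤ ⨆ n : ℕ, ∫⁻ y, ENNReal.ofReal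
      (klDensity (P.withDensity fun x => (f x : ℝ≥0∞)) P n y) := by
  have hm := measurable_klFun
  have hm2 := measurable_posteriorMean (P := P) (f := f)
  set Λ := P.prod (stdGaussian (EuclideanSpace ℝ (Fin d))) with hΛ
  set U : ℕ → EuclideanSpace ℝ (Fin d) × EuclideanSpace ℝ (Fin d) → ℝ := fun n p =>
    smoothDensity (P.withDensity fun x => (f x : ℝ≥0∞)) n
        (p.1 + Real.exp (-((n : ℝ) / 2)) • p.2) /
        smoothDensity P n (p.1 + Real.exp (-((n : ℝ) / 2)) • p.2) with hU
  have hUm (n : ℕ) : Measurable (U n) := (hm2 n).comp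
    (f := fun p : EuclideanSpace ℝ (Fin d) × EuclideanSpace ℝ (Fin d) =>
      p.1 + Real.exp (-((n : ℝ) / 2)) • p.2) (by fun_prop)
  have hmeas : TendstoInMeasure Λ U atTop (fun p => (f p.1 : ℝ)) := by
    refine tendstoInMeasure_of_tendsto_eLpNorm one_ne_zero
      (fun n => (hUm n).aestronglyMeasurable)
      (Measurable.aestronglyMeasurable (by fun_prop)) ?_
    simp_rw [eLpNorm_one_eq_lintegral_enorm]
    exact tendsto_lintegral_posteriorMean_sub hf hfi
  obtain ⟨ns, -, hns⟩ := hmeas.exists_seq_tendsto_ae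
  calc ∫⁻ x, ENNReal.ofReal (klFun (f x)) ∂P
      = ∫⁻ p, ENNReal.ofReal (klFun (f p.1)) ∂Λ := by
        rw [hΛ, lintegral_prod _ (Measurable.aemeasurable (by fun_prop))]
        simp
    _ = ∫⁻ p, liminf (fun k => ENNReal.ofReal (klFun (U (ns k) p))) atTop ∂Λ := by
        refine lintegral_congr_ae ?_
        filter_upwards [hns] with p hp
        exact ((ENNReal.tendsto_ofReal ((continuous_klFun.tendsto _).comp hp)).liminf_eq).symm
    _ ≤ liminf (fun k => ∫⁻ p, ENNReal.ofReal (klFun (U (ns k) p)) ∂Λ) atTop :=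
        lintegral_liminf_le fun k => by have := hUm (ns k); fun_prop
    _ = liminf (fun k => ∫⁻ y, ENNReal.ofReal
          (klDensity (P.withDensity fun x => (f x : ℝ≥0∞)) P (ns k) y)) atTop := by
        congr 1
        ext k
        have := hUm (ns k)
        rw [lintegral_klDensity_eq, hΛ, lintegral_prod _ (Measurable.aemeasurable (by fun_prop))]
    _ ≤ _ := liminf_le_of_le (h := fun b hb => by
        obtain ⟨k, hk⟩ := hb.exists
        exact hk.trans (le_iSup (fun n : ℕ => ∫⁻ y, ENNReal.ofReal
          (klDensity (P.withDensity fun x => (f x : ℝ≥0∞)) P n y)) (ns k)))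

end EntropyLimitAtTop

/-! ### The entropy as total dissipation -/

section EntropyIdentity

variable {d : ℕ} {P : Measure (EuclideanSpace ℝ (Fin d))} [IsProbabilityMeasure P]
  {f : EuclideanSpace ℝ (Fin d) → ℝ≥0}

/-- The relative entropy of `f • P` with respect to `P` is the relative entropy of the masses plus
half the integral over all noise levels of the squared distance between the noise estimates. -/
theorem lintegral_klFun_eq_add_lintegral_dissipation (hf : Measurable f)
    (hK : ∫⁻ x, ENNReal.ofReal (klFun (f x)) ∂P ≠ ∞) :
    ∫⁻ x, ENNReal.ofReal (klFun (f x)) ∂P = ENNReal.ofReal (klFun (∫ x, f x ∂P)) +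
      ∫⁻ γ : ℝ, ∫⁻ y, ENNReal.ofReal
        (dissipation (P.withDensity fun x => (f x : ℝ≥0∞)) P γ y / 2) := by
  have hfi := integrable_coe_of_lintegral_klFun_ne_top hf hK
  have : IsFiniteMeasure (P.withDensity fun x => (f x : ℝ≥0∞)) :=
    isFiniteMeasure_withDensity (lintegral_ne_top_of_lintegral_klFun_ne_top hf hK)
  -- The energy identity needs positive smoothed densities. If `f` vanishes almost everywhere, there
  -- is no dissipation and both sides equal `klFun 0 = 1`.
  by_cases hQ : P.withDensity (fun x => (f x : ℝ≥0∞)) = 0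
  · have h0 : ∀ᵐ x ∂P, f x = 0 := by
      filter_upwards [(withDensity_eq_zero_iff (by fun_prop)).1 hQ] with x hx
      simpa using hx
    have h1 : ∫ x, (f x : ℝ) ∂P = 0 :=
      integral_eq_zero_of_ae (h0.mono fun x hx => by simp [hx])
    have h2 : ∫⁻ x, ENNReal.ofReal (klFun (f x)) ∂P = ∫⁻ _, 1 ∂P :=
      lintegral_congr_ae (h0.mono fun x hx => by simp [hx, klFun_zero])
    rw [h1, h2, hQ]
    simp [dissipation, smoothDensity, gaussMoment, klFun_zero]
  have : NeZero (P.withDensity fun x => (f x : ℝ≥0∞)) := ⟨hQ⟩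
  set Q := P.withDensity fun x => (f x : ℝ≥0∞)
  set KL := ∫⁻ x, ENNReal.ofReal (klFun (f x)) ∂P with hKL
  set H : ℝ → ℝ≥0∞ := fun γ => ∫⁻ y, ENNReal.ofReal (klDensity Q P γ y) with hH
  have hHle (γ : ℝ) : H γ ≤ KL := lintegral_klDensity_le hf hK γ
  have henergy {a b : ℝ} (hab : a ≤ b) : H a + ∫⁻ γ in Set.Ioc a b, ∫⁻ y,
      ENNReal.ofReal (dissipation Q P γ y / 2) = H b := by
    refine lintegral_klDensity_add_dissipation (K := KL.toReal) (integrable_klDensity hf hK)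
      (fun γ => ?_) hab
    rw [integral_eq_lintegral_of_nonneg_ae (ae_of_all _ fun y => klDensity_nonneg γ y)
      (integrable_klDensity hf hK γ).1]
    exact ENNReal.toReal_mono hK (hHle γ)
  have hmono : Monotone fun n : ℕ => H n := fun m n hmn => by
    have := henergy (a := m) (b := n) (by exact_mod_cast hmn)
    exact le_self_add.trans this.le
  have hsup : ⨆ n : ℕ, H n = KL :=
    le_antisymm (iSup_le fun n => hHle n) (lintegral_klFun_le_iSup hf hfi)
  have ht1 : Tendsto (fun n : ℕ => H n) atTop (𝓝 KL) := hsup ▸ tendsto_atTop_iSup hmono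
  have ht2 := tendsto_lintegral_klDensity_atBot (P := P) hf hK
  have hD : Measurable fun γ : ℝ => ∫⁻ y, ENNReal.ofReal (dissipation Q P γ y / 2) := by
    have hc := continuous_dissipation (ρ := Q) (η := P)
    exact Measurable.lintegral_prod_right'
      (f := fun p : ℝ × EuclideanSpace ℝ (Fin d) => ENNReal.ofReal (dissipation Q P p.1 p.2 / 2))
      (ENNReal.measurable_ofReal.comp (hc.measurable.div_const 2))
  have ht3 := (aecover_Ioc (μ := (volume : Measure ℝ)) (l := atTop (α := ℕ))
    (a := fun n : ℕ => -(n : ℝ)) (b := fun n : ℕ => (n : ℝ))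
    (tendsto_neg_atTop_atBot.comp tendsto_natCast_atTop_atTop)
    tendsto_natCast_atTop_atTop).lintegral_tendsto_of_countably_generated hD.aemeasurable
  -- The energy identity on `(-n, n]`, with both endpoints sent to infinity.
  refine tendsto_nhds_unique ht1 ((ht2.add ht3).congr fun n => ?_)
  exact henergy (by have : (0 : ℝ) ≤ n := by positivity
                    linarith)

end EntropyIdentity

/-! ### The identity for probability measures -/

section KlDivDissipation

variable {d : ℕ} {Q P : Measure (EuclideanSpace ℝ (Fin d))}

lemma withDensity_toNNReal_rnDeriv {α : Type*} [MeasurableSpace α] {Q P : Measure α}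
    [IsFiniteMeasure Q] [SigmaFinite P] (h : Q ≪ P) :
    P.withDensity (fun x => ((Q.rnDeriv P x).toNNReal : ℝ≥0∞)) = Q := by
  rw [← Measure.withDensity_rnDeriv_eq Q P h]
  refine withDensity_congr_ae ?_
  rw [Measure.withDensity_rnDeriv_eq Q P h]
  filter_upwards [Measure.rnDeriv_lt_top Q P] with x hx using ENNReal.coe_toNNReal hx.ne

/-- The relative entropy of two probability measures is half the integral over all noise levels of
the squared distance between the noise estimates. -/
theorem klDiv_eq_lintegral_dissipation [IsProbabilityMeasure Q] [IsProbabilityMeasure P]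
    (h : klDiv Q P ≠ ∞) :
    klDiv Q P = ∫⁻ γ : ℝ, ∫⁻ y, ENNReal.ofReal (dissipation Q P γ y / 2) := by
  have hac : Q ≪ P := (klDiv_ne_top_iff.1 h).1
  have hw := withDensity_toNNReal_rnDeriv hac
  have hf : Measurable fun x => (Q.rnDeriv P x).toNNReal := by fun_prop
  have hkl : klDiv Q P = ∫⁻ x, ENNReal.ofReal (klFun ((Q.rnDeriv P x).toNNReal : ℝ)) ∂P :=
    klDiv_eq_lintegral_klFun_of_ac hac
  have h1 : ∫ x, ((Q.rnDeriv P x).toNNReal : ℝ) ∂P = 1 := by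
    have := Measure.integral_toReal_rnDeriv hac
    rwa [probReal_univ] at this
  have := lintegral_klFun_eq_add_lintegral_dissipation hf (hkl ▸ h)
  rw [hw, h1, klFun_one, ENNReal.ofReal_zero, zero_add, ← hkl] at this
  exact this

lemma lintegral_klDensity_le_klDiv [IsProbabilityMeasure Q] [IsProbabilityMeasure P]
    (h : klDiv Q P ≠ ∞) (γ : ℝ) :
    ∫⁻ y, ENNReal.ofReal (klDensity Q P γ y) ≤ klDiv Q P := by
  have hac : Q ≪ P := (klDiv_ne_top_iff.1 h).1
  have hw := withDensity_toNNReal_rnDeriv hac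
  have hf : Measurable fun x => (Q.rnDeriv P x).toNNReal := by fun_prop
  have hkl : klDiv Q P = ∫⁻ x, ENNReal.ofReal (klFun ((Q.rnDeriv P x).toNNReal : ℝ)) ∂P :=
    klDiv_eq_lintegral_klFun_of_ac hac
  have : IsFiniteMeasure (P.withDensity fun x => ((Q.rnDeriv P x).toNNReal : ℝ≥0∞)) := by
    rw [hw]; infer_instance
  have : NeZero (P.withDensity fun x => ((Q.rnDeriv P x).toNNReal : ℝ≥0∞)) := by
    rw [hw]; infer_instance
  have := lintegral_klDensity_le hf (hkl ▸ h) γ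
  rwa [hw, ← hkl] at this

end KlDivDissipation

/-! ### Square integrability of a mismatched noise estimate -/

section SecondMoment

variable {d : ℕ}

lemma lintegral_exp_sq_norm_stdGaussian_ne_top :
    ∫⁻ e, ENNReal.ofReal (Real.exp (‖e‖ ^ 2 / 4)) ∂stdGaussian (EuclideanSpace ℝ (Fin d)) ≠ ∞ := by
  have hm : Measurable (heatKernel 0 : EuclideanSpace ℝ (Fin d) → ℝ) :=
    (continuous_heatKernel_right 0).measurable
  have hN := map_smul_stdGaussian (d := d) 0
  simp only [zero_div, neg_zero, Real.exp_zero, one_smul, Measure.map_id'] at hN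
  rw [hN, lintegral_withDensity_eq_lintegral_mul _ (by fun_prop) (by fun_prop)]
  -- The factor `exp (‖e‖² / 4)` halves the Gaussian exponent. What remains is the density with
  -- covariance `2 • 1`, which is the level `-log 2`, up to a constant.
  have hint := (integrable_heatKernel_volume (d := d) (-Real.log 2)).const_mul
    (Real.exp (Real.log 2 * d / 2))
  have : ∀ e : EuclideanSpace ℝ (Fin d), ENNReal.ofReal (heatKernel 0 e) *
      ENNReal.ofReal (Real.exp (‖e‖ ^ 2 / 4)) =
      ENNReal.ofReal (Real.exp (Real.log 2 * d / 2) * heatKernel (-Real.log 2) e) := by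
    intro e
    rw [← ENNReal.ofReal_mul (heatKernel_pos _ _).le]
    congr 1
    simp only [heatKernel]
    rw [mul_assoc, ← Real.exp_add, mul_left_comm, ← Real.exp_add]
    congr 2
    rw [Real.exp_neg, Real.exp_log two_pos, Real.exp_zero]
    ring
  simp only [Pi.mul_apply, this]
  exact hint.lintegral_lt_top.ne

/-- The tangent plane at `n` of the convex function `exp (‖·‖² / 4)`, to be integrated over a
posterior. -/
lemma exp_sq_norm_tangent_le {E : Type*} [NormedAddCommGroup E] [InnerProductSpace ℝ E] (n v : E) :
    Real.exp (‖n‖ ^ 2 / 4) * (1 + inner ℝ n (v - n) / 2) ≤ Real.exp (‖v‖ ^ 2 / 4) := by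
  have h1 : 2 * inner ℝ n (v - n) ≤ ‖v‖ ^ 2 - ‖n‖ ^ 2 := by
    have := norm_sub_sq_real v n
    rw [inner_sub_right, real_inner_self_eq_norm_sq, real_inner_comm]
    nlinarith [sq_nonneg ‖v - n‖]
  have h2 := Real.add_one_le_exp ((‖v‖ ^ 2 - ‖n‖ ^ 2) / 4)
  calc _ ≤ Real.exp (‖n‖ ^ 2 / 4) * Real.exp ((‖v‖ ^ 2 - ‖n‖ ^ 2) / 4) := by
        gcongr; linarith
    _ = _ := by rw [← Real.exp_add]; congr 1; ring

lemma integrable_heatKernel_smul_sub {ρ : Measure (EuclideanSpace ℝ (Fin d))} [IsFiniteMeasure ρ]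
    (γ : ℝ) (y n : EuclideanSpace ℝ (Fin d)) :
    Integrable (fun x => heatKernel γ (y - x) • (Real.exp (γ / 2) • (y - x) - n)) ρ := by
  simp only [smul_sub (heatKernel _ _)]
  exact (integrable_heatKernel_smul γ y).sub ((integrable_heatKernel γ y).smul_const n)

lemma integral_heatKernel_smul_sub_noiseEst {ρ : Measure (EuclideanSpace ℝ (Fin d))}
    [IsFiniteMeasure ρ] [NeZero ρ] (γ : ℝ) (y : EuclideanSpace ℝ (Fin d)) :
    ∫ x, heatKernel γ (y - x) • (Real.exp (γ / 2) • (y - x) - noiseEst ρ γ y) ∂ρ = 0 := by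
  simp only [smul_sub (heatKernel _ _)]
  rw [integral_sub (integrable_heatKernel_smul γ y) ((integrable_heatKernel γ y).smul_const _),
    integral_smul_const, ← smoothDensity_eq, noiseEst,
    smul_inv_smul₀ (smoothDensity_pos γ y).ne', sub_self]

lemma ofReal_integral_le_lintegral {α : Type*} [MeasurableSpace α] {μ : Measure α} {g : α → ℝ}
    (hg : Integrable g μ) : ENNReal.ofReal (∫ x, g x ∂μ) ≤ ∫⁻ x, ENNReal.ofReal (g x) ∂μ := by
  rw [integral_eq_lintegral_pos_part_sub_lintegral_neg_part hg]
  exact (ENNReal.ofReal_le_ofReal (sub_le_self _ ENNReal.toReal_nonneg)).trans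
    ENNReal.ofReal_toReal_le

/-- Jensen for `exp (‖·‖² / 4)` under the posterior: at the posterior mean the linear term of the
tangent plane integrates to zero. Working with `lintegral` on the right avoids assuming that the
exponential is integrable. -/
lemma ofReal_smoothDensity_mul_exp_le {P : Measure (EuclideanSpace ℝ (Fin d))} [IsFiniteMeasure P]
    [NeZero P] (γ : ℝ) (y : EuclideanSpace ℝ (Fin d)) :
    ENNReal.ofReal (smoothDensity P γ y * Real.exp (‖noiseEst P γ y‖ ^ 2 / 4)) ≤
      ∫⁻ x, ENNReal.ofReal (heatKernel γ (y - x)) *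
        ENNReal.ofReal (Real.exp (‖Real.exp (γ / 2) • (y - x)‖ ^ 2 / 4)) ∂P := by
  set n := noiseEst P γ y with hn
  have hp := smoothDensity_pos (ρ := P) γ y
  have hi1 := integrable_heatKernel (ρ := P) γ y
  have hi3 := integrable_heatKernel_smul_sub (ρ := P) γ y n
  have hz : ∫ x, heatKernel γ (y - x) • (Real.exp (γ / 2) • (y - x) - n) ∂P = 0 :=
    integral_heatKernel_smul_sub_noiseEst γ y
  have hi4 : Integrable (fun x => heatKernel γ (y - x) *
      (Real.exp (‖n‖ ^ 2 / 4) * (1 + inner ℝ n (Real.exp (γ / 2) • (y - x) - n) / 2))) P := by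
    have := (hi1.const_mul (Real.exp (‖n‖ ^ 2 / 4))).add
      ((hi3.const_inner (𝕜 := ℝ) n).const_mul (Real.exp (‖n‖ ^ 2 / 4) / 2))
    refine this.congr (ae_of_all _ fun x => ?_)
    simp only [Pi.add_apply, inner_smul_right]
    ring
  have hi5 : ∫ x, heatKernel γ (y - x) *
      (Real.exp (‖n‖ ^ 2 / 4) * (1 + inner ℝ n (Real.exp (γ / 2) • (y - x) - n) / 2)) ∂P =
      smoothDensity P γ y * Real.exp (‖n‖ ^ 2 / 4) := by
    have h1 : ∫ x, inner ℝ n (heatKernel γ (y - x) • (Real.exp (γ / 2) • (y - x) - n)) ∂P = 0 := by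
      rw [integral_inner hi3, hz, inner_zero_right]
    calc _ = ∫ x, (Real.exp (‖n‖ ^ 2 / 4) * heatKernel γ (y - x) + Real.exp (‖n‖ ^ 2 / 4) / 2 *
          inner ℝ n (heatKernel γ (y - x) • (Real.exp (γ / 2) • (y - x) - n))) ∂P := by
          refine integral_congr_ae (ae_of_all _ fun x => ?_)
          simp only [inner_smul_right]
          ring
      _ = _ := by
          rw [integral_add (hi1.const_mul _) ((hi3.const_inner (𝕜 := ℝ) n).const_mul _),
            integral_const_mul, integral_const_mul, h1, ← smoothDensity_eq]
          ring
  rw [← hi5]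
  refine (ofReal_integral_le_lintegral hi4).trans (lintegral_mono fun x => ?_)
  rw [← ENNReal.ofReal_mul (heatKernel_pos _ _).le]
  exact ENNReal.ofReal_le_ofReal (mul_le_mul_of_nonneg_left (exp_sq_norm_tangent_le _ _)
    (heatKernel_pos _ _).le)

/-- The noise estimate of `P` is square integrable for the smoothing of `Q` when the relative
entropy of `Q` with respect to `P` is finite. -/
lemma lintegral_smoothDensity_mul_sq_noiseEst_le {Q P : Measure (EuclideanSpace ℝ (Fin d))}
    [IsProbabilityMeasure Q] [IsProbabilityMeasure P] (h : klDiv Q P ≠ ∞) (γ : ℝ) :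
    ∫⁻ y, ENNReal.ofReal (smoothDensity Q γ y) * ENNReal.ofReal (‖noiseEst P γ y‖ ^ 2 / 4) ≤
      klDiv Q P + ∫⁻ e, ENNReal.ofReal (Real.exp (‖e‖ ^ 2 / 4))
        ∂stdGaussian (EuclideanSpace ℝ (Fin d)) := by
  have hcK := continuous_klDensity (ρ := Q) (η := P)
  have hcG := continuous_heatKernel_right (d := d) γ
  have hF : Measurable fun p : EuclideanSpace ℝ (Fin d) × EuclideanSpace ℝ (Fin d) =>
      ENNReal.ofReal (Real.exp (‖Real.exp (γ / 2) • (p.2 - p.1)‖ ^ 2 / 4)) := by fun_prop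
  -- Since `exp (γ / 2) • (y - x)` is the noise itself, this exponential moment depends neither on
  -- `P` nor on `γ`.
  have hch := lintegral_lintegral_channel P γ hF
  simp only [add_sub_cancel_left, smul_smul, ← Real.exp_add, add_neg_cancel, Real.exp_zero,
    one_smul, lintegral_const, measure_univ, mul_one] at hch
  calc _ ≤ ∫⁻ y, (ENNReal.ofReal (klDensity Q P γ y) +
        ∫⁻ x, ENNReal.ofReal (heatKernel γ (y - x)) *
        ENNReal.ofReal (Real.exp (‖Real.exp (γ / 2) • (y - x)‖ ^ 2 / 4)) ∂P) := by
        refine lintegral_mono fun y => ?_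
        have hp := smoothDensity_pos (ρ := P) γ y
        have hq := smoothDensity_nonneg (ρ := Q) γ y
        rw [← ENNReal.ofReal_mul hq]
        refine le_trans ?_ (add_le_add_right (ofReal_smoothDensity_mul_exp_le γ y) _)
        rw [← ENNReal.ofReal_add (klDensity_nonneg γ y) (by positivity)]
        refine ENNReal.ofReal_le_ofReal ?_
        -- The entropy inequality: passing from `P` to `Q` costs the relative entropy plus an
        -- exponential moment under `P`.
        have hy := young_klFun (g := ‖noiseEst P γ y‖ ^ 2 / 4)
          (div_nonneg hq hp.le : 0 ≤ smoothDensity Q γ y / smoothDensity P γ y)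
        have := mul_le_mul_of_nonneg_left hy hp.le
        rw [← mul_assoc, mul_div_cancel₀ _ hp.ne'] at this
        rw [klDensity_eq]
        nlinarith
    _ = (∫⁻ y, ENNReal.ofReal (klDensity Q P γ y)) +
        ∫⁻ e, ENNReal.ofReal (Real.exp (‖e‖ ^ 2 / 4)) ∂stdGaussian (EuclideanSpace ℝ (Fin d)) := by
        rw [lintegral_add_left (by fun_prop), hch]
    _ ≤ _ := by gcongr; exact lintegral_klDensity_le_klDiv h γ

end SecondMoment

/-! ### Joint measurability in the level, the condition and the observation -/

section KernelMeasurability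

variable {S : Type*} [MeasurableSpace S] {d : ℕ} (κ : Kernel S (EuclideanSpace ℝ (Fin d)))
  [IsMarkovKernel κ]

lemma measurable_smoothDensity_kernel :
    Measurable fun p : (ℝ × S) × EuclideanSpace ℝ (Fin d) => smoothDensity (κ p.1.2) p.1.1 p.2 := by
  have hc := continuous_heatKernel (d := d)
  have h := StronglyMeasurable.integral_kernel_prod_right'
    (κ := κ.comap (fun p : (ℝ × S) × EuclideanSpace ℝ (Fin d) => p.1.2) (by fun_prop))
    (f := fun p : ((ℝ × S) × EuclideanSpace ℝ (Fin d)) × EuclideanSpace ℝ (Fin d) =>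
      heatKernel p.1.1.1 (p.1.2 - p.2))
    (Measurable.stronglyMeasurable
      (hc.measurable.comp (g := fun q : ℝ × EuclideanSpace ℝ (Fin d) => heatKernel q.1 q.2)
        (f := fun p : ((ℝ × S) × EuclideanSpace ℝ (Fin d)) × EuclideanSpace ℝ (Fin d) =>
          (p.1.1.1, p.1.2 - p.2)) (by fun_prop)))
  simp only [smoothDensity_eq]
  exact h.measurable

lemma measurable_noiseEst_kernel :
    Measurable fun p : (ℝ × S) × EuclideanSpace ℝ (Fin d) => noiseEst (κ p.1.2) p.1.1 p.2 := by
  have hc := continuous_heatKernel (d := d)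
  have hm : Measurable fun p : ((ℝ × S) × EuclideanSpace ℝ (Fin d)) × EuclideanSpace ℝ (Fin d) =>
      heatKernel p.1.1.1 (p.1.2 - p.2) :=
    hc.measurable.comp (g := fun q : ℝ × EuclideanSpace ℝ (Fin d) => heatKernel q.1 q.2)
        (f := fun p : ((ℝ × S) × EuclideanSpace ℝ (Fin d)) × EuclideanSpace ℝ (Fin d) =>
          (p.1.1.1, p.1.2 - p.2)) (by fun_prop)
  have h := StronglyMeasurable.integral_kernel_prod_right'
    (κ := κ.comap (fun p : (ℝ × S) × EuclideanSpace ℝ (Fin d) => p.1.2) (by fun_prop))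
    (f := fun p : ((ℝ × S) × EuclideanSpace ℝ (Fin d)) × EuclideanSpace ℝ (Fin d) =>
      heatKernel p.1.1.1 (p.1.2 - p.2) • Real.exp (p.1.1.1 / 2) • (p.1.2 - p.2))
    (Measurable.stronglyMeasurable (by fun_prop))
  exact (measurable_smoothDensity_kernel κ).inv.smul h.measurable

lemma measurable_dissipation_kernel (η : Kernel S (EuclideanSpace ℝ (Fin d))) [IsMarkovKernel η] :
    Measurable fun p : (ℝ × S) × EuclideanSpace ℝ (Fin d) =>
      dissipation (κ p.1.2) (η p.1.2) p.1.1 p.2 := by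
  have h1 := measurable_smoothDensity_kernel κ
  have h2 := measurable_noiseEst_kernel κ
  have h3 := measurable_noiseEst_kernel η
  unfold dissipation
  fun_prop

end KernelMeasurability

/-! ### Relative entropy of kernels -/

section ConditionalKlDiv

variable {α β : Type*} [MeasurableSpace α] [MeasurableSpace β]
  [MeasurableSpace.CountableOrCountablyGenerated α β] (κ η : Kernel α β)
  [IsFiniteKernel κ] [IsFiniteKernel η]

/-- The kernel Radon-Nikodym derivative is jointly measurable and, for each `a`, a version of the
derivative of the measures. The value `∞` is taken off the measurable set of absolute continuity. -/
lemma measurable_klDiv_kernel : Measurable fun a => klDiv (κ a) (η a) := by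
  classical
  have hk := measurable_klFun
  have h : Measurable fun a => ∫⁻ b, ENNReal.ofReal (klFun (κ.rnDeriv η a b).toReal) ∂(η a) :=
    Measurable.lintegral_kernel_prod_right'
      (f := fun p : α × β => ENNReal.ofReal (klFun (κ.rnDeriv η p.1 p.2).toReal))
      (by have := Kernel.measurable_rnDeriv κ η; fun_prop)
  have heq : (fun a => klDiv (κ a) (η a)) = fun a => if κ a ≪ η a then
      ∫⁻ b, ENNReal.ofReal (klFun (κ.rnDeriv η a b).toReal) ∂(η a) else ∞ := by
    funext a
    rw [klDiv_eq_lintegral_klFun]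
    refine if_congr Iff.rfl (lintegral_congr_ae ?_) rfl
    filter_upwards [Kernel.rnDeriv_eq_rnDeriv_measure (κ := κ) (η := η) (a := a)] with b hb
    rw [hb]
  rw [heq]
  exact Measurable.ite (Kernel.measurableSet_absolutelyContinuous κ η) h measurable_const

/-- The relative entropy of two composition-products with the same first marginal is the mean of the
relative entropies of the kernels. -/
theorem klDiv_compProd_right (π : Measure α) [IsFiniteMeasure π] :
    klDiv (π ⊗ₘ κ) (π ⊗ₘ η) = ∫⁻ a, klDiv (κ a) (η a) ∂π := by
  have hk := measurable_klFun
  by_cases h : ∀ᵐ a ∂π, κ a ≪ η a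
  · have hac := Measure.AbsolutelyContinuous.compProd_right (μ := π) h
    have hm := Kernel.measurable_rnDeriv κ η
    have hw : π ⊗ₘ κ = (π ⊗ₘ η).withDensity fun p => κ.rnDeriv η p.1 p.2 := by
      refine Measure.ext_of_lintegral _ fun F hF => ?_
      rw [lintegral_withDensity_eq_lintegral_mul _ hm hF, Measure.lintegral_compProd hF,
        Measure.lintegral_compProd (hm.mul hF)]
      refine lintegral_congr_ae (h.mono fun a ha => ?_)
      have hma := Kernel.measurable_rnDeriv_right κ η a
      beta_reduce
      rw [← Kernel.withDensity_rnDeriv_eq ha, Kernel.withDensity_apply _ hm,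
        lintegral_withDensity_eq_lintegral_mul _ hma (by fun_prop)]
      rfl
    have hd : (π ⊗ₘ κ).rnDeriv (π ⊗ₘ η) =ᵐ[π ⊗ₘ η] fun p => κ.rnDeriv η p.1 p.2 := by
      conv_lhs => rw [hw]
      exact Measure.rnDeriv_withDensity _ hm
    rw [klDiv_eq_lintegral_klFun_of_ac hac]
    calc _ = ∫⁻ p, ENNReal.ofReal (klFun (κ.rnDeriv η p.1 p.2).toReal) ∂(π ⊗ₘ η) :=
          lintegral_congr_ae (hd.mono fun p hp => by rw [hp])
      _ = ∫⁻ a, ∫⁻ b, ENNReal.ofReal (klFun (κ.rnDeriv η a b).toReal) ∂(η a) ∂π :=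
          Measure.lintegral_compProd (by fun_prop)
      _ = _ := by
          refine lintegral_congr_ae (h.mono fun a ha => ?_)
          beta_reduce
          rw [klDiv_eq_lintegral_klFun_of_ac ha]
          refine lintegral_congr_ae ?_
          filter_upwards [Kernel.rnDeriv_eq_rnDeriv_measure (κ := κ) (η := η) (a := a)] with b hb
          rw [hb]
  -- The left side is infinite. A finite right side would make the inner entropies finite, hence the
  -- kernels absolutely continuous, almost everywhere.
  · have hnac : ¬ (π ⊗ₘ κ ≪ π ⊗ₘ η) := fun h' => h h'.kernel_of_compProd
    rw [klDiv_of_not_ac hnac]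
    by_contra hne
    refine h ((ae_lt_top (measurable_klDiv_kernel κ η) (Ne.symm hne)).mono fun a ha => ?_)
    exact (klDiv_ne_top_iff.1 ha.ne).1

end ConditionalKlDiv

/-! ### The entropy identity given a condition -/

section Observation

variable {Ω : Type*} [MeasurableSpace Ω] {μ : Measure Ω} [IsProbabilityMeasure μ]
  {S : Type*} [MeasurableSpace S] {d : ℕ}
  {z ε : Ω → EuclideanSpace ℝ (Fin d)} {s : Ω → S}

/-- The joint law of the condition, the signal and the noisy observation. -/
lemma lintegral_comp_observation (hz : Measurable z) (hε : Measurable ε) (hs : Measurable s)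
    (hεlaw : μ.map ε = stdGaussian (EuclideanSpace ℝ (Fin d)))
    (hεs : IndepFun ε (fun ω => (z ω, s ω)) μ) (γ : ℝ)
    {F : S × EuclideanSpace ℝ (Fin d) × EuclideanSpace ℝ (Fin d) → ℝ≥0∞} (hF : Measurable F) :
    ∫⁻ ω, F (s ω, z ω, z ω + Real.exp (-(γ / 2)) • ε ω) ∂μ =
      ∫⁻ t, ∫⁻ y, ∫⁻ x, ENNReal.ofReal (heatKernel γ (y - x)) * F (t, x, y)
        ∂(condDistrib z s μ t) ∂(volume : Measure (EuclideanSpace ℝ (Fin d))) ∂(μ.map s) := by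
  have hind : IndepFun (fun ω => (s ω, z ω)) ε μ :=
    (hεs.comp measurable_id measurable_swap).symm
  have hlaw : μ.map (fun ω => ((s ω, z ω), ε ω)) =
      (μ.map fun ω => (s ω, z ω)).prod (stdGaussian (EuclideanSpace ℝ (Fin d))) := by
    rw [← hεlaw]
    exact (indepFun_iff_map_prod_eq_prod_map_map (by fun_prop) (by fun_prop)).1 hind
  have hG : Measurable fun p : (S × EuclideanSpace ℝ (Fin d)) × EuclideanSpace ℝ (Fin d) =>
      F (p.1.1, p.1.2, p.1.2 + Real.exp (-(γ / 2)) • p.2) := by fun_prop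
  calc _ = ∫⁻ p, F (p.1.1, p.1.2, p.1.2 + Real.exp (-(γ / 2)) • p.2)
        ∂(μ.map fun ω => ((s ω, z ω), ε ω)) := (lintegral_map hG (by fun_prop)).symm
    _ = ∫⁻ p, ∫⁻ e, F (p.1, p.2, p.2 + Real.exp (-(γ / 2)) • e)
        ∂stdGaussian (EuclideanSpace ℝ (Fin d)) ∂(μ.map fun ω => (s ω, z ω)) := by
        rw [hlaw, lintegral_prod _ hG.aemeasurable]
    _ = ∫⁻ t, ∫⁻ x, ∫⁻ e, F (t, x, x + Real.exp (-(γ / 2)) • e)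
        ∂stdGaussian (EuclideanSpace ℝ (Fin d)) ∂(condDistrib z s μ t) ∂(μ.map s) := by
        rw [← compProd_map_condDistrib hz.aemeasurable (X := s),
          Measure.lintegral_compProd hG.lintegral_prod_right']
    _ = _ := by
        refine lintegral_congr fun t => ?_
        exact lintegral_lintegral_channel (condDistrib z s μ t) γ
          (F := fun p => F (t, p.1, p.2)) (by fun_prop)

/-- The joint law of the condition and the noisy observation. -/
lemma lintegral_comp_observation_snd (hz : Measurable z) (hε : Measurable ε) (hs : Measurable s)
    (hεlaw : μ.map ε = stdGaussian (EuclideanSpace ℝ (Fin d)))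
    (hεs : IndepFun ε (fun ω => (z ω, s ω)) μ) (γ : ℝ)
    {F : S × EuclideanSpace ℝ (Fin d) → ℝ≥0∞} (hF : Measurable F) :
    ∫⁻ ω, F (s ω, z ω + Real.exp (-(γ / 2)) • ε ω) ∂μ =
      ∫⁻ t, ∫⁻ y, ENNReal.ofReal (smoothDensity (condDistrib z s μ t) γ y) * F (t, y)
        ∂(volume : Measure (EuclideanSpace ℝ (Fin d))) ∂(μ.map s) := by
  have hc := continuous_heatKernel_right (d := d) γ
  rw [lintegral_comp_observation hz hε hs hεlaw hεs γ (F := fun p => F (p.1, p.2.2)) (by fun_prop)]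
  refine lintegral_congr fun t => lintegral_congr fun y => ?_
  rw [ofReal_smoothDensity]
  exact lintegral_mul_const (F (t, y)) (f := fun x => ENNReal.ofReal (heatKernel γ (y - x)))
    (by fun_prop)

variable {κ : Kernel S (EuclideanSpace ℝ (Fin d))} [IsMarkovKernel κ] {ν : Measure S}
  [IsProbabilityMeasure ν]

/-- The chain rule over the condition. The reference `ν ⊗ₘ κ` is arbitrary, so `κ` can be the
conditional law for a different condition or the unconditional law. -/
lemma klDiv_map_eq_add_lintegral_klDiv (hz : Measurable z) (hs : Measurable s) :
    klDiv (μ.map fun ω => (s ω, z ω)) (ν ⊗ₘ κ) =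
      klDiv (μ.map s) ν + ∫⁻ t, klDiv (condDistrib z s μ t) (κ t) ∂(μ.map s) := by
  have := Measure.isProbabilityMeasure_map (μ := μ) hs.aemeasurable
  rw [← compProd_map_condDistrib hz.aemeasurable (X := s), klDiv_compProd_eq_add,
    klDiv_compProd_right]

lemma ae_klDiv_condDistrib_ne_top (hz : Measurable z) (hs : Measurable s)
    (h : klDiv (μ.map fun ω => (s ω, z ω)) (ν ⊗ₘ κ) ≠ ∞) :
    ∀ᵐ t ∂(μ.map s), klDiv (condDistrib z s μ t) (κ t) ≠ ∞ := by
  rw [klDiv_map_eq_add_lintegral_klDiv hz hs] at h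
  exact (ae_lt_top (measurable_klDiv_kernel _ _) (ENNReal.add_ne_top.1 h).2).mono
    fun t ht => ht.ne

/-- The relative entropy of the joint law of the condition and the signal is the relative entropy
of the condition plus half the integral over all noise levels of the mean squared distance between
the noise estimates. -/
theorem klDiv_map_eq_add_lintegral_sq_noiseEst_sub (hz : Measurable z) (hε : Measurable ε)
    (hs : Measurable s) (hεlaw : μ.map ε = stdGaussian (EuclideanSpace ℝ (Fin d)))
    (hεs : IndepFun ε (fun ω => (z ω, s ω)) μ)
    (h : klDiv (μ.map fun ω => (s ω, z ω)) (ν ⊗ₘ κ) ≠ ∞) :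
    klDiv (μ.map fun ω => (s ω, z ω)) (ν ⊗ₘ κ) = klDiv (μ.map s) ν + ∫⁻ γ : ℝ, ∫⁻ ω,
      ENNReal.ofReal (‖noiseEst (condDistrib z s μ (s ω)) γ (z ω + Real.exp (-(γ / 2)) • ε ω) -
        noiseEst (κ (s ω)) γ (z ω + Real.exp (-(γ / 2)) • ε ω)‖ ^ 2 / 2) ∂μ := by
  have := Measure.isProbabilityMeasure_map (μ := μ) hs.aemeasurable
  have hD := measurable_dissipation_kernel (condDistrib z s μ) κ
  have hn1 := measurable_noiseEst_kernel (condDistrib z s μ)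
  have hn2 := measurable_noiseEst_kernel κ
  rw [klDiv_map_eq_add_lintegral_klDiv hz hs]
  congr 1
  calc _ = ∫⁻ t, (∫⁻ γ : ℝ, ∫⁻ y, ENNReal.ofReal
        (dissipation (condDistrib z s μ t) (κ t) γ y / 2)) ∂(μ.map s) :=
        lintegral_congr_ae ((ae_klDiv_condDistrib_ne_top hz hs h).mono fun t ht =>
          klDiv_eq_lintegral_dissipation ht)
    _ = ∫⁻ γ : ℝ, ∫⁻ t, (∫⁻ y, ENNReal.ofReal
        (dissipation (condDistrib z s μ t) (κ t) γ y / 2)) ∂(μ.map s) := by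
        refine lintegral_lintegral_swap (Measurable.aemeasurable ?_)
        exact Measurable.lintegral_prod_right'
          (f := fun p : (S × ℝ) × EuclideanSpace ℝ (Fin d) => ENNReal.ofReal
            (dissipation (condDistrib z s μ p.1.1) (κ p.1.1) p.1.2 p.2 / 2))
          ((hD.comp (f := fun p : (S × ℝ) × EuclideanSpace ℝ (Fin d) => ((p.1.2, p.1.1), p.2))
            (by fun_prop)).div_const 2).ennreal_ofReal
    _ = _ := by
        refine lintegral_congr fun γ => ?_
        have hm1 : Measurable fun p : S × EuclideanSpace ℝ (Fin d) =>
            noiseEst (condDistrib z s μ p.1) γ p.2 :=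
          hn1.comp (f := fun p : S × EuclideanSpace ℝ (Fin d) => ((γ, p.1), p.2)) (by fun_prop)
        have hm2 : Measurable fun p : S × EuclideanSpace ℝ (Fin d) => noiseEst (κ p.1) γ p.2 :=
          hn2.comp (f := fun p : S × EuclideanSpace ℝ (Fin d) => ((γ, p.1), p.2)) (by fun_prop)
        rw [lintegral_comp_observation_snd hz hε hs hεlaw hεs γ (F := fun p => ENNReal.ofReal
          (‖noiseEst (condDistrib z s μ p.1) γ p.2 - noiseEst (κ p.1) γ p.2‖ ^ 2 / 2))
          (by fun_prop)]
        refine lintegral_congr fun t => lintegral_congr fun y => ?_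
        rw [← ENNReal.ofReal_mul (smoothDensity_nonneg _ _), dissipation, mul_div_assoc]

/-- The noise estimate built from `κ` is square integrable when the relative entropy is finite. -/
lemma memLp_noiseEst_observation (hz : Measurable z) (hε : Measurable ε)
    (hs : Measurable s) (hεlaw : μ.map ε = stdGaussian (EuclideanSpace ℝ (Fin d)))
    (hεs : IndepFun ε (fun ω => (z ω, s ω)) μ)
    (h : klDiv (μ.map fun ω => (s ω, z ω)) (ν ⊗ₘ κ) ≠ ∞) (γ : ℝ) :
    MemLp (fun ω => noiseEst (κ (s ω)) γ (z ω + Real.exp (-(γ / 2)) • ε ω)) 2 μ := by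
  have := Measure.isProbabilityMeasure_map (μ := μ) hs.aemeasurable
  have hn2 := measurable_noiseEst_kernel κ
  have hm2 : Measurable fun p : S × EuclideanSpace ℝ (Fin d) => noiseEst (κ p.1) γ p.2 :=
    hn2.comp (f := fun p : S × EuclideanSpace ℝ (Fin d) => ((γ, p.1), p.2)) (by fun_prop)
  have hm : Measurable fun ω => noiseEst (κ (s ω)) γ (z ω + Real.exp (-(γ / 2)) • ε ω) :=
    hm2.comp (f := fun ω => (s ω, z ω + Real.exp (-(γ / 2)) • ε ω)) (by fun_prop)
  have hfin : ∫⁻ ω, ENNReal.ofReal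
      (‖noiseEst (κ (s ω)) γ (z ω + Real.exp (-(γ / 2)) • ε ω)‖ ^ 2 / 4) ∂μ < ∞ := by
    rw [lintegral_comp_observation_snd hz hε hs hεlaw hεs γ (F := fun p => ENNReal.ofReal
          (‖noiseEst (κ p.1) γ p.2‖ ^ 2 / 4)) (by fun_prop)]
    -- For almost every condition the bound is an entropy plus a fixed Gaussian constant, and the
    -- chain rule makes the mean entropy finite.
    refine (lintegral_mono_ae ((ae_klDiv_condDistrib_ne_top hz hs h).mono fun t ht =>
      lintegral_smoothDensity_mul_sq_noiseEst_le ht γ)).trans_lt ?_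
    rw [lintegral_add_right _ measurable_const, lintegral_const, measure_univ, mul_one]
    rw [klDiv_map_eq_add_lintegral_klDiv hz hs] at h
    exact ENNReal.add_lt_top.2 ⟨(ENNReal.add_ne_top.1 h).2.lt_top,
      lintegral_exp_sq_norm_stdGaussian_ne_top.lt_top⟩
  rw [memLp_two_iff_integrable_sq_norm hm.aestronglyMeasurable]
  have hi : Integrable (fun ω =>
      ‖noiseEst (κ (s ω)) γ (z ω + Real.exp (-(γ / 2)) • ε ω)‖ ^ 2 / 4) μ := by
    refine ⟨((hm.norm.pow_const 2).div_const 4).aestronglyMeasurable, ?_⟩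
    rwa [hasFiniteIntegral_iff_ofReal (ae_of_all _ fun ω => by positivity)]
  refine (hi.const_mul 4).congr (ae_of_all _ fun ω => ?_)
  beta_reduce
  ring

end Observation

/-! ### Orthogonality in `L²` -/

section SquareIntegrable

lemma MeasureTheory.MemLp.integrable_inner {α E : Type*} [MeasurableSpace α] {m : Measure α}
    [NormedAddCommGroup E] [InnerProductSpace ℝ E] {f g : α → E} (hf : MemLp f 2 m)
    (hg : MemLp g 2 m) : Integrable (fun x => inner ℝ (f x) (g x)) m := by
  refine (hf.norm.integrable_mul hg.norm).mono (hf.1.inner hg.1) (ae_of_all _ fun x => ?_)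
  simpa using norm_inner_le_norm (𝕜 := ℝ) (f x) (g x)

lemma integral_sq_norm_sub_eq_add_of_orthogonal {α E : Type*} [MeasurableSpace α] {m : Measure α}
    [NormedAddCommGroup E] [InnerProductSpace ℝ E] {f g h : α → E} (hf : MemLp f 2 m)
    (hg : MemLp g 2 m) (hh : MemLp h 2 m) (h0 : ∫ x, inner ℝ (g x - h x) (f x - g x) ∂m = 0) :
    ∫ x, ‖f x - h x‖ ^ 2 ∂m = ∫ x, ‖f x - g x‖ ^ 2 ∂m + ∫ x, ‖g x - h x‖ ^ 2 ∂m := by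
  have hin : Integrable (fun x => inner ℝ (g x - h x) (f x - g x)) m :=
    (hg.sub hh).integrable_inner (hf.sub hg)
  have i1 : Integrable (fun x => ‖f x - g x‖ ^ 2) m :=
    (hf.sub hg).integrable_norm_pow (p := 2) (by norm_num)
  have i2 : Integrable (fun x => ‖g x - h x‖ ^ 2) m :=
    (hg.sub hh).integrable_norm_pow (p := 2) (by norm_num)
  calc _ = ∫ x, ((‖f x - g x‖ ^ 2 + ‖g x - h x‖ ^ 2) +
        2 * inner ℝ (g x - h x) (f x - g x)) ∂m := by
        refine integral_congr_ae (ae_of_all _ fun x => ?_)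
        beta_reduce
        rw [← sub_add_sub_cancel (f x) (g x), norm_add_sq_real, real_inner_comm]
        ring
    _ = _ := by
        rw [integral_add (f := fun x => ‖f x - g x‖ ^ 2 + ‖g x - h x‖ ^ 2) (i1.add i2)
          (hin.const_mul 2), integral_const_mul, h0, mul_zero, add_zero, integral_add i1 i2]

lemma memLp_of_map_eq_stdGaussian {Ω : Type*} [MeasurableSpace Ω] {μ : Measure Ω} {d : ℕ}
    {ε : Ω → EuclideanSpace ℝ (Fin d)} (hε : Measurable ε)
    (hεlaw : μ.map ε = stdGaussian (EuclideanSpace ℝ (Fin d))) : MemLp ε 2 μ := by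
  have : MemLp id 2 (μ.map ε) := hεlaw ▸ IsGaussian.memLp_two_id
  exact (memLp_map_measure_iff (by fun_prop) hε.aemeasurable).1 this

end SquareIntegrable

/-! ### Identification of the MMSE estimator -/

section NoiseIdentification

variable {Ω : Type*} [MeasurableSpace Ω] {μ : Measure Ω} [IsProbabilityMeasure μ]
  {S : Type*} [MeasurableSpace S] {d : ℕ}
  {z ε : Ω → EuclideanSpace ℝ (Fin d)} {s : Ω → S}

/-- The law of the signal given the condition and the noisy observation. -/
lemma map_observation_eq_compProd (hz : Measurable z) (hε : Measurable ε) (hs : Measurable s)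
    (hεlaw : μ.map ε = stdGaussian (EuclideanSpace ℝ (Fin d)))
    (hεs : IndepFun ε (fun ω => (z ω, s ω)) μ) (γ : ℝ) :
    μ.map (fun ω => ((s ω, z ω + Real.exp (-(γ / 2)) • ε ω), z ω)) =
      ((μ.map s).prod (volume : Measure (EuclideanSpace ℝ (Fin d)))) ⊗ₘ
        (((condDistrib z s μ).comap Prod.fst measurable_fst).withDensity
          fun p x => ((heatKernel γ (p.2 - x)).toNNReal : ℝ≥0∞)) := by
  have := Measure.isProbabilityMeasure_map (μ := μ) hs.aemeasurable
  have hc := (continuous_heatKernel_right (d := d) γ).measurable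
  have hd : Measurable (Function.uncurry
      fun (p : S × EuclideanSpace ℝ (Fin d)) x => ((heatKernel γ (p.2 - x)).toNNReal : ℝ≥0∞)) := by
    unfold Function.uncurry
    fun_prop
  refine Measure.ext_of_lintegral _ fun F hF => ?_
  rw [lintegral_map hF (by fun_prop), Measure.lintegral_compProd hF,
    lintegral_comp_observation hz hε hs hεlaw hεs γ (F := fun p => F ((p.1, p.2.2), p.2.1))
    (by fun_prop), lintegral_prod _ hF.lintegral_kernel_prod_right'.aemeasurable]
  refine lintegral_congr fun t => lintegral_congr fun y => ?_
  rw [Kernel.lintegral_withDensity _ hd _ (by fun_prop)]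
  rfl

/-- The error of the noise estimate is orthogonal to every function of the condition and of the
noisy observation. -/
lemma integral_clm_sub_noiseEst_eq_zero (hz : Measurable z) (hε : Measurable ε)
    (hs : Measurable s) (hεlaw : μ.map ε = stdGaussian (EuclideanSpace ℝ (Fin d)))
    (hεs : IndepFun ε (fun ω => (z ω, s ω)) μ) (γ : ℝ)
    {F : Type*} [NormedAddCommGroup F] [NormedSpace ℝ F] [CompleteSpace F]
    {φ : S × EuclideanSpace ℝ (Fin d) → EuclideanSpace ℝ (Fin d) →L[ℝ] F}
    (hφ : StronglyMeasurable fun p : (S × EuclideanSpace ℝ (Fin d)) × EuclideanSpace ℝ (Fin d) =>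
      φ p.1 p.2)
    (hint : Integrable (fun ω => φ (s ω, z ω + Real.exp (-(γ / 2)) • ε ω)
      (ε ω - noiseEst (condDistrib z s μ (s ω)) γ (z ω + Real.exp (-(γ / 2)) • ε ω))) μ) :
    ∫ ω, φ (s ω, z ω + Real.exp (-(γ / 2)) • ε ω)
      (ε ω - noiseEst (condDistrib z s μ (s ω)) γ (z ω + Real.exp (-(γ / 2)) • ε ω)) ∂μ = 0 := by
  have := Measure.isProbabilityMeasure_map (μ := μ) hs.aemeasurable
  have hc := (continuous_heatKernel_right (d := d) γ).measurable
  have hn : Measurable fun p : S × EuclideanSpace ℝ (Fin d) =>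
      noiseEst (condDistrib z s μ p.1) γ p.2 :=
    (measurable_noiseEst_kernel (condDistrib z s μ)).comp
      (f := fun p : S × EuclideanSpace ℝ (Fin d) => ((γ, p.1), p.2)) (by fun_prop)
  -- The noise is `exp (γ / 2) • (y - x)`, so the integrand is a function of condition, observation
  -- and signal.
  set G : (S × EuclideanSpace ℝ (Fin d)) × EuclideanSpace ℝ (Fin d) → F := fun p =>
    φ p.1 (Real.exp (γ / 2) • (p.1.2 - p.2) - noiseEst (condDistrib z s μ p.1.1) γ p.1.2) with hG
  have hGm : StronglyMeasurable G := hφ.comp_measurable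
    (g := fun p : (S × EuclideanSpace ℝ (Fin d)) × EuclideanSpace ℝ (Fin d) => (p.1,
      Real.exp (γ / 2) • (p.1.2 - p.2) - noiseEst (condDistrib z s μ p.1.1) γ p.1.2))
    (measurable_fst.prodMk (Measurable.sub (by fun_prop) (hn.comp measurable_fst)))
  have hT : Measurable fun ω => ((s ω, z ω + Real.exp (-(γ / 2)) • ε ω), z ω) := by fun_prop
  have hGT (ω : Ω) : φ (s ω, z ω + Real.exp (-(γ / 2)) • ε ω)
      (ε ω - noiseEst (condDistrib z s μ (s ω)) γ (z ω + Real.exp (-(γ / 2)) • ε ω)) =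
      G ((s ω, z ω + Real.exp (-(γ / 2)) • ε ω), z ω) := by
    simp only [hG, add_sub_cancel_left, smul_smul, ← Real.exp_add, add_neg_cancel, Real.exp_zero,
      one_smul]
  simp only [hGT] at hint ⊢
  have hi : Integrable G (μ.map fun ω => ((s ω, z ω + Real.exp (-(γ / 2)) • ε ω), z ω)) :=
    (integrable_map_measure hGm.aestronglyMeasurable hT.aemeasurable).2 hint
  rw [← integral_map hT.aemeasurable hGm.aestronglyMeasurable]
  rw [map_observation_eq_compProd hz hε hs hεlaw hεs γ] at hi ⊢
  rw [Measure.integral_compProd hi]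
  refine integral_eq_zero_of_ae (ae_of_all _ fun p => ?_)
  beta_reduce
  rw [Kernel.integral_withDensity (by unfold Function.uncurry; fun_prop), Kernel.comap_apply]
  -- For fixed condition and observation `φ p` is a constant linear map, and the error has mean zero
  -- under the unnormalised posterior.
  have h0 := (φ p).integral_comp_comm
    (integrable_heatKernel_smul_sub (ρ := condDistrib z s μ p.1) γ p.2
      (noiseEst (condDistrib z s μ p.1) γ p.2))
  rw [integral_heatKernel_smul_sub_noiseEst, map_zero] at h0
  rw [Pi.zero_apply, ← h0]
  refine integral_congr_ae (ae_of_all _ fun x => ?_)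
  beta_reduce
  rw [map_smul, NNReal.smul_def, Real.coe_toNNReal _ (heatKernel_pos _ _).le]

/-- The matched case: the reference is the joint law itself, so the relative entropy is zero. -/
lemma memLp_noiseEst_condDistrib (hz : Measurable z) (hε : Measurable ε)
    (hs : Measurable s) (hεlaw : μ.map ε = stdGaussian (EuclideanSpace ℝ (Fin d)))
    (hεs : IndepFun ε (fun ω => (z ω, s ω)) μ) (γ : ℝ) :
    MemLp (fun ω => noiseEst (condDistrib z s μ (s ω)) γ (z ω + Real.exp (-(γ / 2)) • ε ω)) 2 μ := by
  have := Measure.isProbabilityMeasure_map (μ := μ) hs.aemeasurable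
  refine memLp_noiseEst_observation (ν := μ.map s) hz hε hs hεlaw hεs ?_ γ
  rw [compProd_map_condDistrib hz.aemeasurable, klDiv_self]
  simp

/-- The bias-variance decomposition of the denoising error of the noise estimate built from another
conditional law. -/
lemma integral_sq_norm_sub_noiseEst (hz : Measurable z) (hε : Measurable ε)
    (hs : Measurable s) (hεlaw : μ.map ε = stdGaussian (EuclideanSpace ℝ (Fin d)))
    (hεs : IndepFun ε (fun ω => (z ω, s ω)) μ) {κ : Kernel S (EuclideanSpace ℝ (Fin d))}
    [IsMarkovKernel κ] {ν : Measure S} [IsProbabilityMeasure ν]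
    (h : klDiv (μ.map fun ω => (s ω, z ω)) (ν ⊗ₘ κ) ≠ ∞) (γ : ℝ) :
    ∫ ω, ‖ε ω - noiseEst (κ (s ω)) γ (z ω + Real.exp (-(γ / 2)) • ε ω)‖ ^ 2 ∂μ =
      ∫ ω, ‖ε ω - noiseEst (condDistrib z s μ (s ω)) γ (z ω + Real.exp (-(γ / 2)) • ε ω)‖ ^ 2 ∂μ +
      ∫ ω, ‖noiseEst (condDistrib z s μ (s ω)) γ (z ω + Real.exp (-(γ / 2)) • ε ω) -
        noiseEst (κ (s ω)) γ (z ω + Real.exp (-(γ / 2)) • ε ω)‖ ^ 2 ∂μ := by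
  have hL := memLp_of_map_eq_stdGaussian hε hεlaw
  have hL1 := memLp_noiseEst_condDistrib hz hε hs hεlaw hεs γ
  have hL2 := memLp_noiseEst_observation hz hε hs hεlaw hεs h γ
  have hn1 : Measurable fun p : S × EuclideanSpace ℝ (Fin d) =>
      noiseEst (condDistrib z s μ p.1) γ p.2 :=
    (measurable_noiseEst_kernel (condDistrib z s μ)).comp
      (f := fun p : S × EuclideanSpace ℝ (Fin d) => ((γ, p.1), p.2)) (by fun_prop)
  have hn2 : Measurable fun p : S × EuclideanSpace ℝ (Fin d) => noiseEst (κ p.1) γ p.2 :=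
    (measurable_noiseEst_kernel κ).comp
      (f := fun p : S × EuclideanSpace ℝ (Fin d) => ((γ, p.1), p.2)) (by fun_prop)
  have hφ : Measurable fun p : (S × EuclideanSpace ℝ (Fin d)) × EuclideanSpace ℝ (Fin d) =>
      inner ℝ (noiseEst (condDistrib z s μ p.1.1) γ p.1.2 - noiseEst (κ p.1.1) γ p.1.2) p.2 :=
    Measurable.inner ((hn1.comp measurable_fst).sub (hn2.comp measurable_fst)) measurable_snd
  exact integral_sq_norm_sub_eq_add_of_orthogonal hL hL1 hL2
    (integral_clm_sub_noiseEst_eq_zero hz hε hs hεlaw hεs γ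
      (φ := fun p => innerSL ℝ (noiseEst (condDistrib z s μ p.1) γ p.2 - noiseEst (κ p.1) γ p.2))
      hφ.stronglyMeasurable ((hL1.sub hL2).integrable_inner (hL.sub hL1)))

/-- From `σ(-γ) = σ(γ) exp (-γ)`. Being a nonzero multiple of the additive channel, the
variance-preserving one carries the same information. -/
lemma vpNoise_eq (γ : ℝ) (x e : EuclideanSpace ℝ (Fin d)) :
    vpNoise γ x e = √(Real.sigmoid γ) • (x + Real.exp (-(γ / 2)) • e) := by
  have h : √(Real.sigmoid (-γ)) = √(Real.sigmoid γ) * Real.exp (-(γ / 2)) := by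
    rw [← Real.sigmoid_mul_rexp_neg, Real.sqrt_mul (Real.sigmoid_nonneg γ), ← neg_div,
      Real.exp_half]
  rw [vpNoise, h, smul_add, smul_smul]

/-- The MMSE estimator of the noise is the explicit noise estimate of the conditional law. -/
lemma mmseDenoiser_ae_eq (hz : Measurable z) (hε : Measurable ε)
    (hs : Measurable s) (hεlaw : μ.map ε = stdGaussian (EuclideanSpace ℝ (Fin d)))
    (hεs : IndepFun ε (fun ω => (z ω, s ω)) μ) (γ : ℝ) :
    ∀ᵐ w ∂(μ.map fun ω => (vpNoise γ (z ω) (ε ω), s ω)), mmseDenoiser μ z ε s γ w.1 w.2 =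
      noiseEst (condDistrib z s μ w.2) γ ((√(Real.sigmoid γ))⁻¹ • w.1) := by
  have hσ : √(Real.sigmoid γ) ≠ 0 := (Real.sqrt_pos.2 (Real.sigmoid_pos γ)).ne'
  have hL := memLp_of_map_eq_stdGaussian hε hεlaw
  have hL1 := memLp_noiseEst_condDistrib hz hε hs hεlaw hεs γ
  have hW : Measurable fun ω => (vpNoise γ (z ω) (ε ω), s ω) := by unfold vpNoise; fun_prop
  have hn : Measurable fun w : EuclideanSpace ℝ (Fin d) × S =>
      noiseEst (condDistrib z s μ w.2) γ ((√(Real.sigmoid γ))⁻¹ • w.1) :=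
    (measurable_noiseEst_kernel (condDistrib z s μ)).comp
      (f := fun w : EuclideanSpace ℝ (Fin d) × S => ((γ, w.2), (√(Real.sigmoid γ))⁻¹ • w.1))
      (by fun_prop)
  have hm : Measurable fun w : EuclideanSpace ℝ (Fin d) × S => mmseDenoiser μ z ε s γ w.1 w.2 :=
    (StronglyMeasurable.integral_kernel_prod_right'
      (f := fun p : (EuclideanSpace ℝ (Fin d) × S) × EuclideanSpace ℝ (Fin d) => p.2)
      measurable_snd.stronglyMeasurable).measurable
  have hY (ω : Ω) : (√(Real.sigmoid γ))⁻¹ • vpNoise γ (z ω) (ε ω) =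
      z ω + Real.exp (-(γ / 2)) • ε ω := by
    rw [vpNoise_eq, inv_smul_smul₀ hσ]
  rw [ae_map_iff hW.aemeasurable (measurableSet_eq_fun hm hn)]
  have h1 := condExp_ae_eq_integral_condDistrib' (μ := μ) hW (hL.integrable one_le_two)
  have h2 : (fun ω => noiseEst (condDistrib z s μ (s ω)) γ (z ω + Real.exp (-(γ / 2)) • ε ω))
      =ᵐ[μ] μ[ε | MeasurableSpace.comap (fun ω => (vpNoise γ (z ω) (ε ω), s ω)) inferInstance] := by
    -- The noise estimate is a function of the conditioning pair and has the right integral over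
    -- each event of that pair, by orthogonality with `φ` the indicator times the identity map.
    refine ae_eq_condExp_of_forall_setIntegral_eq hW.comap_le (hL.integrable one_le_two)
      (fun A _ _ => (hL1.integrable one_le_two).integrableOn) ?_ ?_
    · rintro _ ⟨A, hA, rfl⟩ -
      set B : Set (S × EuclideanSpace ℝ (Fin d)) :=
        (fun p => (√(Real.sigmoid γ) • p.2, p.1)) ⁻¹' A with hB
      have hBm : MeasurableSet B := by
        refine measurableSet_preimage (f := fun p : S × EuclideanSpace ℝ (Fin d) =>
          (√(Real.sigmoid γ) • p.2, p.1)) (by fun_prop) hA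
      have hWA : (fun ω => (vpNoise γ (z ω) (ε ω), s ω)) ⁻¹' A =
          {ω | (s ω, z ω + Real.exp (-(γ / 2)) • ε ω) ∈ B} := by
        ext ω
        simp [hB, vpNoise_eq]
      have hφ (ω : Ω) : B.indicator (fun _ => ContinuousLinearMap.id ℝ (EuclideanSpace ℝ (Fin d)))
          (s ω, z ω + Real.exp (-(γ / 2)) • ε ω)
          (ε ω - noiseEst (condDistrib z s μ (s ω)) γ (z ω + Real.exp (-(γ / 2)) • ε ω)) =
          ((fun ω => (vpNoise γ (z ω) (ε ω), s ω)) ⁻¹' A).indicator (fun ω => ε ω -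
            noiseEst (condDistrib z s μ (s ω)) γ (z ω + Real.exp (-(γ / 2)) • ε ω)) ω := by
        rw [hWA]
        by_cases h : (s ω, z ω + Real.exp (-(γ / 2)) • ε ω) ∈ B <;> simp [Set.indicator, h]
      have hi := (hL.integrable one_le_two).sub (hL1.integrable one_le_two)
      have h0 := integral_clm_sub_noiseEst_eq_zero hz hε hs hεlaw hεs γ
        (φ := B.indicator fun _ => ContinuousLinearMap.id ℝ (EuclideanSpace ℝ (Fin d))) (by
          have hm : Measurable ((Prod.fst ⁻¹' B).indicator
              (Prod.snd : _ × EuclideanSpace ℝ (Fin d) → EuclideanSpace ℝ (Fin d))) :=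
            measurable_snd.indicator (measurable_fst hBm)
          refine (Eq.subst (motive := Measurable) ?_ hm).stronglyMeasurable
          funext p
          by_cases h : p.1 ∈ B <;> simp [Set.indicator, h]) (by
          simp only [hφ]
          exact hi.indicator (hW hA))
      simp only [hφ] at h0
      rw [integral_indicator (hW hA), integral_sub (hL.integrable one_le_two).integrableOn
        (hL1.integrable one_le_two).integrableOn, sub_eq_zero] at h0
      exact h0.symm
    · simp only [← hY]
      exact (hn.comp (comap_measurable fun ω =>
        (vpNoise γ (z ω) (ε ω), s ω))).stronglyMeasurable.aestronglyMeasurable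
  filter_upwards [h1, h2] with ω h1 h2
  rw [hY, h2, h1]
  rfl

end NoiseIdentification

/-- Data processing in both directions. -/
lemma klDiv_map_measurableEquiv {α β : Type*} [MeasurableSpace α] [MeasurableSpace β]
    (μ ν : Measure α) [IsFiniteMeasure μ] [IsFiniteMeasure ν] (e : α ≃ᵐ β) :
    klDiv (μ.map e) (ν.map e) = klDiv μ ν := by
  refine le_antisymm (klDiv_map_le μ ν e.measurable) ?_
  have := klDiv_map_le (μ.map e) (ν.map e) e.symm.measurable
  simpa [Measure.map_map e.symm.measurable e.measurable] using this

/-! ### Denoising errors and the integrated identity in real numbers -/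

section DenoisingError

variable {Ω : Type*} [MeasurableSpace Ω] {μ : Measure Ω} [IsProbabilityMeasure μ]
  {S : Type*} [MeasurableSpace S] {d : ℕ}
  {z ε : Ω → EuclideanSpace ℝ (Fin d)} {s s' : Ω → S}

/-- Both laws are images, under the same map, of the noise law times the law of signal and
condition. This gives meaning to the estimator at `s'`: `mmseDenoiser` is determined only up to null
sets of the law of the observation with `s`. -/
lemma map_vpNoise_absolutelyContinuous (hz : Measurable z) (hε : Measurable ε) (hs : Measurable s)
    (hs' : Measurable s') (hεs : IndepFun ε (fun ω => (z ω, s ω)) μ)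
    (hεs' : IndepFun ε (fun ω => (z ω, s' ω)) μ)
    (h : μ.map (fun ω => (z ω, s' ω)) ≪ μ.map (fun ω => (z ω, s ω))) (γ : ℝ) :
    μ.map (fun ω => (vpNoise γ (z ω) (ε ω), s' ω)) ≪
      μ.map (fun ω => (vpNoise γ (z ω) (ε ω), s ω)) := by
  have hp (s : Ω → S) (hs : Measurable s) (hεs : IndepFun ε (fun ω => (z ω, s ω)) μ) :
      μ.map (fun ω => (vpNoise γ (z ω) (ε ω), s ω)) =
        ((μ.map ε).prod (μ.map fun ω => (z ω, s ω))).map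
          fun p => (vpNoise γ p.2.1 p.1, p.2.2) := by
    rw [← (indepFun_iff_map_prod_eq_prod_map_map (by fun_prop) (by fun_prop)).1 hεs,
      Measure.map_map (by unfold vpNoise; fun_prop) (by fun_prop)]
    rfl
  rw [hp s hs hεs, hp s' hs' hεs']
  exact (Measure.AbsolutelyContinuous.rfl.prod h).map (by unfold vpNoise; fun_prop)

lemma denoisingSqError_ae_eq (hz : Measurable z) (hε : Measurable ε) (hs : Measurable s)
    (hs' : Measurable s') (hεlaw : μ.map ε = stdGaussian (EuclideanSpace ℝ (Fin d)))
    (hεs : IndepFun ε (fun ω => (z ω, s ω)) μ)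
    (hεs' : IndepFun ε (fun ω => (z ω, s' ω)) μ)
    (h : μ.map (fun ω => (z ω, s' ω)) ≪ μ.map (fun ω => (z ω, s ω))) (γ : ℝ) :
    denoisingSqError μ z ε s s' γ =ᵐ[μ] fun ω => ‖ε ω -
      noiseEst (condDistrib z s μ (s' ω)) γ (z ω + Real.exp (-(γ / 2)) • ε ω)‖ ^ 2 := by
  have hσ : √(Real.sigmoid γ) ≠ 0 := (Real.sqrt_pos.2 (Real.sigmoid_pos γ)).ne'
  have h1 := (map_vpNoise_absolutelyContinuous hz hε hs hs' hεs hεs' h γ).ae_le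
    (mmseDenoiser_ae_eq hz hε hs hεlaw hεs γ)
  filter_upwards [ae_of_ae_map (by unfold vpNoise; fun_prop) h1] with ω hω
  rw [denoisingSqError, hω, vpNoise_eq, inv_smul_smul₀ hσ]

/-- The real-valued form of `klDiv_map_eq_add_lintegral_sq_noiseEst_sub`. -/
lemma integrable_and_toReal_klDiv_map_eq (hz : Measurable z) (hε : Measurable ε)
    (hs : Measurable s) (hεlaw : μ.map ε = stdGaussian (EuclideanSpace ℝ (Fin d)))
    (hεs : IndepFun ε (fun ω => (z ω, s ω)) μ) {κ : Kernel S (EuclideanSpace ℝ (Fin d))}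
    [IsMarkovKernel κ] {ν : Measure S} [IsProbabilityMeasure ν]
    (h : klDiv (μ.map fun ω => (s ω, z ω)) (ν ⊗ₘ κ) ≠ ∞) :
    Integrable (fun γ : ℝ => ∫ ω,
      ‖noiseEst (condDistrib z s μ (s ω)) γ (z ω + Real.exp (-(γ / 2)) • ε ω) -
        noiseEst (κ (s ω)) γ (z ω + Real.exp (-(γ / 2)) • ε ω)‖ ^ 2 ∂μ) ∧
    (klDiv (μ.map fun ω => (s ω, z ω)) (ν ⊗ₘ κ)).toReal = (klDiv (μ.map s) ν).toReal +
      (∫ γ : ℝ, ∫ ω, ‖noiseEst (condDistrib z s μ (s ω)) γ (z ω + Real.exp (-(γ / 2)) • ε ω) -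
        noiseEst (κ (s ω)) γ (z ω + Real.exp (-(γ / 2)) • ε ω)‖ ^ 2 ∂μ) / 2 := by
  have hn (κ : Kernel S (EuclideanSpace ℝ (Fin d))) [IsMarkovKernel κ] :
      Measurable fun p : ℝ × Ω =>
        noiseEst (κ (s p.2)) p.1 (z p.2 + Real.exp (-(p.1 / 2)) • ε p.2) :=
    (measurable_noiseEst_kernel κ).comp (f := fun p : ℝ × Ω =>
      ((p.1, s p.2), z p.2 + Real.exp (-(p.1 / 2)) • ε p.2)) (by fun_prop)
  have hn1 := hn (condDistrib z s μ)
  have hn2 := hn κ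
  set g : ℝ × Ω → ℝ := fun p => ‖noiseEst (condDistrib z s μ (s p.2)) p.1
      (z p.2 + Real.exp (-(p.1 / 2)) • ε p.2) -
        noiseEst (κ (s p.2)) p.1 (z p.2 + Real.exp (-(p.1 / 2)) • ε p.2)‖ ^ 2 with hg
  have hgm : Measurable g := (hn1.sub hn2).norm.pow_const 2
  have hgi (γ : ℝ) : Integrable (fun ω => g (γ, ω)) μ :=
    ((memLp_noiseEst_condDistrib hz hε hs hεlaw hεs γ).sub
      (memLp_noiseEst_observation hz hε hs hεlaw hεs h γ)).integrable_norm_pow (p := 2)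
      (by norm_num)
  have hG : StronglyMeasurable fun γ : ℝ => ∫ ω, g (γ, ω) ∂μ :=
    hgm.stronglyMeasurable.integral_prod_right'
  have hG0 (γ : ℝ) : 0 ≤ ∫ ω, g (γ, ω) ∂μ := integral_nonneg fun ω => by positivity
  have hkl := klDiv_map_eq_add_lintegral_sq_noiseEst_sub hz hε hs hεlaw hεs h
  have hin (γ : ℝ) : ∫⁻ ω, ENNReal.ofReal (g (γ, ω) / 2) ∂μ =
      ENNReal.ofReal ((∫ ω, g (γ, ω) ∂μ) / 2) := by
    rw [← integral_div, ofReal_integral_eq_lintegral_ofReal ((hgi γ).div_const 2)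
      (ae_of_all _ fun ω => by positivity)]
  change _ = _ + ∫⁻ γ : ℝ, ∫⁻ ω, ENNReal.ofReal (g (γ, ω) / 2) ∂μ at hkl
  simp only [hin] at hkl
  rw [hkl] at h ⊢
  obtain ⟨hR, hL⟩ := ENNReal.add_ne_top.1 h
  have hint : Integrable fun γ : ℝ => (∫ ω, g (γ, ω) ∂μ) / 2 := by
    refine ⟨(hG.measurable.div_const 2).aestronglyMeasurable, ?_⟩
    rw [hasFiniteIntegral_iff_ofReal (ae_of_all _ fun γ => div_nonneg (hG0 γ) two_pos.le)]
    exact hL.lt_top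
  refine ⟨(hint.const_mul 2).congr (ae_of_all _ fun γ => ?_), ?_⟩
  · beta_reduce
    ring
  · rw [ENNReal.toReal_add hR hL, ← ofReal_integral_eq_lintegral_ofReal hint
      (ae_of_all _ fun γ => div_nonneg (hG0 γ) two_pos.le), ENNReal.toReal_ofReal
      (integral_nonneg fun γ => div_nonneg (hG0 γ) two_pos.le), integral_div]

end DenoisingError

/-! ### The identity for the mutual information -/

theorem theorem1 {Ω : Type*} [MeasurableSpace Ω] (μ : Measure Ω) [IsProbabilityMeasure μ]
    {S : Type*} [MeasurableSpace S] [StandardBorelSpace S] [Nonempty S] {d : ℕ}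
    (z ε : Ω → EuclideanSpace ℝ (Fin d)) (s s' : Ω → S)
    (hz : Measurable z) (hε : Measurable ε) (hs : Measurable s) (hs' : Measurable s')
    -- the negative slot `s'` is drawn from `q(· | z)`
    (q : Kernel (EuclideanSpace ℝ (Fin d)) S) [IsMarkovKernel q]
    (hq : μ.map (fun ω => (z ω, s' ω)) = (μ.map z) ⊗ₘ q)
    -- standard Gaussian noise, independent of the data
    (hεlaw : μ.map ε = stdGaussian (EuclideanSpace ℝ (Fin d)))
    (hεs : IndepFun ε (fun ω => (z ω, s ω)) μ)
    (hεs' : IndepFun ε (fun ω => (z ω, s' ω)) μ)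
    -- the information quantities of the identity are finite
    (hI : mutualInformation μ z s ≠ ∞)
    (hK₁ : ∫⁻ x, klDiv (q x) (condDistrib s z μ x) ∂(μ.map z) ≠ ∞)
    (hK₂ : ∫⁻ x, klDiv (q x) (μ.map s) ∂(μ.map z) ≠ ∞) :
    (∀ γ : ℝ, Integrable (denoisingSqError μ z ε s s γ) μ) ∧
    (∀ γ : ℝ, Integrable (denoisingSqError μ z ε s s' γ) μ) ∧
    Integrable (fun γ : ℝ => denoisingGap μ z ε s s' γ) ∧
    Integrable (fun x => (klDiv (q x) (condDistrib s z μ x)).toReal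
      - (klDiv (q x) (μ.map s)).toReal) (μ.map z) ∧
    -(mutualInformation μ z s).toReal =
      (1 / 2) * (∫ γ : ℝ, denoisingGap μ z ε s s' γ) +
        ∫ x, ((klDiv (q x) (condDistrib s z μ x)).toReal
          - (klDiv (q x) (μ.map s)).toReal) ∂(μ.map z) := by
  have := Measure.isProbabilityMeasure_map (μ := μ) hs.aemeasurable
  have := Measure.isProbabilityMeasure_map (μ := μ) hz.aemeasurable
  have hzs' : Measurable fun ω => (z ω, s' ω) := by fun_prop
  have hzs : Measurable fun ω => (z ω, s ω) := by fun_prop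
  have := Measure.isProbabilityMeasure_map (μ := μ) hzs.aemeasurable
  have := Measure.isProbabilityMeasure_map (μ := μ) hzs'.aemeasurable
  -- The energy identity disintegrates over the condition, whereas the hypotheses disintegrate over
  -- the signal; exchanging the coordinates connects them.
  have hswap (t : Ω → S) (ht : Measurable t) : μ.map (fun ω => (t ω, z ω)) =
      (μ.map fun ω => (z ω, t ω)).map (MeasurableEquiv.prodComm (β := S)) := by
    rw [Measure.map_map (MeasurableEquiv.measurable _) (by fun_prop)]
    rfl
  have hprod : (μ.map s) ⊗ₘ Kernel.const S (μ.map z) =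
      ((μ.map z).prod (μ.map s)).map (MeasurableEquiv.prodComm (β := S)) := by
    rw [Measure.compProd_const]
    exact Measure.prod_swap.symm
  -- the three relative entropies
  have hE₁ : klDiv (μ.map fun ω => (s' ω, z ω)) ((μ.map s) ⊗ₘ condDistrib z s μ) =
      ∫⁻ x, klDiv (q x) (condDistrib s z μ x) ∂(μ.map z) := by
    rw [compProd_map_condDistrib hz.aemeasurable, hswap s hs, hswap s' hs',
      klDiv_map_measurableEquiv, hq, ← compProd_map_condDistrib hs.aemeasurable (X := z),
      klDiv_compProd_right]
  have hE₂ : klDiv (μ.map fun ω => (s' ω, z ω)) ((μ.map s) ⊗ₘ Kernel.const S (μ.map z)) =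
      ∫⁻ x, klDiv (q x) (μ.map s) ∂(μ.map z) := by
    rw [hprod, hswap s' hs', klDiv_map_measurableEquiv, hq, ← Measure.compProd_const,
      klDiv_compProd_right]
    simp only [Kernel.const_apply]
  have hE₃ : klDiv (μ.map fun ω => (s ω, z ω)) ((μ.map s) ⊗ₘ Kernel.const S (μ.map z)) =
      mutualInformation μ z s := by
    rw [hprod, hswap s hs, klDiv_map_measurableEquiv, mutualInformation]
  have hac : μ.map (fun ω => (z ω, s' ω)) ≪ μ.map (fun ω => (z ω, s ω)) := by
    have h : klDiv (μ.map fun ω => (z ω, s' ω)) (μ.map fun ω => (z ω, s ω)) ≠ ∞ := by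
      rw [hq, ← compProd_map_condDistrib hs.aemeasurable (X := z), klDiv_compProd_right]
      exact hK₁
    exact (klDiv_ne_top_iff.1 h).1
  have hF₁ := hE₁ ▸ hK₁
  have hF₂ := hE₂ ▸ hK₂
  have hF₃ := hE₃ ▸ hI
  -- the energy identities
  obtain ⟨hi₁, he₁⟩ := integrable_and_toReal_klDiv_map_eq hz hε hs' hεlaw hεs' hF₁
  obtain ⟨hi₂, he₂⟩ := integrable_and_toReal_klDiv_map_eq hz hε hs' hεlaw hεs' hF₂
  obtain ⟨hi₃, he₃⟩ := integrable_and_toReal_klDiv_map_eq hz hε hs hεlaw hεs hF₃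
  rw [hE₁] at he₁
  rw [hE₂] at he₂
  -- Here the marginal of the condition is the reference marginal. In `he₁` and `he₂` the marginal
  -- term is the entropy of the law of `s'` relative to that of `s`, which cancels in their
  -- difference.
  rw [hE₃, klDiv_self, ENNReal.toReal_zero, zero_add] at he₃
  simp only [Kernel.const_apply] at hi₂ hi₃ he₂ he₃
  have hL := memLp_of_map_eq_stdGaussian hε hεlaw
  have hd (γ : ℝ) := denoisingSqError_ae_eq hz hε hs hs hεlaw hεs hεs .rfl γ
  have hd' (γ : ℝ) := denoisingSqError_ae_eq hz hε hs hs' hεlaw hεs hεs' hac γ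
  -- Three bias-variance decompositions. The error of the unconditional estimate is common to `h₂`
  -- and `h₃`, and that of the optimal estimate given `s'` to `h₁` and `h₂`; both cancel.
  have hgap (γ : ℝ) : denoisingGap μ z ε s s' γ =
      (∫ ω, ‖noiseEst (condDistrib z s' μ (s' ω)) γ (z ω + Real.exp (-(γ / 2)) • ε ω) -
        noiseEst (μ.map z) γ (z ω + Real.exp (-(γ / 2)) • ε ω)‖ ^ 2 ∂μ) -
      (∫ ω, ‖noiseEst (condDistrib z s μ (s ω)) γ (z ω + Real.exp (-(γ / 2)) • ε ω) -
        noiseEst (μ.map z) γ (z ω + Real.exp (-(γ / 2)) • ε ω)‖ ^ 2 ∂μ) -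
      ∫ ω, ‖noiseEst (condDistrib z s' μ (s' ω)) γ (z ω + Real.exp (-(γ / 2)) • ε ω) -
        noiseEst (condDistrib z s μ (s' ω)) γ (z ω + Real.exp (-(γ / 2)) • ε ω)‖ ^ 2 ∂μ := by
    have h₁ := integral_sq_norm_sub_noiseEst hz hε hs' hεlaw hεs' hF₁ γ
    have h₂ := integral_sq_norm_sub_noiseEst hz hε hs' hεlaw hεs' hF₂ γ
    have h₃ := integral_sq_norm_sub_noiseEst hz hε hs hεlaw hεs hF₃ γ
    simp only [Kernel.const_apply] at h₂ h₃
    rw [denoisingGap, integral_congr_ae (hd γ), integral_congr_ae (hd' γ)]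
    linarith
  have hm₁ := measurable_klDiv_kernel q (condDistrib s z μ)
  have hm₂ : Measurable fun x => klDiv (q x) (μ.map s) :=
    measurable_klDiv_kernel q (Kernel.const _ (μ.map s))
  have ht₁ := integrable_toReal_of_lintegral_ne_top hm₁.aemeasurable hK₁
  have ht₂ := integrable_toReal_of_lintegral_ne_top hm₂.aemeasurable hK₂
  refine ⟨fun γ => ?_, fun γ => ?_, ?_, ht₁.sub ht₂, ?_⟩
  · exact ((hL.sub (memLp_noiseEst_condDistrib hz hε hs hεlaw hεs γ)).integrable_norm_pow (p := 2)
      (by norm_num)).congr (hd γ).symm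
  · exact ((hL.sub (memLp_noiseEst_observation hz hε hs' hεlaw hεs' hF₁ γ)).integrable_norm_pow
      (p := 2) (by norm_num)).congr (hd' γ).symm
  · simp only [hgap]
    exact (hi₂.sub hi₃).sub hi₁
  · have h := integral_sub (hi₂.sub hi₃) hi₁
    simp only [Pi.sub_apply] at h
    simp only [hgap]
    rw [h, integral_sub hi₂ hi₃, integral_sub ht₁ ht₂,
      integral_toReal hm₁.aemeasurable (ae_lt_top hm₁ hK₁),
      integral_toReal hm₂.aemeasurable (ae_lt_top hm₂ hK₂), he₁, he₂, he₃]
    ring
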